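/- Let $X$ be a superscheme, i.e. a space with a sheaf of supercommutative rings $\mathcal O_X=\mathcal O_X^+\oplus\mathcal O_X^-$ (odd functions having square zero) such that $(|X|,\mathcal O_X^+)$ is a scheme and $\mathcal O_X^-$ is a quasi-coherent $\mathcal O_X^+$-module. Consider the following three groupoids. (a) $\mathbb A^{0|1}$-fibrations over $X$: morphisms of superschemes $\pi:\widetilde X\to X$ such that $X$ is covered by open subsets $U$ over which $\pi$ is isomorphic to the projection $\mathbb A^{0|1}\times U\to U$, where $\mathbb A^{0|1}\times U=(U,\mathcal O_U[\theta])$ with $\theta$ odd. Morphisms are isomorphisms over $X$. (b) Pairs $(L,T)$, where $L$ is an even line bundle on $X$ (a vector bundle of rank $1|0$) and $T$ is a $\Pi L$-torsor over $X$, that is, a Zariski torsor under the sheaf of even sections of the parity shift $\Pi L$. Morphisms $(L,T)\to(L',T')$ are pairs of an isomorphism $L\to L'$ and an isomorphism $T\to T'$ equivariant with respect to it. (c) Vector bundles $V$ of rank $1|1$ on $X$ with an embedding $\mathcal O_X\to V$ such that $V/\mathcal O_X$ is a line bundle of rank $0|1$. Morphisms are isomorphisms $V\to V'$ compatible with the embeddings.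 Then the groupoids (a), (b) and (c) are equivalent. More precisely, there are an equivalence $F$ from (a) to (b) and an equivalence $G$ from (b) to (c) such that: - the composite $G\circ F$ is naturally isomorphic to the functor sending $\pi:\widetilde X\to X$ to $\mathcal O_X\to\pi_*\mathcal O_{\widetilde X}$ (an isomorphism $g$ over $X$ acting by pull-back of functions along $g^{-1}$); - if $G(L,T)=(\mathcal O_X\to V)$, then $V/\mathcal O_X\cong\Pi L^{-1}$ and $T$ is identified with the $\Pi L$-torsor of $\mathcal O_X$-linear splittings of $0\to\mathcal O_X\to V\to\Pi L^{-1}\to 0$, naturally in $(L,T)$. Explicitly: to every section $t$ of $T$ and every generator $e$ of $L$ over an open $U$ there is attached an odd section $\theta_{t,e}$ of $V$ over $U$, compatibly with restriction to smaller open sets and with morphisms of pairs $(L,T)$, such that $1,\theta_{t,e}$ is a basis of $V|_U$, $\theta_{t,ae}=a^{-1}\theta_{t,e}$ for every invertible even function $a$, and $\theta_{t+se,\,e}=\theta_{t,e}-s\cdot 1$ for every odd function $s$ on $U$. (The splitting $V|_U\to\mathcal O_U$ corresponding to $t$ is the one that vanishes on $\theta_{t,e}$.) -/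

import Mathlib

universe u

open CategoryTheory AlgebraicGeometry TopologicalSpace Opposite

/-- A superscheme: a space with a sheaf `𝒪 = 𝒪⁺ ⊕ 𝒪⁻` of supercommutative rings such that
`(|X|, 𝒪⁺)` is a scheme (the field `even`) and `𝒪⁻` is a quasi-coherent `𝒪⁺`-module (the
field `odd`). The product of two odd functions is `mul`; supercommutativity is the statement that
odd functions have square zero (hence anticommute), and even functions commute with everything.
The product of an even and an odd function is the `𝒪⁺`-module structure of `𝒪⁻`, and
`mul_assoc` is the only instance of associativity that is not part of bilinearity. -/
structure Superscheme where
  even : Scheme.{u}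
  odd : even.Modules
  isQuasicoherent : odd.IsQuasicoherent
  mul (U : even.Opens) : Γ(odd, U) →ₗ[Γ(even, U)] Γ(odd, U) →ₗ[Γ(even, U)] Γ(even, U)
  mul_self {U : even.Opens} (s : Γ(odd, U)) : mul U s s = 0
  mul_assoc {U : even.Opens} (s t r : Γ(odd, U)) : mul U s t • r = mul U t r • s
  map_mul {U V : even.Opens} (i : V ⟶ U) (s t : Γ(odd, U)) :
    even.presheaf.map i.op (mul U s t) =
      mul V (odd.presheaf.map i.op s) (odd.presheaf.map i.op t)

namespace Superscheme

/-- A morphism of superschemes: a map of spaces together with a homomorphism of sheaves of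
superrings `𝒪_Y → f_* 𝒪_X`, given on even functions by the morphism of schemes `even` (it is
local on stalks) and on odd functions by `odd`. -/
structure Hom (X Y : Superscheme.{u}) where
  even : X.even ⟶ Y.even
  odd : Y.odd ⟶ (Scheme.Modules.pushforward even).obj X.odd
  app_mul {U : Y.even.Opens} (s t : Γ(Y.odd, U)) :
    even.app U (Y.mul U s t) = X.mul (even ⁻¹ᵁ U) (odd.app U s) (odd.app U t)

/-- The identity morphism. -/
noncomputable def Hom.id (X : Superscheme.{u}) : Hom X X where
  even := 𝟙 _
  odd := (Scheme.Modules.pushforwardId X.even).inv.app X.odd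
  app_mul _ _ := rfl

/-- Composition of morphisms. -/
noncomputable def Hom.comp {X Y Z : Superscheme.{u}} (f : Hom X Y) (g : Hom Y Z) : Hom X Z where
  even := f.even ≫ g.even
  odd := g.odd ≫ (Scheme.Modules.pushforward g.even).map f.odd ≫
    (Scheme.Modules.pushforwardComp f.even g.even).hom.app X.odd
  app_mul s t := by
    have h1 := g.app_mul s t
    have h2 := f.app_mul (g.odd.app _ s) (g.odd.app _ t)
    exact (congrArg (f.even.app _) h1).trans h2

noncomputable instance : Category Superscheme.{u} where
  Hom := Hom
  id := Hom.id
  comp := Hom.comp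
  id_comp _ := rfl
  comp_id _ := rfl
  assoc _ _ _ := rfl


end Superscheme

/-- A sheaf of (`ℤ/2`-graded left) modules over the structure sheaf of a superscheme: a pair of
`𝒪⁺`-modules with multiplications `𝒪⁻ × M⁺ → M⁻` and `𝒪⁻ × M⁻ → M⁺`. -/
structure SuperModule (X : Superscheme.{u}) where
  even : X.even.Modules
  odd : X.even.Modules
  smulEven (U : X.even.Opens) : Γ(X.odd, U) →ₗ[Γ(X.even, U)] Γ(even, U) →ₗ[Γ(X.even, U)] Γ(odd, U)
  smulOdd (U : X.even.Opens) : Γ(X.odd, U) →ₗ[Γ(X.even, U)] Γ(odd, U) →ₗ[Γ(X.even, U)] Γ(even, U)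
  smulOdd_smulEven {U : X.even.Opens} (s t : Γ(X.odd, U)) (m : Γ(even, U)) :
    smulOdd U s (smulEven U t m) = X.mul U s t • m
  smulEven_smulOdd {U : X.even.Opens} (s t : Γ(X.odd, U)) (m : Γ(odd, U)) :
    smulEven U s (smulOdd U t m) = X.mul U s t • m
  map_smulEven {U V : X.even.Opens} (i : V ⟶ U) (s : Γ(X.odd, U)) (m : Γ(even, U)) :
    odd.presheaf.map i.op (smulEven U s m) =
      smulEven V (X.odd.presheaf.map i.op s) (even.presheaf.map i.op m)
  map_smulOdd {U V : X.even.Opens} (i : V ⟶ U) (s : Γ(X.odd, U)) (m : Γ(odd, U)) :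
    even.presheaf.map i.op (smulOdd U s m) =
      smulOdd V (X.odd.presheaf.map i.op s) (odd.presheaf.map i.op m)

namespace SuperModule

variable {X : Superscheme.{u}}

/-- Even (parity preserving) `𝒪_X`-linear maps. -/
@[ext]
structure Hom (M N : SuperModule X) where
  even : M.even ⟶ N.even
  odd : M.odd ⟶ N.odd
  app_smulEven {U : X.even.Opens} (s : Γ(X.odd, U)) (m : Γ(M.even, U)) :
    odd.app U (M.smulEven U s m) = N.smulEven U s (even.app U m)
  app_smulOdd {U : X.even.Opens} (s : Γ(X.odd, U)) (m : Γ(M.odd, U)) :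
    even.app U (M.smulOdd U s m) = N.smulOdd U s (odd.app U m)

instance : Category (SuperModule X) where
  Hom := Hom
  id _ := ⟨𝟙 _, 𝟙 _, fun _ _ => rfl, fun _ _ => rfl⟩
  comp f g :=
    { even := f.even ≫ g.even
      odd := f.odd ≫ g.odd
      app_smulEven := fun s m =>
        (congrArg (g.odd.app _) (f.app_smulEven s m)).trans (g.app_smulEven s _)
      app_smulOdd := fun s m =>
        (congrArg (g.even.app _) (f.app_smulOdd s m)).trans (g.app_smulOdd s _) }
  id_comp _ := rfl
  comp_id _ := rfl
  assoc _ _ _ := rfl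

variable (X) in
/-- The structure sheaf `𝒪_X` as a module over itself. -/
noncomputable def structureSheaf : SuperModule X where
  even := SheafOfModules.unit X.even.ringCatSheaf
  odd := X.odd
  smulEven U := (LinearMap.lsmul Γ(X.even, U) Γ(X.odd, U)).flip
  smulOdd U := X.mul U
  smulOdd_smulEven {U} s t m := by
    exact ((X.mul U s).map_smul m t).trans (mul_comm _ _)
  smulEven_smulOdd s t r := (X.mul_assoc s t r).symm
  map_smulEven i s m := Scheme.Modules.map_smul X.odd i m s
  map_smulOdd i s t := X.map_mul i s t

/-- The parity shift `ΠM`, with `a • Πm = (-1)^|a| Π(a • m)`. -/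
noncomputable def shift (M : SuperModule X) : SuperModule X where
  even := M.odd
  odd := M.even
  smulEven U := -M.smulOdd U
  smulOdd U := -M.smulEven U
  smulOdd_smulEven s t m := by simpa using M.smulEven_smulOdd s t m
  smulEven_smulOdd s t m := by simpa using M.smulOdd_smulEven s t m
  map_smulEven i s m := by simpa using M.map_smulOdd i s m
  map_smulOdd i s m := by simpa using M.map_smulEven i s m


/-- The direct image `f_* N` of a sheaf of modules. -/
noncomputable def pushforward {Y : Superscheme.{u}} (f : Y ⟶ X) (N : SuperModule Y) :
    SuperModule X where
  even := (Scheme.Modules.pushforward f.even).obj N.even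
  odd := (Scheme.Modules.pushforward f.even).obj N.odd
  smulEven U := LinearMap.mk₂ _
    (fun s (m : Γ(N.even, f.even ⁻¹ᵁ U)) => N.smulEven (f.even ⁻¹ᵁ U) (f.odd.app U s) m)
    (fun s t m => by
      rw [map_add (f.odd.app U).hom]
      exact LinearMap.map_add₂ (N.smulEven (f.even ⁻¹ᵁ U)) _ _ m)
    (fun a s m => by
      rw [Scheme.Modules.Hom.app_smul]
      exact LinearMap.map_smul₂ (N.smulEven (f.even ⁻¹ᵁ U)) (f.even.app U a) _ m)
    (fun s m n => map_add (N.smulEven (f.even ⁻¹ᵁ U) (f.odd.app U s)) m n)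
    (fun a s (m : Γ(N.even, f.even ⁻¹ᵁ U)) =>
      map_smul (N.smulEven (f.even ⁻¹ᵁ U) (f.odd.app U s)) (f.even.app U a) m)
  smulOdd U := LinearMap.mk₂ _
    (fun s (m : Γ(N.odd, f.even ⁻¹ᵁ U)) => N.smulOdd (f.even ⁻¹ᵁ U) (f.odd.app U s) m)
    (fun s t m => by
      rw [map_add (f.odd.app U).hom]
      exact LinearMap.map_add₂ (N.smulOdd (f.even ⁻¹ᵁ U)) _ _ m)
    (fun a s m => by
      rw [Scheme.Modules.Hom.app_smul]
      exact LinearMap.map_smul₂ (N.smulOdd (f.even ⁻¹ᵁ U)) (f.even.app U a) _ m)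
    (fun s m n => map_add (N.smulOdd (f.even ⁻¹ᵁ U) (f.odd.app U s)) m n)
    (fun a s (m : Γ(N.odd, f.even ⁻¹ᵁ U)) =>
      map_smul (N.smulOdd (f.even ⁻¹ᵁ U) (f.odd.app U s)) (f.even.app U a) m)
  smulOdd_smulEven := fun {U} s t (m : Γ(N.even, f.even ⁻¹ᵁ U)) =>
    (N.smulOdd_smulEven (f.odd.app U s) (f.odd.app U t) m).trans
      (congrArg (fun a : Γ(Y.even, f.even ⁻¹ᵁ U) => (a • m : Γ(N.even, f.even ⁻¹ᵁ U)))
        (f.app_mul s t).symm)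
  smulEven_smulOdd := fun {U} s t (m : Γ(N.odd, f.even ⁻¹ᵁ U)) =>
    (N.smulEven_smulOdd (f.odd.app U s) (f.odd.app U t) m).trans
      (congrArg (fun a : Γ(Y.even, f.even ⁻¹ᵁ U) => (a • m : Γ(N.odd, f.even ⁻¹ᵁ U)))
        (f.app_mul s t).symm)
  map_smulEven {U V} i s m := by
    refine (N.map_smulEven ((Opens.map f.even.base).map i) (f.odd.app U s) m).trans ?_
    exact congrArg (fun s' => N.smulEven (f.even ⁻¹ᵁ V) s' _)
      (ConcreteCategory.congr_hom (f.odd.mapPresheaf.naturality i.op) s).symm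
  map_smulOdd {U V} i s m := by
    refine (N.map_smulOdd ((Opens.map f.even.base).map i) (f.odd.app U s) m).trans ?_
    exact congrArg (fun s' => N.smulOdd (f.even ⁻¹ᵁ V) s' _)
      (ConcreteCategory.congr_hom (f.odd.mapPresheaf.naturality i.op) s).symm

/-- The homomorphism `𝒪_X → f_* 𝒪_Y`. -/
noncomputable def toPushforward {Y : Superscheme.{u}} (f : Y ⟶ X) :
    structureSheaf X ⟶ pushforward f (structureSheaf Y) where
  even := SheafOfModules.unitToPushforwardObjUnit f.even.toRingCatSheafHom
  odd := f.odd
  app_smulEven s m := f.odd.app_smul m s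
  app_smulOdd s m := f.app_mul s m

lemma hom_ext {M N : SuperModule X} {φ ψ : M ⟶ N}
    (h : ∀ U (x : Γ(M.even, U)), φ.even.app U x = ψ.even.app U x)
    (h' : ∀ U (x : Γ(M.odd, U)), φ.odd.app U x = ψ.odd.app U x) : φ = ψ :=
  Hom.ext
    (Scheme.Modules.hom_ext _ _ fun U => by ext x; exact h U x)
    (Scheme.Modules.hom_ext _ _ fun U => by ext x; exact h' U x)

lemma even_w {Y Z : Superscheme.{u}} {f : Y ⟶ X} {f' : Z ⟶ X} {g : Y ⟶ Z}
    (h : g ≫ f' = f) : g.even ≫ f'.even = f.even :=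
  congrArg Superscheme.Hom.even h

lemma even_preimage {Y Z : Superscheme.{u}} {f : Y ⟶ X} {f' : Z ⟶ X} {g : Y ⟶ Z}
    (h : g ≫ f' = f) (U : X.even.Opens) : f.even ⁻¹ᵁ U = g.even ⁻¹ᵁ f'.even ⁻¹ᵁ U := by
  rw [← even_w h]; rfl

lemma odd_w {Y Z : Superscheme.{u}} {f : Y ⟶ X} {f' : Z ⟶ X} {g : Y ⟶ Z}
    (h : g ≫ f' = f) (U : X.even.Opens) (s : Γ(X.odd, U)) :
    Y.odd.presheaf.map (eqToHom (even_preimage h U)).op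
      (g.odd.app (f'.even ⁻¹ᵁ U) (f'.odd.app U s)) = f.odd.app U s := by
  subst h
  exact ConcreteCategory.congr_hom (Y.odd.presheaf.map_id _) _

/-- For `g : Y ⟶ Z` over `X`, the homomorphism `f'_* 𝒪_Z → f_* 𝒪_Y`, pull-back of functions
along `g`. -/
noncomputable def pushforwardUnitMap {Y Z : Superscheme.{u}} (f : Y ⟶ X) (f' : Z ⟶ X) (g : Y ⟶ Z)
    (h : g ≫ f' = f) :
    pushforward f' (structureSheaf Z) ⟶ pushforward f (structureSheaf Y) where
  even := (Scheme.Modules.pushforward f'.even).map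
      (SheafOfModules.unitToPushforwardObjUnit g.even.toRingCatSheafHom) ≫
    (Scheme.Modules.pushforwardComp g.even f'.even).hom.app _ ≫
    (Scheme.Modules.pushforwardCongr (even_w h)).hom.app _
  odd := (Scheme.Modules.pushforward f'.even).map g.odd ≫
    (Scheme.Modules.pushforwardComp g.even f'.even).hom.app _ ≫
    (Scheme.Modules.pushforwardCongr (even_w h)).hom.app _
  app_smulEven := fun {U} s (m : Γ(Z.even, f'.even ⁻¹ᵁ U)) => by
    have h₁ := congrArg (Y.odd.presheaf.map (eqToHom (even_preimage h U)).op)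
      (g.odd.app_smul m (f'.odd.app U s))
    have h₂ := Scheme.Modules.map_smul Y.odd (eqToHom (even_preimage h U))
      (g.even.app _ m) (g.odd.app _ (f'.odd.app U s))
    rw [odd_w h U s] at h₂
    exact h₁.trans h₂
  app_smulOdd := fun {U} s (m : Γ(Z.odd, f'.even ⁻¹ᵁ U)) => by
    have h₁ := congrArg (Y.even.presheaf.map (eqToHom (even_preimage h U)).op)
      (g.app_mul (f'.odd.app U s) m)
    have h₂ := Y.map_mul (eqToHom (even_preimage h U))
      (g.odd.app _ (f'.odd.app U s)) (g.odd.app _ m)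
    rw [odd_w h U s] at h₂
    exact h₁.trans h₂

lemma pushforwardUnitMap_even_app {Y Z : Superscheme.{u}} (f : Y ⟶ X) (f' : Z ⟶ X) (g : Y ⟶ Z)
    (h : g ≫ f' = f) (U : X.even.Opens) (a : Γ(Z.even, f'.even ⁻¹ᵁ U)) :
    (pushforwardUnitMap f f' g h).even.app U a =
      Y.even.presheaf.map (eqToHom (even_preimage h U)).op
        (g.even.app (f'.even ⁻¹ᵁ U) a) := 
  rfl

lemma pushforwardUnitMap_odd_app {Y Z : Superscheme.{u}} (f : Y ⟶ X) (f' : Z ⟶ X) (g : Y ⟶ Z)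
    (h : g ≫ f' = f) (U : X.even.Opens) (a : Γ(Z.odd, f'.even ⁻¹ᵁ U)) :
    (pushforwardUnitMap f f' g h).odd.app U a =
      Y.odd.presheaf.map (eqToHom (even_preimage h U)).op
        (g.odd.app (f'.even ⁻¹ᵁ U) a) := 
  rfl

lemma toPushforward_comp {Y Z : Superscheme.{u}} (f : Y ⟶ X) (f' : Z ⟶ X) (g : Y ⟶ Z)
    (h : g ≫ f' = f) :
    toPushforward f' ≫ pushforwardUnitMap f f' g h = toPushforward f := by
  apply hom_ext
  · intro U a
    subst h
    exact ConcreteCategory.congr_hom (Y.even.presheaf.map_id _) _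
  · intro U a
    exact odd_w h U a

lemma pushforwardUnitMap_id {Y : Superscheme.{u}} (f : Y ⟶ X) (h : 𝟙 Y ≫ f = f) :
    pushforwardUnitMap f f (𝟙 Y) h = 𝟙 _ := by
  apply hom_ext
  · intro U a
    exact ConcreteCategory.congr_hom (Y.even.presheaf.map_id _) _
  · intro U a
    exact ConcreteCategory.congr_hom (Y.odd.presheaf.map_id _) _

lemma pushforwardUnitMap_comp {Y Z W : Superscheme.{u}} (f : Y ⟶ X) (f' : Z ⟶ X) (f'' : W ⟶ X)
    (g : Y ⟶ Z) (g' : Z ⟶ W) (h : g ≫ f' = f) (h' : g' ≫ f'' = f') (h'' : (g ≫ g') ≫ f'' = f) :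
    pushforwardUnitMap f f'' (g ≫ g') h'' =
      pushforwardUnitMap f' f'' g' h' ≫ pushforwardUnitMap f f' g h := by
  subst h' h
  apply hom_ext
  · intro U (a : Γ(W.even, f''.even ⁻¹ᵁ U))
    refine (ConcreteCategory.congr_hom (Y.even.presheaf.map_id _) _).trans ?_
    refine Eq.trans ?_ (ConcreteCategory.congr_hom (Y.even.presheaf.map_id _) _).symm
    exact congrArg (g.even.app _)
      (ConcreteCategory.congr_hom (Z.even.presheaf.map_id _) (g'.even.app _ a)).symm
  · intro U (a : Γ(W.odd, f''.even ⁻¹ᵁ U))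
    refine (ConcreteCategory.congr_hom (Y.odd.presheaf.map_id _) _).trans ?_
    refine Eq.trans ?_ (ConcreteCategory.congr_hom (Y.odd.presheaf.map_id _) _).symm
    exact congrArg (g.odd.app _)
      (ConcreteCategory.congr_hom (Z.odd.presheaf.map_id _) (g'.odd.app _ a)).symm

variable (X) in
/-- The contravariant functor sending `π : Y ⟶ X` to `𝒪_X → π_* 𝒪_Y`. -/
noncomputable def pushforwardFunctor : (Over X)ᵒᵖ ⥤ Under (structureSheaf X) where
  obj Y := Under.mk (toPushforward Y.unop.hom)
  map g := Under.homMk (pushforwardUnitMap _ _ g.unop.left (Over.w g.unop))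
    (toPushforward_comp _ _ _ _)
  map_id Y := by
    apply Under.UnderMorphism.ext
    exact pushforwardUnitMap_id Y.unop.hom (Over.w (𝟙 Y.unop))
  map_comp g g' := by
    apply Under.UnderMorphism.ext
    exact pushforwardUnitMap_comp _ _ _ g'.unop.left g.unop.left (Over.w g'.unop) (Over.w g.unop)
      (Over.w (g ≫ g').unop)

/-- Even sections `e i` and odd sections `θ j` form a basis of `M` over `U`: on every open
`V ⊆ U`, each section of `M`, even or odd, is a unique `𝒪(V)`-linear combination of them (with
coefficients of the appropriate parity). That is, `M|_U ≅ 𝒪_U^{p|q}` through `e` and `θ`. -/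
def IsBasis (M : SuperModule X) {p q : ℕ} (U : X.even.Opens) (e : Fin p → Γ(M.even, U))
    (θ : Fin q → Γ(M.odd, U)) : Prop :=
  ∀ (V : X.even.Opens) (h : V ≤ U),
    Function.Bijective
      (fun c : (Fin p → Γ(X.even, V)) × (Fin q → Γ(X.odd, V)) =>
        ∑ i, c.1 i • M.even.presheaf.map (homOfLE h).op (e i) +
          ∑ j, M.smulOdd V (c.2 j) (M.odd.presheaf.map (homOfLE h).op (θ j))) ∧
    Function.Bijective
      (fun c : (Fin q → Γ(X.even, V)) × (Fin p → Γ(X.odd, V)) =>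
        ∑ j, c.1 j • M.odd.presheaf.map (homOfLE h).op (θ j) +
          ∑ i, M.smulEven V (c.2 i) (M.even.presheaf.map (homOfLE h).op (e i)))

/-- `M` is a vector bundle of rank `p|q`. -/
def IsLocallyFree (M : SuperModule X) (p q : ℕ) : Prop :=
  ∀ x : X.even, ∃ (U : X.even.Opens) (_ : x ∈ U) (e : Fin p → Γ(M.even, U))
    (θ : Fin q → Γ(M.odd, U)), M.IsBasis U e θ

/-- An even section that generates a bundle of rank `1|0` over `U`. -/
def IsGenerator (M : SuperModule X) (U : X.even.Opens) (e : Γ(M.even, U)) : Prop :=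
  M.IsBasis U (fun _ : Fin 1 => e) (fun j : Fin 0 => j.elim0)

/-- Exactness of `0 → A → B → C → 0` as a sequence of sheaves of abelian groups. -/
def IsShortExactSheaf {Z : Scheme.{u}} {A B C : Z.Modules} (f : A ⟶ B) (g : B ⟶ C) : Prop :=
  (∀ U : Z.Opens, Function.Injective (f.app U)) ∧
  (∀ (U : Z.Opens) (b : Γ(B, U)), g.app U b = 0 ↔ ∃ a : Γ(A, U), f.app U a = b) ∧
  (∀ (U : Z.Opens) (c : Γ(C, U)) (x : Z), x ∈ U → ∃ (V : Z.Opens) (_ : x ∈ V) (h : V ≤ U)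
    (b : Γ(B, V)), g.app V b = C.presheaf.map (homOfLE h).op c)

/-- Exactness of `0 → A → B → C → 0` for sheaves of modules over a superscheme. -/
def IsShortExact {A B C : SuperModule X} (f : A ⟶ B) (g : B ⟶ C) : Prop :=
  IsShortExactSheaf f.even g.even ∧ IsShortExactSheaf f.odd g.odd

end SuperModule

open SuperModule

/-- Over the open `U ⊆ X`, the morphism `π : Y ⟶ X` is isomorphic to the projection
`𝔸^{0|1} × U → U`. Since `𝔸^{0|1} × U` is the space `U` with the sheaf of superrings
`𝒪_U[θ] = 𝒪_U ⊕ 𝒪_U θ`, with `θ` odd, this says that `π⁻¹(U) → U` is a homeomorphism and that there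
is an odd function `θ` on `π⁻¹(U)` such that `1, θ` is a basis of `π_* 𝒪_Y` over `𝒪_U`. -/
def IsTrivialOver {X Y : Superscheme.{u}} (π : Y ⟶ X) (U : X.even.Opens) : Prop :=
  IsHomeomorph ((U : Set X.even).restrictPreimage π.even) ∧
  ∃ θ : Γ(Y.odd, π.even ⁻¹ᵁ U),
    (pushforward π (structureSheaf Y)).IsBasis U
      (fun _ : Fin 1 => (1 : Γ(Y.even, π.even ⁻¹ᵁ U))) (fun _ : Fin 1 => θ)

/-- `π : Y ⟶ X` is a (Zariski locally trivial) `𝔸^{0|1}`-fibration. -/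
def IsA01Fibration {X Y : Superscheme.{u}} (π : Y ⟶ X) : Prop :=
  ∀ x : X.even, ∃ U : X.even.Opens, x ∈ U ∧ IsTrivialOver π U

/-- The groupoid of `𝔸^{0|1}`-fibrations over `X` and isomorphisms over `X`. -/
abbrev A01Fibration (X : Superscheme.{u}) : Type (u + 1) :=
  Core (ObjectProperty.FullSubcategory fun Y : Over X => IsA01Fibration Y.hom)

/-- An embedding `𝒪_X → V` into a bundle of rank `1|1` whose quotient is a line bundle of
rank `0|1`. -/
def IsBundleExtension {X : Superscheme.{u}} (E : Under (structureSheaf X)) : Prop :=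
  E.right.IsLocallyFree 1 1 ∧
    ∃ (M : SuperModule X) (q : E.right ⟶ M), M.IsLocallyFree 0 1 ∧ IsShortExact E.hom q

/-- The groupoid of `1|1`-bundles `V` with an embedding `𝒪_X → V` whose quotient is a line bundle
of rank `0|1`; morphisms are isomorphisms `V ≅ V'` compatible with the embeddings. -/
abbrev BundleExtension (X : Superscheme.{u}) : Type (u + 1) :=
  Core (ObjectProperty.FullSubcategory fun E : Under (structureSheaf X) => IsBundleExtension E)

/-- A torsor under a sheaf `G` of abelian groups: a sheaf of sets, locally non-empty, with an
action of `G` that is simply transitive on sections. -/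
structure SheafTorsor {Z : TopCat.{u}} (G : TopCat.Presheaf Ab.{u} Z) where
  sections : TopCat.Sheaf (Type u) Z
  vadd (U : Opens Z) : G.obj (op U) → sections.presheaf.obj (op U) → sections.presheaf.obj (op U)
  zero_vadd {U : Opens Z} (t : sections.presheaf.obj (op U)) : vadd U 0 t = t
  add_vadd {U : Opens Z} (g g' : G.obj (op U)) (t : sections.presheaf.obj (op U)) :
    vadd U (g + g') t = vadd U g (vadd U g' t)
  map_vadd {U V : Opens Z} (i : V ⟶ U) (g : G.obj (op U)) (t : sections.presheaf.obj (op U)) :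
    sections.presheaf.map i.op (vadd U g t) =
      vadd V (G.map i.op g) (sections.presheaf.map i.op t)
  existsUnique_vadd {U : Opens Z} (t t' : sections.presheaf.obj (op U)) : ∃! g, vadd U g t = t'
  locally_nonempty (x : Z) : ∃ U : Opens Z, x ∈ U ∧ Nonempty (sections.presheaf.obj (op U))

/-- A pair `(L, T)` of an even line bundle `L` (a bundle of rank `1|0`) on `X` and a `ΠL`-torsor
`T`, i.e. a torsor under the sheaf of even sections of `ΠL`. -/
structure LineTorsorPair (X : Superscheme.{u}) where
  line : SuperModule X
  isLine : line.IsLocallyFree 1 0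
  torsor : SheafTorsor line.shift.even.presheaf

namespace LineTorsorPair

variable {X : Superscheme.{u}}

/-- The sections over `U` of the torsor. -/
abbrev sec (P : LineTorsorPair X) (U : X.even.Opens) : Type u :=
  P.torsor.sections.presheaf.obj (op U)

/-- A morphism `(L, T) ⟶ (L', T')`: a homomorphism `L ⟶ L'` and a map `T ⟶ T'` that is
equivariant with respect to it. -/
structure Hom (P Q : LineTorsorPair X) where
  line : P.line ⟶ Q.line
  torsor : P.torsor.sections.presheaf ⟶ Q.torsor.sections.presheaf
  app_vadd {U : X.even.Opens} (l : Γ(P.line.odd, U)) (t : P.sec U) :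
    torsor.app (op U) (P.torsor.vadd U l t) =
      Q.torsor.vadd U (line.odd.app U l) (torsor.app (op U) t)

instance : Category (LineTorsorPair X) where
  Hom := Hom
  id _ := ⟨𝟙 _, 𝟙 _, fun _ _ => rfl⟩
  comp f g :=
    { line := f.line ≫ g.line
      torsor := f.torsor ≫ g.torsor
      app_vadd := fun l t =>
        (congrArg (g.torsor.app _) (f.app_vadd l t)).trans (g.app_vadd _ _) }
  id_comp _ := rfl
  comp_id _ := rfl
  assoc _ _ _ := rfl

end LineTorsorPair

/-- The groupoid of pairs (even line bundle `L`, `ΠL`-torsor). -/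
abbrev LineTorsor (X : Superscheme.{u}) : Type (u + 1) := Core (LineTorsorPair X)

/-- `E = (𝒪_X → V)` is the extension associated with the pair `(L, T)`. For a section `t` of `T` and a
generator `e` of `L` over `U`, `coord t e` is the odd section of `V` that spans, together with
`1 ∈ 𝒪_U ⊆ V|_U`, the bundle `V|_U`; it depends on `e` as the dual generator `e⁻¹` of `L⁻¹` does, and
translating `t` by `s • e`, `s` an odd function, translates `coord t e` by `-s`. In other
words, the class of `coord t e` in `V/𝒪_X` is `Πe⁻¹`, which identifies `V/𝒪_X` with `ΠL⁻¹`, and the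
sections `t` of `T` are identified with the `𝒪_X`-linear splittings `V → 𝒪_X` (`t` corresponding to
the one that vanishes on `coord t e`), on which `ΠL` acts by translations. -/
structure AssociatedExtension {X : Superscheme.{u}} (P : LineTorsorPair X)
    (E : Under (structureSheaf X)) where
  coord {U : X.even.Opens} (t : P.sec U) (e : Γ(P.line.even, U)) (he : P.line.IsGenerator U e) :
    Γ(E.right.odd, U)
  map_coord {U V : X.even.Opens} (i : V ⟶ U) (t : P.sec U) (e : Γ(P.line.even, U))
    (he : P.line.IsGenerator U e)
    (he' : P.line.IsGenerator V (P.line.even.presheaf.map i.op e)) :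
    E.right.odd.presheaf.map i.op (coord t e he) =
      coord (P.torsor.sections.presheaf.map i.op t) (P.line.even.presheaf.map i.op e) he'
  isBasis {U : X.even.Opens} (t : P.sec U) (e : Γ(P.line.even, U))
    (he : P.line.IsGenerator U e) :
    E.right.IsBasis U (fun _ : Fin 1 => E.hom.even.app U (1 : Γ(X.even, U)))
      (fun _ : Fin 1 => coord t e he)
  coord_smul {U : X.even.Opens} (t : P.sec U) (e : Γ(P.line.even, U)) (a b : Γ(X.even, U))
    (hab : a * b = 1) (he : P.line.IsGenerator U e) (he' : P.line.IsGenerator U (a • e)) :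
    coord t (a • e) he' = b • coord t e he
  coord_vadd {U : X.even.Opens} (t : P.sec U) (e : Γ(P.line.even, U))
    (he : P.line.IsGenerator U e) (s : Γ(X.odd, U)) :
    coord (P.torsor.vadd U (P.line.smulEven U s e) t) e he =
      coord t e he - E.right.smulEven U s (E.hom.even.app U (1 : Γ(X.even, U)))

/-- The functor `(𝒪_X → V) ↦ (𝒪_X → V)` forgetting that `V` is a bundle. -/
noncomputable abbrev BundleExtension.forget (X : Superscheme.{u}) :
    BundleExtension X ⥤ Under (structureSheaf X) :=
  Core.inclusion _ ⋙ ObjectProperty.ι _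

/-- The functor `(π : Y ⟶ X) ↦ (𝒪_X → π_* 𝒪_Y)` on the groupoid of `𝔸^{0|1}`-fibrations; an
isomorphism `g : Y ≅ Y'` over `X` acts by pull-back of functions along `g⁻¹`. -/
noncomputable abbrev A01Fibration.directImage (X : Superscheme.{u}) :
    A01Fibration X ⥤ Under (structureSheaf X) :=
  (Groupoid.invEquivalence _).functor ⋙ (Core.inclusion _ ⋙ ObjectProperty.ι _).op ⋙
    pushforwardFunctor X

/-!
Let `𝒪_X → V` be an extension by a line bundle of rank `0|1`. Locally on `X` it has a frame: an odd
section `θ` such that `1, θ` is a basis of `V`. Two frames over the same open set are related by an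
invertible affine substitution `θ' = u θ + γ`, with `u` an invertible even and `γ` an odd function.
The same affine transformations relate the pairs `(t, e)` of a section of `T` and a generator of
`L`, by `e = u e'` and `t = t' + γ e'`. Affine cocycles (`AffineCocycle`) are therefore the common
description of fibrations, of pairs and of extensions, and the proof consists in passing from a
cocycle to one of the geometric objects and back.

*Pairs and extensions.* The cocycle of a pair is indexed by all pairs `(t, e)` over all open sets
(`LineTorsorPair.cocycle`), so that no cover has to be chosen, and it twists the free module
on `1, θ` into an extension (`AffineCocycle.ext`) whose frames are attached to the pairs `(t, e)`.
Conversely the frames of an extension define a cocycle (`SuperExtension.cocycle`), hence a pair. A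
homomorphism of extensions is determined by the images of frames, and can be prescribed on them
compatibly with affine substitutions (`SuperExtension.exists_hom_of_frames`); likewise for pairs
(`AssociatedExtension.exists_iso_of_match`). So `LineTorsorPair.extensionFunctor` is an
equivalence.

*Fibrations and extensions.* The direct image of the functions on a fibration is an extension with
local frames. Conversely, affine substitutions respect the multiplication of `𝒪[θ]`, so the even
sections of the extension of a cocycle form a sheaf of `𝒪_X⁺`-algebras over which the odd sections
form a module. The total space is the relative spectrum of the even sections, with the odd sections
as odd functions (`AffineCocycle.totalSpace`). An even section `a + α θ` differs from the function
`a` by an element of square zero, so the projection is a homeomorphism, and a function `a + α θ` is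
invertible exactly where `a` is; this gives the quasi-coherence of the odd functions.

That the functor from fibrations to extensions is fully faithful comes from the same two facts. A
homomorphism of extensions between direct images is determined by what it does to a local `θ`, and
is automatically multiplicative (`SuperExtension.evenMap_mul`); as the projections are
homeomorphisms, it defines a morphism of ringed spaces over `X`, which is local because functions
are pulled back from `X` up to nilpotents (`SuperExtension.isLocalHom_stalkMap`).

The equivalence from fibrations to pairs is the functor from fibrations to extensions followed by
an inverse of the functor from pairs to extensions.
-/

/-! ### Gluing of sections and of homomorphisms -/

namespace AlgebraicGeometry.Scheme

/-- Restriction of functions. -/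
noncomputable def res (Z : Scheme.{u}) {U V : Z.Opens} (h : V ≤ U) : Γ(Z, U) →+* Γ(Z, V) :=
  (Z.presheaf.map (homOfLE h).op).hom

@[simp]
lemma res_res (Z : Scheme.{u}) {U V W : Z.Opens} (h : V ≤ U) (h' : W ≤ V) (a : Γ(Z, U)) :
    Z.res h' (Z.res h a) = Z.res (h'.trans h) a :=
  (ConcreteCategory.congr_hom (Z.presheaf.map_comp (homOfLE h).op (homOfLE h').op) a).symm

@[simp]
lemma res_self (Z : Scheme.{u}) {U : Z.Opens} (h : U ≤ U) (a : Γ(Z, U)) : Z.res h a = a :=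
  ConcreteCategory.congr_hom (Z.presheaf.map_id (op U)) a

namespace Modules

variable {Z : Scheme.{u}}

/-- Restriction of sections of a sheaf of modules. -/
noncomputable def res (M : Z.Modules) {U V : Z.Opens} (h : V ≤ U) : Γ(M, U) →+ Γ(M, V) :=
  (M.presheaf.map (homOfLE h).op).hom

@[simp]
lemma res_res (M : Z.Modules) {U V W : Z.Opens} (h : V ≤ U) (h' : W ≤ V) (a : Γ(M, U)) :
    M.res h' (M.res h a) = M.res (h'.trans h) a :=
  (ConcreteCategory.congr_hom (M.presheaf.map_comp (homOfLE h).op (homOfLE h').op) a).symm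

@[simp]
lemma res_self (M : Z.Modules) {U : Z.Opens} (h : U ≤ U) (a : Γ(M, U)) : M.res h a = a :=
  ConcreteCategory.congr_hom (M.presheaf.map_id (op U)) a

@[simp]
lemma res_smul (M : Z.Modules) {U V : Z.Opens} (h : V ≤ U) (a : Γ(Z, U)) (x : Γ(M, U)) :
    M.res h (a • x) = Z.res h a • M.res h x :=
  M.map_smul (homOfLE h) a x

@[simp]
lemma Hom.app_res {M N : Z.Modules} (f : M ⟶ N) {U V : Z.Opens} (h : V ≤ U) (x : Γ(M, U)) :
    f.app V (M.res h x) = N.res h (f.app U x) :=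
  ConcreteCategory.congr_hom (f.mapPresheaf.naturality (homOfLE h).op) x

lemma map_eq_res (M : Z.Modules) {U V : Z.Opens} (i : V ⟶ U) (x : Γ(M, U)) :
    M.presheaf.map i.op x = M.res i.le x := rfl

end Modules

end AlgebraicGeometry.Scheme

namespace TopCat.Sheaf

open Limits

universe v w

variable {C : Type w} [Category.{v} C] {FC : C → C → Type*} {CC : C → Type u}
  [∀ X Y, FunLike (FC X Y) (CC X) (CC Y)] [ConcreteCategory C FC]
  [HasLimitsOfSize.{u, u} C] [(CategoryTheory.forget C).ReflectsIsomorphisms]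
  [PreservesLimitsOfSize.{u, u} (CategoryTheory.forget C)] {Z : TopCat.{u}}

lemma eq_of_locally (F : Sheaf C Z) {U : Opens Z} (s t : ToType (F.1.obj (op U)))
    (h : ∀ x ∈ U, ∃ (V : Opens Z) (hV : V ≤ U), x ∈ V ∧
      F.1.map (homOfLE hV).op s = F.1.map (homOfLE hV).op t) : s = t := by
  choose V hV hx hs using h
  refine F.eq_of_locally_eq' (fun x : U => V x.1 x.2) U (fun x => homOfLE (hV x.1 x.2)) ?_ s t
    (fun x => hs x.1 x.2)
  intro x hx'
  exact Opens.mem_iSup.2 ⟨⟨x, hx'⟩, hx x hx'⟩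

/-- If a property `R`, stable under restriction, holds locally for some section and determines it,
then there is a global section restricting to every section with that property. -/
lemma exists_glue (F : Sheaf C Z) {U : Opens Z}
    (R : ∀ V : Opens Z, V ≤ U → ToType (F.1.obj (op V)) → Prop)
    (hres : ∀ (V W : Opens Z) (hV : V ≤ U) (h : W ≤ V) s, R V hV s →
      R W (h.trans hV) (F.1.map (homOfLE h).op s))
    (hex : ∀ x ∈ U, ∃ (V : Opens Z) (hV : V ≤ U), x ∈ V ∧ ∃ s, R V hV s)
    (huniq : ∀ (V : Opens Z) (hV : V ≤ U) s t, R V hV s → R V hV t → s = t) :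
    ∃ s : ToType (F.1.obj (op U)), ∀ (V : Opens Z) (hV : V ≤ U) t, R V hV t →
      F.1.map (homOfLE hV).op s = t := by
  choose V hV hx s hs using hex
  obtain ⟨g, hg, -⟩ := F.existsUnique_gluing' (fun x : U => V x.1 x.2) U
    (fun x => homOfLE (hV x.1 x.2))
    (fun x hx' => Opens.mem_iSup.2 ⟨⟨x, hx'⟩, hx x hx'⟩) (fun x => s x.1 x.2) (by
      intro x y
      exact huniq (V x.1 x.2 ⊓ V y.1 y.2) (inf_le_left.trans (hV _ _)) _ _
        (hres _ _ _ inf_le_left _ (hs x.1 x.2)) (hres _ _ _ inf_le_right _ (hs y.1 y.2)))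
  refine ⟨g, fun W hW t ht => F.eq_of_locally _ _ fun x hxW => ?_⟩
  refine ⟨W ⊓ V x (hW hxW), inf_le_left, ⟨hxW, hx _ _⟩, ?_⟩
  refine huniq _ (inf_le_left.trans hW) _ _ ?_ (hres _ _ hW inf_le_left _ ht)
  have h2 := hres _ _ (hV x (hW hxW)) (inf_le_right : W ⊓ V x (hW hxW) ≤ _) _ (hs x (hW hxW))
  rw [← hg ⟨x, hW hxW⟩] at h2
  rw [← ConcreteCategory.comp_apply, ← F.1.map_comp] at h2 ⊢
  exact h2

end TopCat.Sheaf

namespace AlgebraicGeometry.Scheme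

variable (Z : Scheme.{u})

lemma eq_of_locally {U : Z.Opens} {s t : Γ(Z, U)}
    (h : ∀ x ∈ U, ∃ (V : Z.Opens) (hV : V ≤ U), x ∈ V ∧ Z.res hV s = Z.res hV t) : s = t :=
  TopCat.Sheaf.eq_of_locally (F := Z.sheaf) s t h

lemma exists_glue {U : Z.Opens} (R : ∀ V : Z.Opens, V ≤ U → Γ(Z, V) → Prop)
    (hres : ∀ (V W : Z.Opens) (hV : V ≤ U) (h : W ≤ V) s, R V hV s →
      R W (h.trans hV) (Z.res h s))
    (hex : ∀ x ∈ U, ∃ (V : Z.Opens) (hV : V ≤ U), x ∈ V ∧ ∃ s, R V hV s)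
    (huniq : ∀ (V : Z.Opens) (hV : V ≤ U) s t, R V hV s → R V hV t → s = t) :
    ∃ s : Γ(Z, U), ∀ (V : Z.Opens) (hV : V ≤ U) t, R V hV t → Z.res hV s = t :=
  TopCat.Sheaf.exists_glue (F := Z.sheaf) R hres hex huniq

end AlgebraicGeometry.Scheme

namespace AlgebraicGeometry.Scheme.Modules

variable {Z : Scheme.{u}}

lemma eq_of_locally (M : Z.Modules) {U : Z.Opens} {s t : Γ(M, U)}
    (h : ∀ x ∈ U, ∃ (V : Z.Opens) (hV : V ≤ U), x ∈ V ∧ M.res hV s = M.res hV t) : s = t :=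
  TopCat.Sheaf.eq_of_locally (F := ⟨M.presheaf, M.isSheaf⟩) s t h

lemma exists_glue (M : Z.Modules) {U : Z.Opens} (R : ∀ V : Z.Opens, V ≤ U → Γ(M, V) → Prop)
    (hres : ∀ (V W : Z.Opens) (hV : V ≤ U) (h : W ≤ V) s, R V hV s →
      R W (h.trans hV) (M.res h s))
    (hex : ∀ x ∈ U, ∃ (V : Z.Opens) (hV : V ≤ U), x ∈ V ∧ ∃ s, R V hV s)
    (huniq : ∀ (V : Z.Opens) (hV : V ≤ U) s t, R V hV s → R V hV t → s = t) :
    ∃ s : Γ(M, U), ∀ (V : Z.Opens) (hV : V ≤ U) t, R V hV t → M.res hV s = t :=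
  TopCat.Sheaf.exists_glue (F := ⟨M.presheaf, M.isSheaf⟩) R hres hex huniq

/-- A homomorphism of sheaves of modules, from its values on sections. -/
noncomputable def homMk {M N : Z.Modules} (φ : ∀ U : Z.Opens, Γ(M, U) →ₗ[Γ(Z, U)] Γ(N, U))
    (hφ : ∀ {U V : Z.Opens} (h : V ≤ U) (x : Γ(M, U)), φ V (M.res h x) = N.res h (φ U x)) :
    M ⟶ N :=
  ⟨PresheafOfModules.homMk
    { app := fun U => AddCommGrpCat.ofHom (φ U.unop).toAddMonoidHom
      naturality := fun U V i => by
        ext x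
        exact hφ i.unop.le x }
    (fun U r m => (φ U.unop).map_smul r m)⟩

@[simp]
lemma homMk_app {M N : Z.Modules} (φ : ∀ U : Z.Opens, Γ(M, U) →ₗ[Γ(Z, U)] Γ(N, U))
    (hφ : ∀ {U V : Z.Opens} (h : V ≤ U) (x : Γ(M, U)), φ V (M.res h x) = N.res h (φ U x))
    (U : Z.Opens) (x : Γ(M, U)) : (homMk φ hφ).app U x = φ U x := rfl

/-- A relation between sections of two sheaves of modules that is additive, linear, stable under
restriction and locally the graph of a map is contained in the graph of a homomorphism. -/
lemma exists_hom_of_rel (M N : Z.Modules) (R : ∀ V : Z.Opens, Γ(M, V) → Γ(N, V) → Prop)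
    (hres : ∀ (V W : Z.Opens) (h : W ≤ V) s t, R V s t → R W (M.res h s) (N.res h t))
    (hex : ∀ (U : Z.Opens) (s : Γ(M, U)), ∀ x ∈ U, ∃ (V : Z.Opens) (hV : V ≤ U), x ∈ V ∧
      ∃ t, R V (M.res hV s) t)
    (huniq : ∀ (V : Z.Opens) s t t', R V s t → R V s t' → t = t')
    (hadd : ∀ (V : Z.Opens) s t s' t', R V s t → R V s' t' → R V (s + s') (t + t'))
    (hsmul : ∀ (V : Z.Opens) (a : Γ(Z, V)) s t, R V s t → R V (a • s) (a • t)) :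
    ∃ f : M ⟶ N, ∀ V s t, R V s t → f.app V s = t := by
  have key : ∀ (U : Z.Opens) (s : Γ(M, U)), ∃ t : Γ(N, U), ∀ (V : Z.Opens) (hV : V ≤ U) t',
      R V (M.res hV s) t' → N.res hV t = t' := fun U s =>
    N.exists_glue (fun V hV t => R V (M.res hV s) t)
      (fun V W hV h t ht => by simpa using hres V W h _ _ ht) (hex U s)
      (fun V hV t t' h h' => huniq V _ t t' h h')
  choose φ hφ using key
  have hex2 : ∀ (U : Z.Opens) (s s' : Γ(M, U)), ∀ x ∈ U, ∃ (V : Z.Opens) (hV : V ≤ U), x ∈ V ∧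
      (∃ t, R V (M.res hV s) t) ∧ ∃ t, R V (M.res hV s') t := by
    intro U s s' x hx
    obtain ⟨V, hV, hxV, t, ht⟩ := hex U s x hx
    obtain ⟨V', hV', hxV', t', ht'⟩ := hex U s' x hx
    refine ⟨V ⊓ V', inf_le_left.trans hV, ⟨hxV, hxV'⟩, ⟨N.res inf_le_left t, ?_⟩,
      ⟨N.res inf_le_right t', ?_⟩⟩
    · simpa using hres _ _ (inf_le_left : V ⊓ V' ≤ V) _ _ ht
    · simpa using hres _ _ (inf_le_right : V ⊓ V' ≤ V') _ _ ht'
  refine ⟨homMk (fun U =>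
    { toFun := φ U
      map_add' := fun s s' => N.eq_of_locally fun x hx => ?_
      map_smul' := fun a s => N.eq_of_locally fun x hx => ?_ }) ?_, ?_⟩
  · obtain ⟨V, hV, hxV, ⟨t, ht⟩, ⟨t', ht'⟩⟩ := hex2 U s s' x hx
    refine ⟨V, hV, hxV, ?_⟩
    rw [map_add, hφ U s V hV t ht, hφ U s' V hV t' ht']
    exact hφ U _ V hV _ (by rw [map_add]; exact hadd _ _ _ _ _ ht ht')
  · obtain ⟨V, hV, hxV, t, ht⟩ := hex U s x hx
    refine ⟨V, hV, hxV, ?_⟩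
    rw [RingHom.id_apply, res_smul, hφ U s V hV t ht]
    exact hφ U _ V hV _ (by rw [res_smul]; exact hsmul _ _ _ _ ht)
  · intro U V h s
    refine N.eq_of_locally fun x hx => ?_
    obtain ⟨W, hW, hxW, t, ht⟩ := hex U s x (h hx)
    refine ⟨V ⊓ W, inf_le_left, ⟨hx, hxW⟩, ?_⟩
    have h1 := hres _ _ (inf_le_right : V ⊓ W ≤ W) _ _ ht
    rw [res_res] at h1
    have h2 := hφ V (M.res h s) (V ⊓ W) inf_le_left (N.res inf_le_right t) (by rwa [res_res])
    refine h2.trans ?_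
    rw [← hφ U s W hW t ht]
    simp
  · intro V s t ht
    have := hφ V s V le_rfl t (by simpa using ht)
    simpa using this

/-- A sheaf of abelian groups with module structures on its sections, compatible with
restriction, as a sheaf of modules. -/
noncomputable def ofPresheaf (P : TopCat.Presheaf Ab.{u} Z) (hP : P.IsSheaf)
    [∀ U : Z.Opens, Module Γ(Z, U) (P.obj (op U))]
    (hsmul : ∀ {U V : Z.Opens} (i : V ⟶ U) (a : Γ(Z, U)) (x : P.obj (op U)),
      P.map i.op (a • x) = Z.presheaf.map i.op a • P.map i.op x) : Z.Modules :=
  letI : ∀ U : Z.Opensᵒᵖ, Module (Z.ringCatSheaf.obj.obj U) (P.obj U) := fun U =>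
    inferInstanceAs (Module Γ(Z, U.unop) (P.obj (op U.unop)))
  { val := PresheafOfModules.ofPresheaf (R := Z.ringCatSheaf.obj) P
      (fun _ _ f r m => hsmul f.unop r m)
    isSheaf := hP }

end AlgebraicGeometry.Scheme.Modules

/-! ### Bases of sheaves of modules over a superscheme -/

namespace Superscheme

variable {X : Superscheme.{u}} {U : X.even.Opens}

lemma mul_comm_neg (s t : Γ(X.odd, U)) : X.mul U s t = -X.mul U t s := by
  have h := X.mul_self (s + t)
  simp only [map_add, LinearMap.add_apply, X.mul_self] at h
  rw [zero_add, add_zero] at h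
  rw [eq_neg_iff_add_eq_zero, add_comm]
  exact h

@[simp]
lemma res_mul {V : X.even.Opens} (h : V ≤ U) (s t : Γ(X.odd, U)) :
    X.even.res h (X.mul U s t) = X.mul V (X.odd.res h s) (X.odd.res h t) :=
  X.map_mul (homOfLE h) s t

end Superscheme

namespace SuperModule

variable {X : Superscheme.{u}} (M : SuperModule X) {U V : X.even.Opens}

@[simp]
lemma res_smulEven (h : V ≤ U) (s : Γ(X.odd, U)) (m : Γ(M.even, U)) :
    M.odd.res h (M.smulEven U s m) = M.smulEven V (X.odd.res h s) (M.even.res h m) :=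
  M.map_smulEven (homOfLE h) s m

@[simp]
lemma res_smulOdd (h : V ≤ U) (s : Γ(X.odd, U)) (m : Γ(M.odd, U)) :
    M.even.res h (M.smulOdd U s m) = M.smulOdd V (X.odd.res h s) (M.odd.res h m) :=
  M.map_smulOdd (homOfLE h) s m

/-- An even section `e` and an odd section `θ` form a basis over `U` itself. -/
def BasisAt (U : X.even.Opens) (e : Γ(M.even, U)) (θ : Γ(M.odd, U)) : Prop :=
  Function.Bijective (fun c : Γ(X.even, U) × Γ(X.odd, U) => c.1 • e + M.smulOdd U c.2 θ) ∧
    Function.Bijective (fun c : Γ(X.even, U) × Γ(X.odd, U) => c.1 • θ + M.smulEven U c.2 e)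

lemma isBasis_one_one_iff (e : Γ(M.even, U)) (θ : Γ(M.odd, U)) :
    M.IsBasis U (fun _ : Fin 1 => e) (fun _ : Fin 1 => θ) ↔
      ∀ (V : X.even.Opens) (h : V ≤ U), M.BasisAt V (M.even.res h e) (M.odd.res h θ) := by
  refine forall₂_congr fun V h => and_congr ?_ ?_
  · rw [← (Equiv.prodCongr (Equiv.funUnique (Fin 1) Γ(X.even, V))
      (Equiv.funUnique (Fin 1) Γ(X.odd, V))).bijective.of_comp_iff]
    simp [Function.comp_def]
    rfl
  · rw [← (Equiv.prodCongr (Equiv.funUnique (Fin 1) Γ(X.even, V))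
      (Equiv.funUnique (Fin 1) Γ(X.odd, V))).bijective.of_comp_iff]
    simp [Function.comp_def]
    rfl

lemma isGenerator_iff (e : Γ(M.even, U)) :
    M.IsGenerator U e ↔ ∀ (V : X.even.Opens) (h : V ≤ U),
      Function.Bijective (fun a : Γ(X.even, V) => a • M.even.res h e) ∧
        Function.Bijective (fun a : Γ(X.odd, V) => M.smulEven V a (M.even.res h e)) := by
  refine forall₂_congr fun V h => and_congr ?_ ?_
  · rw [← ((Equiv.prodUnique (Fin 1 → Γ(X.even, V)) (Fin 0 → Γ(X.odd, V))).trans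
      (Equiv.funUnique (Fin 1) Γ(X.even, V))).bijective.of_comp_iff]
    simp [Function.comp_def]
    rfl
  · rw [← ((Equiv.uniqueProd (Fin 1 → Γ(X.odd, V)) (Fin 0 → Γ(X.even, V))).trans
      (Equiv.funUnique (Fin 1) Γ(X.odd, V))).bijective.of_comp_iff]
    simp [Function.comp_def]
    rfl

lemma isBasis_zero_one_iff (θ : Γ(M.odd, U)) :
    M.IsBasis U (fun j : Fin 0 => j.elim0) (fun _ : Fin 1 => θ) ↔
      ∀ (V : X.even.Opens) (h : V ≤ U),
      Function.Bijective (fun a : Γ(X.odd, V) => M.smulOdd V a (M.odd.res h θ)) ∧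
        Function.Bijective (fun a : Γ(X.even, V) => a • M.odd.res h θ) := by
  refine forall₂_congr fun V h => and_congr ?_ ?_
  · rw [← ((Equiv.uniqueProd (Fin 1 → Γ(X.odd, V)) (Fin 0 → Γ(X.even, V))).trans
      (Equiv.funUnique (Fin 1) Γ(X.odd, V))).bijective.of_comp_iff]
    simp [Function.comp_def]
    rfl
  · rw [← ((Equiv.prodUnique (Fin 1 → Γ(X.even, V)) (Fin 0 → Γ(X.odd, V))).trans
      (Equiv.funUnique (Fin 1) Γ(X.even, V))).bijective.of_comp_iff]
    simp [Function.comp_def]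
    rfl

variable {M}

lemma IsGenerator.res {e : Γ(M.even, U)} (he : M.IsGenerator U e) (h : V ≤ U) :
    M.IsGenerator V (M.even.res h e) := by
  rw [isGenerator_iff] at he ⊢
  intro W hW
  simpa using he W (hW.trans h)

lemma IsGenerator.bijective_smul {e : Γ(M.even, U)} (he : M.IsGenerator U e) :
    Function.Bijective (fun a : Γ(X.even, U) => a • e) := by
  simpa using ((M.isGenerator_iff e).1 he U le_rfl).1

lemma IsGenerator.bijective_smulEven {e : Γ(M.even, U)} (he : M.IsGenerator U e) :
    Function.Bijective (fun a : Γ(X.odd, U) => M.smulEven U a e) := by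
  simpa using ((M.isGenerator_iff e).1 he U le_rfl).2

lemma exists_isGenerator (hM : M.IsLocallyFree 1 0) (x : X.even) :
    ∃ (U : X.even.Opens) (_ : x ∈ U) (e : Γ(M.even, U)), M.IsGenerator U e := by
  obtain ⟨U, hx, e, θ, h⟩ := hM x
  refine ⟨U, hx, e 0, ?_⟩
  convert! h using 1

lemma IsGenerator.exists_smul_eq {e e' : Γ(M.even, U)} (he : M.IsGenerator U e)
    (he' : M.IsGenerator U e') : ∃ a b : Γ(X.even, U), a * b = 1 ∧ e' = a • e ∧ e = b • e' := by
  obtain ⟨a, rfl⟩ := he.bijective_smul.2 e'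
  obtain ⟨b, hb⟩ := he'.bijective_smul.2 e
  refine ⟨a, b, he.bijective_smul.1 ?_, rfl, hb.symm⟩
  simp only at hb ⊢
  rw [one_smul, mul_comm, mul_smul, hb]

/-- Multiplying a generator by an invertible function gives a generator. -/
lemma IsGenerator.smul {e : Γ(M.even, U)} (he : M.IsGenerator U e) {a b : Γ(X.even, U)}
    (hab : a * b = 1) : M.IsGenerator U (a • e) := by
  rw [isGenerator_iff] at he ⊢
  intro W hW
  have hab' : X.even.res hW a * X.even.res hW b = 1 := by rw [← map_mul, hab, map_one]
  obtain ⟨h1, h2⟩ := he W hW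
  have ha : IsUnit (X.even.res hW a) := .of_mul_eq_one _ hab'
  have hba : X.even.res hW b * X.even.res hW a = 1 := by rw [mul_comm, hab']
  refine ⟨?_, ?_⟩
  · convert! h1.comp (Units.mulRight ha.unit).bijective using 1
    funext c
    simp [mul_smul]
  · have hbij : Function.Bijective (fun c : Γ(X.odd, W) => X.even.res hW a • c) :=
      ⟨fun c c' hc => by
        have := congrArg (X.even.res hW b • ·) hc
        simpa [smul_smul, hba] using this,
      fun c => ⟨X.even.res hW b • c, by simp [smul_smul, hab']⟩⟩
    convert! h2.comp hbij using 1
    funext c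
    simp

end SuperModule

/-! ### Frames of an extension -/

namespace SuperExtension

variable {X : Superscheme.{u}} (E : Under (structureSheaf X)) {U V : X.even.Opens}

/-- The image of `1 ∈ 𝒪_X` in `V`. -/
noncomputable def one (U : X.even.Opens) : Γ(E.right.even, U) :=
  E.hom.even.app U (1 : Γ(X.even, U))

@[simp]
lemma res_one (h : V ≤ U) : E.right.even.res h (one E U) = one E V := by
  refine (Scheme.Modules.Hom.app_res E.hom.even h (1 : Γ(X.even, U))).symm.trans ?_
  exact congrArg (E.hom.even.app V) (map_one (X.even.res h))

lemma hom_even_app (a : Γ(X.even, U)) : E.hom.even.app U a = a • one E U := by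
  refine Eq.trans ?_ (Scheme.Modules.Hom.app_smul E.hom.even a (1 : Γ(X.even, U)))
  exact congrArg (E.hom.even.app U) (mul_one a).symm

lemma hom_odd_app (a : Γ(X.odd, U)) : E.hom.odd.app U a = E.right.smulEven U a (one E U) := by
  refine Eq.trans ?_ (E.hom.app_smulEven a (1 : Γ(X.even, U)))
  exact congrArg (E.hom.odd.app U) (one_smul Γ(X.even, U) a).symm

/-- The even section `a + α θ`. -/
noncomputable def evenComb (θ : Γ(E.right.odd, U)) (a : Γ(X.even, U)) (α : Γ(X.odd, U)) :
    Γ(E.right.even, U) :=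
  a • one E U + E.right.smulOdd U α θ

/-- The odd section `b θ + β`. -/
noncomputable def oddComb (θ : Γ(E.right.odd, U)) (b : Γ(X.even, U)) (β : Γ(X.odd, U)) :
    Γ(E.right.odd, U) :=
  b • θ + E.right.smulEven U β (one E U)

@[simp]
lemma res_evenComb (h : V ≤ U) (θ : Γ(E.right.odd, U)) (a : Γ(X.even, U)) (α : Γ(X.odd, U)) :
    E.right.even.res h (evenComb E θ a α) =
      evenComb E (E.right.odd.res h θ) (X.even.res h a) (X.odd.res h α) := by
  simp [evenComb]

@[simp]
lemma res_oddComb (h : V ≤ U) (θ : Γ(E.right.odd, U)) (a : Γ(X.even, U)) (α : Γ(X.odd, U)) :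
    E.right.odd.res h (oddComb E θ a α) =
      oddComb E (E.right.odd.res h θ) (X.even.res h a) (X.odd.res h α) := by
  simp [oddComb]

/-- An odd section `θ` is a frame of the extension over `U` if `1, θ` is a basis. -/
def IsFrame (U : X.even.Opens) (θ : Γ(E.right.odd, U)) : Prop :=
  E.right.IsBasis U (fun _ : Fin 1 => one E U) (fun _ : Fin 1 => θ)

/-- Frames exist locally. -/
def HasLocalFrames : Prop :=
  ∀ x : X.even, ∃ (U : X.even.Opens) (_ : x ∈ U) (θ : Γ(E.right.odd, U)), IsFrame E U θ

variable {E}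

lemma isFrame_iff {θ : Γ(E.right.odd, U)} : IsFrame E U θ ↔
    ∀ (V : X.even.Opens) (h : V ≤ U),
      Function.Bijective (fun c : Γ(X.even, V) × Γ(X.odd, V) =>
        evenComb E (E.right.odd.res h θ) c.1 c.2) ∧
      Function.Bijective (fun c : Γ(X.even, V) × Γ(X.odd, V) =>
        oddComb E (E.right.odd.res h θ) c.1 c.2) := by
  rw [IsFrame, isBasis_one_one_iff]
  simp only [res_one]
  rfl

lemma IsFrame.res {θ : Γ(E.right.odd, U)} (hθ : IsFrame E U θ) (h : V ≤ U) :
    IsFrame E V (E.right.odd.res h θ) := by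
  rw [isFrame_iff] at hθ ⊢
  intro W hW
  simpa using hθ W (hW.trans h)

lemma IsFrame.exists_even {θ : Γ(E.right.odd, U)} (hθ : IsFrame E U θ) (x : Γ(E.right.even, U)) :
    ∃ a α, x = evenComb E θ a α := by
  obtain ⟨c, hc⟩ := ((isFrame_iff.1 hθ) U le_rfl).1.2 x
  exact ⟨c.1, c.2, by simpa using hc.symm⟩

lemma IsFrame.exists_odd {θ : Γ(E.right.odd, U)} (hθ : IsFrame E U θ) (x : Γ(E.right.odd, U)) :
    ∃ a α, x = oddComb E θ a α := by
  obtain ⟨c, hc⟩ := ((isFrame_iff.1 hθ) U le_rfl).2.2 x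
  exact ⟨c.1, c.2, by simpa using hc.symm⟩

lemma IsFrame.even_inj {θ : Γ(E.right.odd, U)} (hθ : IsFrame E U θ) {a a' : Γ(X.even, U)}
    {α α' : Γ(X.odd, U)} (h : evenComb E θ a α = evenComb E θ a' α') : a = a' ∧ α = α' := by
  have := @((isFrame_iff.1 hθ) U le_rfl).1.1 (a, α) (a', α') (by simpa using h)
  simpa using this

lemma IsFrame.odd_inj {θ : Γ(E.right.odd, U)} (hθ : IsFrame E U θ) {a a' : Γ(X.even, U)}
    {α α' : Γ(X.odd, U)} (h : oddComb E θ a α = oddComb E θ a' α') : a = a' ∧ α = α' := by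
  have := @((isFrame_iff.1 hθ) U le_rfl).2.1 (a, α) (a', α') (by simpa using h)
  simpa using this

lemma smulOdd_smulEven_one (α β : Γ(X.odd, U)) :
    E.right.smulOdd U α (E.right.smulEven U β (one E U)) = X.mul U α β • one E U :=
  E.right.smulOdd_smulEven _ _ _

/-- Even coordinates with respect to the odd section `u θ + γ`. -/
lemma evenComb_oddComb (θ : Γ(E.right.odd, U)) (a u : Γ(X.even, U)) (α γ : Γ(X.odd, U)) :
    evenComb E (oddComb E θ u γ) a α = evenComb E θ (a + X.mul U α γ) (u • α) := by
  simp only [evenComb, oddComb, map_add, smulOdd_smulEven_one, add_smul, map_smul,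
    LinearMap.smul_apply]
  abel

/-- Odd coordinates with respect to the odd section `u θ + γ`. -/
lemma oddComb_oddComb (θ : Γ(E.right.odd, U)) (b u : Γ(X.even, U)) (β γ : Γ(X.odd, U)) :
    oddComb E (oddComb E θ u γ) b β = oddComb E θ (b * u) (b • γ + β) := by
  simp only [oddComb, map_add, smul_add, mul_smul, map_smul, LinearMap.smul_apply,
    LinearMap.add_apply]
  abel

@[simp]
lemma oddComb_one_zero (θ : Γ(E.right.odd, U)) : oddComb E θ 1 0 = θ := by
  simp [oddComb]

/-- Two frames over the same open set differ by an invertible affine transformation. -/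
lemma IsFrame.exists_eq_oddComb {θ θ' : Γ(E.right.odd, U)} (hθ : IsFrame E U θ)
    (hθ' : IsFrame E U θ') :
    ∃ (u v : Γ(X.even, U)) (γ : Γ(X.odd, U)), u * v = 1 ∧ θ' = oddComb E θ u γ := by
  obtain ⟨u, γ, rfl⟩ := hθ.exists_odd θ'
  obtain ⟨v, δ, hv⟩ := hθ'.exists_odd θ
  rw [oddComb_oddComb] at hv
  refine ⟨u, v, γ, ?_, rfl⟩
  rw [mul_comm]
  exact (hθ.odd_inj (hv.symm.trans (oddComb_one_zero θ).symm)).1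

lemma IsFrame.oddComb {θ : Γ(E.right.odd, U)} (hθ : IsFrame E U θ) {u v : Γ(X.even, U)}
    (huv : u * v = 1) (γ : Γ(X.odd, U)) : IsFrame E U (oddComb E θ u γ) := by
  rw [isFrame_iff]
  intro V h
  rw [res_oddComb]
  have huv' : X.even.res h u * X.even.res h v = 1 := by rw [← map_mul, huv, map_one]
  have hvu' : X.even.res h v * X.even.res h u = 1 := by rw [mul_comm, huv']
  have hθV := hθ.res h
  generalize X.even.res h u = u at *
  generalize X.even.res h v = v at *
  generalize X.odd.res h γ = γ at *
  generalize E.right.odd.res h θ = θ at *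
  -- Coordinates with respect to `u θ + γ` are obtained from those with respect to `θ` by dividing
  -- the coefficient of `θ` by `u` and correcting the other one.
  refine ⟨⟨fun c c' hc => ?_, fun x => ?_⟩, ⟨fun c c' hc => ?_, fun x => ?_⟩⟩
  · simp only [evenComb_oddComb] at hc
    obtain ⟨h1, h2⟩ := hθV.even_inj hc
    have h3 : c.2 = c'.2 := by
      have := congrArg (v • ·) h2
      simpa [smul_smul, hvu'] using this
    rw [h3] at h1
    exact Prod.ext (add_right_cancel h1) h3
  · obtain ⟨a, α, rfl⟩ := hθV.exists_even x
    refine ⟨(a - X.mul V (v • α) γ, v • α), ?_⟩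
    simp only [evenComb_oddComb]
    congr 1
    · abel
    · simp [smul_smul, huv']
  · simp only [oddComb_oddComb] at hc
    obtain ⟨h1, h2⟩ := hθV.odd_inj hc
    have h3 : c.1 = c'.1 := by
      have := congrArg (· * v) h1
      simpa [mul_assoc, huv'] using this
    rw [h3] at h2
    exact Prod.ext h3 (add_left_cancel h2)
  · obtain ⟨b, β, rfl⟩ := hθV.exists_odd x
    refine ⟨(b * v, β - (b * v) • γ), ?_⟩
    simp only [oddComb_oddComb]
    congr 1
    · simp [mul_assoc, hvu']
    · abel

/-- Being a frame is a local property. -/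
lemma isFrame_of_locally {θ : Γ(E.right.odd, U)}
    (h : ∀ x ∈ U, ∃ (V : X.even.Opens) (hV : V ≤ U), x ∈ V ∧ IsFrame E V (E.right.odd.res hV θ)) :
    IsFrame E U θ := by
  have h' : ∀ (W : X.even.Opens) (hW : W ≤ U), ∀ x ∈ W, ∃ (V : X.even.Opens) (hV : V ≤ W),
      x ∈ V ∧ IsFrame E V (E.right.odd.res (hV.trans hW) θ) := by
    intro W hW x hx
    obtain ⟨V, hV, hxV, hf⟩ := h x (hW hx)
    exact ⟨W ⊓ V, inf_le_left, ⟨hx, hxV⟩, by simpa using hf.res (inf_le_right : W ⊓ V ≤ V)⟩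
  have hi₀ : ∀ (W : X.even.Opens) (hW : W ≤ U) (a a' : Γ(X.even, W)) (α α' : Γ(X.odd, W)),
      evenComb E (E.right.odd.res hW θ) a α = evenComb E (E.right.odd.res hW θ) a' α' →
        a = a' ∧ α = α' := by
    intro W hW a a' α α' hc
    refine ⟨X.even.eq_of_locally fun x hx => ?_,
      X.odd.eq_of_locally fun x hx => ?_⟩ <;>
    · obtain ⟨V, hV, hxV, hf⟩ := h' W hW x hx
      refine ⟨V, hV, hxV, ?_⟩
      have := congrArg (E.right.even.res hV) hc
      rw [res_evenComb, res_evenComb, Scheme.Modules.res_res] at this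
      have := hf.even_inj this
      first | exact this.1 | exact this.2
  have hi₁ : ∀ (W : X.even.Opens) (hW : W ≤ U) (a a' : Γ(X.even, W)) (α α' : Γ(X.odd, W)),
      oddComb E (E.right.odd.res hW θ) a α = oddComb E (E.right.odd.res hW θ) a' α' →
        a = a' ∧ α = α' := by
    intro W hW a a' α α' hc
    refine ⟨X.even.eq_of_locally fun x hx => ?_,
      X.odd.eq_of_locally fun x hx => ?_⟩ <;>
    · obtain ⟨V, hV, hxV, hf⟩ := h' W hW x hx
      refine ⟨V, hV, hxV, ?_⟩
      have := congrArg (E.right.odd.res hV) hc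
      rw [res_oddComb, res_oddComb, Scheme.Modules.res_res] at this
      have := hf.odd_inj this
      first | exact this.1 | exact this.2
  rw [isFrame_iff]
  intro W hW
  refine ⟨⟨fun c c' hc => Prod.ext_iff.2 (hi₀ W hW _ _ _ _ hc), fun y => ?_⟩,
    ⟨fun c c' hc => Prod.ext_iff.2 (hi₁ W hW _ _ _ _ hc), fun y => ?_⟩⟩
  -- By uniqueness, the local coordinates of a section `y` glue.
  · obtain ⟨a, ha⟩ := X.even.exists_glue (U := W)
      (fun V hV (a : Γ(X.even, V)) => ∃ α, E.right.even.res hV y =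
        evenComb E (E.right.odd.res (hV.trans hW) θ) a α)
      (fun V V' hV hV' a ⟨α, hα⟩ => ⟨X.odd.res hV' α, by
        have := congrArg (E.right.even.res hV') hα
        rw [res_evenComb, Scheme.Modules.res_res, Scheme.Modules.res_res] at this
        exact this⟩)
      (fun x hx => by
        obtain ⟨V, hV, hxV, hf⟩ := h' W hW x hx
        exact ⟨V, hV, hxV, hf.exists_even _⟩)
      (fun V hV a a' ⟨α, hα⟩ ⟨α', hα'⟩ => (hi₀ _ _ _ _ _ _ (hα.symm.trans hα')).1)
    obtain ⟨α, hα⟩ := X.odd.exists_glue (U := W)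
      (fun V hV (α : Γ(X.odd, V)) => ∃ a, E.right.even.res hV y =
        evenComb E (E.right.odd.res (hV.trans hW) θ) a α)
      (fun V V' hV hV' α ⟨a, hα⟩ => ⟨X.even.res hV' a, by
        have := congrArg (E.right.even.res hV') hα
        rw [res_evenComb, Scheme.Modules.res_res, Scheme.Modules.res_res] at this
        exact this⟩)
      (fun x hx => by
        obtain ⟨V, hV, hxV, hf⟩ := h' W hW x hx
        obtain ⟨a, α, h⟩ := hf.exists_even (E.right.even.res hV y)
        exact ⟨V, hV, hxV, α, a, h⟩)
      (fun V hV a a' ⟨α, hα⟩ ⟨α', hα'⟩ => (hi₀ _ _ _ _ _ _ (hα.symm.trans hα')).2)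
    refine ⟨(a, α), E.right.even.eq_of_locally fun x hx => ?_⟩
    obtain ⟨V, hV, hxV, hf⟩ := h' W hW x hx
    refine ⟨V, hV, hxV, ?_⟩
    obtain ⟨a', α', h⟩ := hf.exists_even (E.right.even.res hV y)
    rw [h, res_evenComb, Scheme.Modules.res_res]
    congr 1
    · exact ha V hV a' ⟨α', h⟩
    · exact hα V hV α' ⟨a', h⟩
  · obtain ⟨a, ha⟩ := X.even.exists_glue (U := W)
      (fun V hV (a : Γ(X.even, V)) => ∃ α, E.right.odd.res hV y =
        oddComb E (E.right.odd.res (hV.trans hW) θ) a α)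
      (fun V V' hV hV' a ⟨α, hα⟩ => ⟨X.odd.res hV' α, by
        have := congrArg (E.right.odd.res hV') hα
        rw [res_oddComb, Scheme.Modules.res_res, Scheme.Modules.res_res] at this
        exact this⟩)
      (fun x hx => by
        obtain ⟨V, hV, hxV, hf⟩ := h' W hW x hx
        exact ⟨V, hV, hxV, hf.exists_odd _⟩)
      (fun V hV a a' ⟨α, hα⟩ ⟨α', hα'⟩ => (hi₁ _ _ _ _ _ _ (hα.symm.trans hα')).1)
    obtain ⟨α, hα⟩ := X.odd.exists_glue (U := W)
      (fun V hV (α : Γ(X.odd, V)) => ∃ a, E.right.odd.res hV y =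
        oddComb E (E.right.odd.res (hV.trans hW) θ) a α)
      (fun V V' hV hV' α ⟨a, hα⟩ => ⟨X.even.res hV' a, by
        have := congrArg (E.right.odd.res hV') hα
        rw [res_oddComb, Scheme.Modules.res_res, Scheme.Modules.res_res] at this
        exact this⟩)
      (fun x hx => by
        obtain ⟨V, hV, hxV, hf⟩ := h' W hW x hx
        obtain ⟨a, α, h⟩ := hf.exists_odd (E.right.odd.res hV y)
        exact ⟨V, hV, hxV, α, a, h⟩)
      (fun V hV a a' ⟨α, hα⟩ ⟨α', hα'⟩ => (hi₁ _ _ _ _ _ _ (hα.symm.trans hα')).2)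
    refine ⟨(a, α), E.right.odd.eq_of_locally fun x hx => ?_⟩
    obtain ⟨V, hV, hxV, hf⟩ := h' W hW x hx
    refine ⟨V, hV, hxV, ?_⟩
    obtain ⟨a', α', h⟩ := hf.exists_odd (E.right.odd.res hV y)
    rw [h, res_oddComb, Scheme.Modules.res_res]
    congr 1
    · exact ha V hV a' ⟨α', h⟩
    · exact hα V hV α' ⟨a', h⟩

lemma HasLocalFrames.exists_le (hE : HasLocalFrames E) {x : X.even} (hx : x ∈ U) :
    ∃ (V : X.even.Opens) (_ : V ≤ U), x ∈ V ∧ ∃ θ : Γ(E.right.odd, V), IsFrame E V θ := by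
  obtain ⟨V, hxV, θ, hθ⟩ := hE x
  exact ⟨U ⊓ V, inf_le_left, ⟨hx, hxV⟩, _, hθ.res inf_le_right⟩

end SuperExtension

/-! ### Twisted forms of a sheaf of modules -/

namespace AlgebraicGeometry.Scheme

/-- A presheaf of sets of local trivializations. All open sets are allowed, so that twisted forms
are defined without choosing a cover. -/
structure TrivSystem (Z : Scheme.{u}) where
  obj : Z.Opens → Type u
  res {U V : Z.Opens} (h : V ≤ U) : obj U → obj V
  res_self {U : Z.Opens} (b : obj U) : res le_rfl b = b
  res_res {U V W : Z.Opens} (h : V ≤ U) (h' : W ≤ V) (b : obj U) :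
    res h' (res h b) = res (h'.trans h) b

/-- Transition functions on the sections of `N` between any two local trivializations: `g b b' x`
is the coordinate with respect to `b'` of what has coordinate `x` with respect to `b`. -/
structure TwistCocycle {Z : Scheme.{u}} (N : Z.Modules) (B : TrivSystem Z) where
  g {U : Z.Opens} (b b' : B.obj U) : Γ(N, U) → Γ(N, U)
  g_self {U : Z.Opens} (b : B.obj U) (x : Γ(N, U)) : g b b x = x
  g_comp {U : Z.Opens} (b b' b'' : B.obj U) (x : Γ(N, U)) : g b' b'' (g b b' x) = g b b'' x
  res_g {U V : Z.Opens} (h : V ≤ U) (b b' : B.obj U) (x : Γ(N, U)) :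
    N.res h (g b b' x) = g (B.res h b) (B.res h b') (N.res h x)

namespace TwistCocycle

variable {Z : Scheme.{u}} {N : Z.Modules} {B : TrivSystem Z} (c : TwistCocycle N B)
  {U V : Z.Opens}

/-- A family of coordinates, one for every local trivialization over a smaller open set, that
satisfies the transition rule. -/
def IsSection (U : Z.Opens) (f : ∀ W : {W : Z.Opens // W ≤ U}, B.obj W.1 → Γ(N, W.1)) : Prop :=
  ∀ (W W' : Z.Opens) (h : W ≤ U) (h' : W' ≤ W) (b : B.obj W) (b' : B.obj W'),
    f ⟨W', h'.trans h⟩ b' = c.g (B.res h' b) b' (N.res h' (f ⟨W, h⟩ b))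

/-- Sections of the twisted sheaf. -/
abbrev Sec (U : Z.Opens) : Type u :=
  {f : ∀ W : {W : Z.Opens // W ≤ U}, B.obj W.1 → Γ(N, W.1) // c.IsSection U f}

variable {c}

/-- Restriction of sections of the twisted sheaf. -/
def Sec.res (h : V ≤ U) (f : c.Sec U) : c.Sec V :=
  ⟨fun W b => f.1 ⟨W.1, W.2.trans h⟩ b, fun W W' hW h' b b' => f.2 W W' (hW.trans h) h' b b'⟩

lemma Sec.ext_at (b : B.obj U) {f f' : c.Sec U} (h : f.1 ⟨U, le_rfl⟩ b = f'.1 ⟨U, le_rfl⟩ b) :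
    f = f' := by
  refine Subtype.ext (funext fun ⟨W, hW⟩ => funext fun b' => ?_)
  rw [f.2 U W le_rfl hW b b', f'.2 U W le_rfl hW b b', h]

variable (c) in
/-- The section with coordinate `x` with respect to `b`. -/
noncomputable def mkAt (b : B.obj U) (x : Γ(N, U)) : c.Sec U :=
  ⟨fun W b' => c.g (B.res W.2 b) b' (N.res W.2 x), fun W W' h h' b₁ b₂ => by
    simp only [c.res_g, B.res_res, Modules.res_res, c.g_comp]⟩

@[simp]
lemma mkAt_self (b : B.obj U) (x : Γ(N, U)) : (c.mkAt b x).1 ⟨U, le_rfl⟩ b = x := by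
  simp [mkAt, B.res_self, c.g_self]

lemma Sec.eval_res (h : V ≤ U) (b : B.obj U) (f : c.Sec U) :
    (Sec.res h f).1 ⟨V, le_rfl⟩ (B.res h b) = N.res h (f.1 ⟨U, le_rfl⟩ b) := by
  refine (f.2 U V le_rfl h b (B.res h b)).trans ?_
  rw [c.g_self]

lemma Sec.eval_change (b b' : B.obj U) (f : c.Sec U) :
    f.1 ⟨U, le_rfl⟩ b' = c.g b b' (f.1 ⟨U, le_rfl⟩ b) := by
  refine (f.2 U U le_rfl le_rfl b b').trans ?_
  rw [Modules.res_self, B.res_self]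

variable (c)

/-- The presheaf of sections of the twisted form. -/
def presheaf : TopCat.Presheaf (Type u) Z where
  obj U := c.Sec U.unop
  map i := TypeCat.ofHom (Sec.res i.unop.le)

lemma exists_glue {ι : Type u} (U : ι → Z.Opens) (sf : ∀ i, c.Sec (U i))
    (hsf : ∀ i j, Sec.res (inf_le_left : U i ⊓ U j ≤ U i) (sf i) =
      Sec.res (inf_le_right : U i ⊓ U j ≤ U j) (sf j)) :
    ∃! s : c.Sec (iSup U), ∀ i, Sec.res (le_iSup U i) s = sf i := by
  have hsf' : ∀ (W : Z.Opens) (i j : ι) (hi : W ≤ U i) (hj : W ≤ U j) (b : B.obj W),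
      (sf i).1 ⟨W, hi⟩ b = (sf j).1 ⟨W, hj⟩ b := fun W i j hi hj b =>
    congrFun (congrFun (congrArg Subtype.val (hsf i j)) ⟨W, le_inf hi hj⟩) b
  -- For each `b` over `W`, the coordinates of the local sections at `b` glue to a section of `N`.
  have key : ∀ (W : Z.Opens) (hW : W ≤ iSup U) (b : B.obj W), ∃ s : Γ(N, W),
      ∀ (V : Z.Opens) (hV : V ≤ W) (t : Γ(N, V)),
        (∃ (i : ι) (hi : V ≤ U i), t = (sf i).1 ⟨V, hi⟩ (B.res hV b)) → N.res hV s = t := by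
    intro W hW b
    refine N.exists_glue _ ?_ ?_ ?_
    · rintro V V' hV h _ ⟨i, hi, rfl⟩
      refine ⟨i, h.trans hi, ?_⟩
      rw [(sf i).2 V V' hi h (B.res hV b) (B.res (h.trans hV) b), B.res_res, c.g_self]
    · intro x hx
      obtain ⟨i, hi⟩ := Opens.mem_iSup.1 (hW hx)
      exact ⟨W ⊓ U i, inf_le_left, ⟨hx, hi⟩, _, i, inf_le_right, rfl⟩
    · rintro V hV _ _ ⟨i, hi, rfl⟩ ⟨j, hj, rfl⟩
      exact hsf' V i j hi hj _
  choose f hf using key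
  have hloc : ∀ (W : Z.Opens) (hW : W ≤ iSup U) (b : B.obj W) (i : ι) (V : Z.Opens) (hV : V ≤ W)
      (hi : V ≤ U i), N.res hV (f W hW b) = (sf i).1 ⟨V, hi⟩ (B.res hV b) :=
    fun W hW b i V hV hi => hf W hW b V hV _ ⟨i, hi, rfl⟩
  have hsec : c.IsSection (iSup U) (fun W b => f W.1 W.2 b) := by
    intro W W' h h' b b'
    dsimp only
    refine N.eq_of_locally fun x hx => ?_
    obtain ⟨i, hi⟩ := Opens.mem_iSup.1 (h (h' hx))
    refine ⟨W' ⊓ U i, inf_le_left, ⟨hx, hi⟩, ?_⟩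
    rw [hloc W' _ b' i _ _ inf_le_right, c.res_g, Modules.res_res,
      hloc W _ b i _ _ inf_le_right, B.res_res]
    refine ((sf i).2 _ _ inf_le_right le_rfl (B.res (inf_le_left.trans h') b) _).trans ?_
    rw [B.res_self, Modules.res_self]
  refine ⟨⟨fun W b => f W.1 W.2 b, hsec⟩,
    fun i => Subtype.ext (funext fun ⟨W, hW⟩ => funext fun b => ?_),
    fun s hs => Subtype.ext (funext fun ⟨W, hW⟩ => funext fun b => ?_)⟩
  · have := hloc W (hW.trans (le_iSup U i)) b i W le_rfl hW
    rwa [Modules.res_self, B.res_self] at this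
  · refine N.eq_of_locally fun x hx => ?_
    obtain ⟨i, hi⟩ := Opens.mem_iSup.1 (hW hx)
    refine ⟨W ⊓ U i, inf_le_left, ⟨hx, hi⟩, ?_⟩
    refine Eq.trans ?_ (hloc W hW b i (W ⊓ U i) inf_le_left inf_le_right).symm
    rw [← hs i]
    refine Eq.trans ?_ (s.2 W (W ⊓ U i) hW inf_le_left b _).symm
    rw [c.g_self]

lemma isSheaf : c.presheaf.IsSheaf :=
  TopCat.Presheaf.isSheaf_of_isSheafUniqueGluing_types _ fun _ U sf hsf => c.exists_glue U sf hsf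

/-- The twisted form as a sheaf of sets. -/
def sheaf : TopCat.Sheaf (Type u) Z := ⟨c.presheaf, c.isSheaf⟩

/-- The transition functions are linear. -/
structure IsLinear : Prop where
  g_add {U : Z.Opens} (b b' : B.obj U) (x y : Γ(N, U)) : c.g b b' (x + y) = c.g b b' x + c.g b b' y
  g_smul {U : Z.Opens} (b b' : B.obj U) (a : Γ(Z, U)) (x : Γ(N, U)) :
    c.g b b' (a • x) = a • c.g b b' x

variable {c}

/-- The group of sections of a linear twisted form. -/
def IsLinear.subgroup (hc : c.IsLinear) (U : Z.Opens) :
    AddSubgroup (∀ W : {W : Z.Opens // W ≤ U}, B.obj W.1 → Γ(N, W.1)) where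
  carrier := {f | c.IsSection U f}
  add_mem' {f f'} hf hf' W W' h h' b b' := by
    simp only [Pi.add_apply]
    rw [hf W W' h h' b b', hf' W W' h h' b b', ← hc.g_add, map_add]
  zero_mem' W W' h h' b b' := by
    have := hc.g_smul (B.res h' b) b' 0 0
    simp only [Pi.zero_apply, map_zero]
    simpa using this.symm
  neg_mem' {f} hf W W' h h' b b' := by
    have := hc.g_smul (B.res h' b) b' (-1) (N.res h' (f ⟨W, h⟩ b))
    simp only [Pi.neg_apply, map_neg]
    rw [hf W W' h h' b b']
    simpa using this.symm

noncomputable instance moduleSubgroup (hc : c.IsLinear) (U : Z.Opens) :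
    Module Γ(Z, U) (hc.subgroup U) where
  smul a f := ⟨fun W b => Z.res W.2 a • f.1 W b, fun W W' h h' b b' => by
    change Z.res (h'.trans h) a • f.1 ⟨W', h'.trans h⟩ b' = _
    rw [f.2 W W' h h' b b', Modules.res_smul, Scheme.res_res, hc.g_smul]⟩
  one_smul f := Subtype.ext <| funext fun ⟨W, hW⟩ => funext fun b => by
    change Z.res hW 1 • f.1 ⟨W, hW⟩ b = _
    rw [map_one, one_smul]
  mul_smul a a' f := Subtype.ext <| funext fun ⟨W, hW⟩ => funext fun b => by
    change Z.res hW (a * a') • f.1 ⟨W, hW⟩ b = Z.res hW a • Z.res hW a' • f.1 ⟨W, hW⟩ b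
    rw [map_mul, mul_smul]
  smul_zero a := Subtype.ext <| funext fun ⟨W, hW⟩ => funext fun b =>
    smul_zero (Z.res hW a)
  smul_add a f f' := Subtype.ext <| funext fun ⟨W, hW⟩ => funext fun b =>
    smul_add (Z.res hW a) _ _
  add_smul a a' f := Subtype.ext <| funext fun ⟨W, hW⟩ => funext fun b => by
    change Z.res hW (a + a') • f.1 ⟨W, hW⟩ b =
      Z.res hW a • f.1 ⟨W, hW⟩ b + Z.res hW a' • f.1 ⟨W, hW⟩ b
    rw [map_add, add_smul]
  zero_smul f := Subtype.ext <| funext fun ⟨W, hW⟩ => funext fun b => by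
    change Z.res hW 0 • f.1 ⟨W, hW⟩ b = 0
    rw [map_zero, zero_smul]

/-- The presheaf of abelian groups underlying a linear twisted form. -/
noncomputable def IsLinear.presheaf (hc : c.IsLinear) : TopCat.Presheaf Ab.{u} Z where
  obj U := AddCommGrpCat.of (hc.subgroup U.unop)
  map i := AddCommGrpCat.ofHom
    { toFun := fun f => Sec.res i.unop.le f
      map_zero' := rfl
      map_add' := fun _ _ => rfl }

/-- A linear twisted form as a sheaf of modules. -/
noncomputable def IsLinear.modules (hc : c.IsLinear) : Z.Modules :=
  letI : ∀ U : Z.Opens, Module Γ(Z, U) (hc.presheaf.obj (op U)) := fun U =>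
    inferInstanceAs (Module Γ(Z, U) (hc.subgroup U))
  Modules.ofPresheaf hc.presheaf
    ((TopCat.Presheaf.isSheaf_iff_isSheaf_comp (CategoryTheory.forget Ab) _).2 c.isSheaf)
    (fun i a _ => Subtype.ext <| funext fun ⟨_, hW⟩ => funext fun _ =>
      congrArg (· • _) (Z.res_res i.le hW a).symm)

/-- The coordinate of a section of a linear twisted form with respect to a local trivialization. -/
noncomputable def IsLinear.coord (hc : c.IsLinear) (b : B.obj U) :
    Γ(hc.modules, U) ≃ₗ[Γ(Z, U)] Γ(N, U) where
  toFun f := (show c.Sec U from f).1 ⟨U, le_rfl⟩ b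
  invFun x := c.mkAt b x
  map_add' _ _ := rfl
  map_smul' a f := congrArg (· • (show c.Sec U from f).1 ⟨U, le_rfl⟩ b) (Z.res_self le_rfl a)
  left_inv f := Sec.ext_at b (by simp)
  right_inv x := by simp

lemma IsLinear.coord_res (hc : c.IsLinear) (h : V ≤ U) (b : B.obj U) (f : Γ(hc.modules, U)) :
    hc.coord (B.res h b) (hc.modules.res h f) = N.res h (hc.coord b f) :=
  Sec.eval_res h b (show c.Sec U from f)

lemma IsLinear.coord_change (hc : c.IsLinear) (b b' : B.obj U) (f : Γ(hc.modules, U)) :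
    hc.coord b' f = c.g b b' (hc.coord b f) :=
  Sec.eval_change b b' (show c.Sec U from f)

/-- A section of a twisted form is determined by its coordinates with respect to the local
trivializations over smaller open sets, and any coordinates subject to the transition rule occur. -/
lemma IsLinear.ext_coord (hc : c.IsLinear) {f f' : Γ(hc.modules, U)}
    (h : ∀ (W : Z.Opens) (hW : W ≤ U) (b : B.obj W),
      hc.coord b (hc.modules.res hW f) = hc.coord b (hc.modules.res hW f')) : f = f' :=
  Subtype.ext <| funext fun ⟨W, hW⟩ => funext fun b => h W hW b

/-- The section with given coordinates. -/
noncomputable def IsLinear.ofCoord (hc : c.IsLinear)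
    (f : ∀ W : {W : Z.Opens // W ≤ U}, B.obj W.1 → Γ(N, W.1))
    (hf : c.IsSection U f) : Γ(hc.modules, U) :=
  (⟨f, hf⟩ : c.Sec U)

lemma IsLinear.coord_res_ofCoord (hc : c.IsLinear)
    (f : ∀ W : {W : Z.Opens // W ≤ U}, B.obj W.1 → Γ(N, W.1))
    (hf : c.IsSection U f) (W : Z.Opens) (hW : W ≤ U) (b : B.obj W) :
    hc.coord b (hc.modules.res hW (hc.ofCoord f hf)) = f ⟨W, hW⟩ b := rfl

end TwistCocycle

end AlgebraicGeometry.Scheme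

/-! ### Twisted forms of sheaves of modules over a superscheme -/

namespace AlgebraicGeometry.Scheme.Modules

variable {Z : Scheme.{u}} (M N : Z.Modules)

/-- The presheaf of pairs of sections. -/
noncomputable def prodPresheaf : TopCat.Presheaf Ab.{u} Z where
  obj U := AddCommGrpCat.of (Γ(M, U.unop) × Γ(N, U.unop))
  map i := AddCommGrpCat.ofHom ((M.res i.unop.le).prodMap (N.res i.unop.le))
  map_id U := by
    refine ConcreteCategory.hom_ext _ _ fun x => ?_
    exact Prod.ext (M.res_self _ _) (N.res_self _ _)
  map_comp i j := by
    refine ConcreteCategory.hom_ext _ _ fun x => ?_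
    exact Prod.ext (M.res_res _ _ _).symm (N.res_res _ _ _).symm

lemma isSheaf_prodPresheaf : (prodPresheaf M N).IsSheaf := by
  rw [TopCat.Presheaf.isSheaf_iff_isSheafUniqueGluing]
  intro ι U sf hsf
  obtain ⟨s, hs, hs'⟩ := M.isSheaf.isSheafUniqueGluing U (fun i => (sf i).1)
    (fun i j => congrArg Prod.fst (hsf i j))
  obtain ⟨t, ht, ht'⟩ := N.isSheaf.isSheafUniqueGluing U (fun i => (sf i).2)
    (fun i j => congrArg Prod.snd (hsf i j))
  exact ⟨(s, t), fun i => Prod.ext (hs i) (ht i), fun y hy =>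
    Prod.ext (hs' y.1 fun i => congrArg Prod.fst (hy i))
      (ht' y.2 fun i => congrArg Prod.snd (hy i))⟩

/-- The direct sum of two sheaves of modules, with pairs of sections as sections. -/
noncomputable def prod : Z.Modules :=
  letI : ∀ U : Z.Opens, Module Γ(Z, U) ((prodPresheaf M N).obj (op U)) := fun U =>
    inferInstanceAs (Module Γ(Z, U) (Γ(M, U) × Γ(N, U)))
  ofPresheaf (prodPresheaf M N) (isSheaf_prodPresheaf M N) (fun i a x =>
    Prod.ext (M.map_smul i a x.1) (N.map_smul i a x.2))

variable {M N}

end AlgebraicGeometry.Scheme.Modules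

namespace AlgebraicGeometry.Scheme.TwistCocycle

variable {Z : Scheme.{u}} {N : Z.Modules} {B : TrivSystem Z} {c : TwistCocycle N B}
  {U V : Z.Opens}

lemma IsLinear.coord_res_change (hc : c.IsLinear) (h : V ≤ U) (b : B.obj U) (b' : B.obj V)
    (f : Γ(hc.modules, U)) :
    hc.coord b' (hc.modules.res h f) = c.g (B.res h b) b' (N.res h (hc.coord b f)) := by
  rw [hc.coord_change (B.res h b) b', hc.coord_res]

end AlgebraicGeometry.Scheme.TwistCocycle

open AlgebraicGeometry.Scheme (TrivSystem TwistCocycle)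

/-- Linear transition functions on a sheaf of modules over a superscheme. -/
structure SuperTwist {X : Superscheme.{u}} (N : SuperModule X) (B : TrivSystem X.even) where
  even : TwistCocycle N.even B
  odd : TwistCocycle N.odd B
  isLinear_even : even.IsLinear
  isLinear_odd : odd.IsLinear
  g_smulEven {U : X.even.Opens} (b b' : B.obj U) (s : Γ(X.odd, U)) (x : Γ(N.even, U)) :
    odd.g b b' (N.smulEven U s x) = N.smulEven U s (even.g b b' x)
  g_smulOdd {U : X.even.Opens} (b b' : B.obj U) (s : Γ(X.odd, U)) (x : Γ(N.odd, U)) :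
    even.g b b' (N.smulOdd U s x) = N.smulOdd U s (odd.g b b' x)

namespace SuperTwist

variable {X : Superscheme.{u}} {N : SuperModule X} {B : TrivSystem X.even} (c : SuperTwist N B)
  {U V : X.even.Opens}

lemma isSection_smulEven (s : Γ(X.odd, U)) (f : Γ(c.isLinear_even.modules, U)) :
    c.odd.IsSection U (fun W b => N.smulEven W.1 (X.odd.res W.2 s)
      (c.isLinear_even.coord b (c.isLinear_even.modules.res W.2 f))) := by
  intro W W' h h' b b'
  dsimp only
  rw [← Scheme.Modules.res_res _ h h' f, c.isLinear_even.coord_res_change h' b b', res_smulEven,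
    c.g_smulEven, Scheme.Modules.res_res]

lemma isSection_smulOdd (s : Γ(X.odd, U)) (f : Γ(c.isLinear_odd.modules, U)) :
    c.even.IsSection U (fun W b => N.smulOdd W.1 (X.odd.res W.2 s)
      (c.isLinear_odd.coord b (c.isLinear_odd.modules.res W.2 f))) := by
  intro W W' h h' b b'
  dsimp only
  rw [← Scheme.Modules.res_res _ h h' f, c.isLinear_odd.coord_res_change h' b b', res_smulOdd,
    c.g_smulOdd, Scheme.Modules.res_res]

/-- Multiplication of an odd function with an even section of a twisted form. -/
noncomputable def smulEven (U : X.even.Opens) : Γ(X.odd, U) →ₗ[Γ(X.even, U)]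
    Γ(c.isLinear_even.modules, U) →ₗ[Γ(X.even, U)] Γ(c.isLinear_odd.modules, U) :=
  LinearMap.mk₂ _ (fun s f => c.isLinear_odd.ofCoord _ (c.isSection_smulEven s f))
    (fun s s' f => c.isLinear_odd.ext_coord fun W hW b => by
      simp [TwistCocycle.IsLinear.coord_res_ofCoord])
    (fun a s f => c.isLinear_odd.ext_coord fun W hW b => by
      simp [TwistCocycle.IsLinear.coord_res_ofCoord])
    (fun s f f' => c.isLinear_odd.ext_coord fun W hW b => by
      simp [TwistCocycle.IsLinear.coord_res_ofCoord])
    (fun a s f => c.isLinear_odd.ext_coord fun W hW b => by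
      simp [TwistCocycle.IsLinear.coord_res_ofCoord])

/-- Multiplication of an odd function with an odd section of a twisted form. -/
noncomputable def smulOdd (U : X.even.Opens) : Γ(X.odd, U) →ₗ[Γ(X.even, U)]
    Γ(c.isLinear_odd.modules, U) →ₗ[Γ(X.even, U)] Γ(c.isLinear_even.modules, U) :=
  LinearMap.mk₂ _ (fun s f => c.isLinear_even.ofCoord _ (c.isSection_smulOdd s f))
    (fun s s' f => c.isLinear_even.ext_coord fun W hW b => by
      simp [TwistCocycle.IsLinear.coord_res_ofCoord])
    (fun a s f => c.isLinear_even.ext_coord fun W hW b => by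
      simp [TwistCocycle.IsLinear.coord_res_ofCoord])
    (fun s f f' => c.isLinear_even.ext_coord fun W hW b => by
      simp [TwistCocycle.IsLinear.coord_res_ofCoord])
    (fun a s f => c.isLinear_even.ext_coord fun W hW b => by
      simp [TwistCocycle.IsLinear.coord_res_ofCoord])

lemma coord_res_smulEven (s : Γ(X.odd, U)) (f : Γ(c.isLinear_even.modules, U)) (h : V ≤ U)
    (b : B.obj V) :
    c.isLinear_odd.coord b (c.isLinear_odd.modules.res h (c.smulEven U s f)) =
      N.smulEven V (X.odd.res h s) (c.isLinear_even.coord b (c.isLinear_even.modules.res h f)) :=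
  c.isLinear_odd.coord_res_ofCoord _ (c.isSection_smulEven s f) V h b

lemma coord_res_smulOdd (s : Γ(X.odd, U)) (f : Γ(c.isLinear_odd.modules, U)) (h : V ≤ U)
    (b : B.obj V) :
    c.isLinear_even.coord b (c.isLinear_even.modules.res h (c.smulOdd U s f)) =
      N.smulOdd V (X.odd.res h s) (c.isLinear_odd.coord b (c.isLinear_odd.modules.res h f)) :=
  c.isLinear_even.coord_res_ofCoord _ (c.isSection_smulOdd s f) V h b

lemma coord_smulEven (s : Γ(X.odd, U)) (f : Γ(c.isLinear_even.modules, U)) (b : B.obj U) :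
    c.isLinear_odd.coord b (c.smulEven U s f) = N.smulEven U s (c.isLinear_even.coord b f) := by
  simpa using c.coord_res_smulEven s f le_rfl b

lemma coord_smulOdd (s : Γ(X.odd, U)) (f : Γ(c.isLinear_odd.modules, U)) (b : B.obj U) :
    c.isLinear_even.coord b (c.smulOdd U s f) = N.smulOdd U s (c.isLinear_odd.coord b f) := by
  simpa using c.coord_res_smulOdd s f le_rfl b

/-- The twisted form of a sheaf of modules over a superscheme. -/
noncomputable def module : SuperModule X where
  even := c.isLinear_even.modules
  odd := c.isLinear_odd.modules
  smulEven := c.smulEven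
  smulOdd := c.smulOdd
  smulOdd_smulEven s t f := c.isLinear_even.ext_coord fun W hW b => by
    simp [coord_res_smulEven, coord_res_smulOdd, N.smulOdd_smulEven]
  smulEven_smulOdd s t f := c.isLinear_odd.ext_coord fun W hW b => by
    simp [coord_res_smulEven, coord_res_smulOdd, N.smulEven_smulOdd]
  map_smulEven i s f := c.isLinear_odd.ext_coord fun W hW b => by
    simp only [Scheme.Modules.map_eq_res, Scheme.Modules.res_res, coord_res_smulEven]
  map_smulOdd i s f := c.isLinear_even.ext_coord fun W hW b => by
    simp only [Scheme.Modules.map_eq_res, Scheme.Modules.res_res, coord_res_smulOdd]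

end SuperTwist

namespace SuperModule

variable (X : Superscheme.{u})

/-- The product of an odd function `s` with the pair `(a, α)`. It is the pair `(s α, a s)` in both
parities: `s (a + α θ) = (s α) θ + a s` and `s (a θ + α) = s α + (a s) θ`. -/
noncomputable def freeSmul (U : X.even.Opens) :
    Γ(X.odd, U) →ₗ[Γ(X.even, U)] Γ((structureSheaf X).even.prod X.odd, U) →ₗ[Γ(X.even, U)]
      Γ((structureSheaf X).even.prod X.odd, U) :=
  LinearMap.mk₂ _
    (fun s (p : Γ(X.even, U) × Γ(X.odd, U)) =>
      (show Γ(X.even, U) × Γ(X.odd, U) from (X.mul U s p.2, p.1 • s)))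
    (fun _ _ _ => Prod.ext (LinearMap.map_add₂ _ _ _ _) (smul_add _ _ _))
    (fun _ _ _ => Prod.ext (LinearMap.map_smul₂ _ _ _ _) (smul_comm _ _ _))
    (fun _ _ _ => Prod.ext (map_add _ _ _) (add_smul _ _ _))
    (fun a s p => Prod.ext (map_smul _ _ _) (mul_smul a p.1 s))

/-- The free module of rank `1|1`, with basis `1, θ`. The pair `(a, α)` stands for the even section
`a + α θ`, and also for the odd section `a θ + α`. -/
noncomputable def freeOneOne : SuperModule X where
  even := (structureSheaf X).even.prod X.odd
  odd := (structureSheaf X).even.prod X.odd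
  smulEven := freeSmul X
  smulOdd := freeSmul X
  smulOdd_smulEven s t p := Prod.ext
    (((X.mul _ s).map_smul p.1 t).trans (mul_comm _ _)) (X.mul_assoc s t p.2).symm
  smulEven_smulOdd s t p := Prod.ext
    (((X.mul _ s).map_smul p.1 t).trans (mul_comm _ _)) (X.mul_assoc s t p.2).symm
  map_smulEven i s p := Prod.ext (X.map_mul i s p.2) (Scheme.Modules.map_smul X.odd i p.1 s)
  map_smulOdd i s p := Prod.ext (X.map_mul i s p.2) (Scheme.Modules.map_smul X.odd i p.1 s)

end SuperModule

/-! ### Line bundles, torsors and extensions from affine cocycles -/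

/-- Invertible functions comparing any two local trivializations. -/
structure MulCocycle (X : Superscheme.{u}) (B : TrivSystem X.even) where
  w {U : X.even.Opens} (b b' : B.obj U) : Γ(X.even, U)
  w_self {U : X.even.Opens} (b : B.obj U) : w b b = 1
  w_comp {U : X.even.Opens} (b b' b'' : B.obj U) : w b' b'' * w b b' = w b b''
  res_w {U V : X.even.Opens} (h : V ≤ U) (b b' : B.obj U) :
    X.even.res h (w b b') = w (B.res h b) (B.res h b')

namespace MulCocycle

variable {X : Superscheme.{u}} {B : TrivSystem X.even} (c : MulCocycle X B) {U V : X.even.Opens}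

/-- The inverse cocycle. -/
def inv : MulCocycle X B where
  w b b' := c.w b' b
  w_self b := c.w_self b
  w_comp b b' b'' := by rw [mul_comm, c.w_comp]
  res_w h b b' := c.res_w h b' b

/-- The twisting of the structure sheaf by a multiplicative cocycle. -/
noncomputable def twist : SuperTwist (structureSheaf X) B where
  even :=
    { g := fun b b' x => c.w b b' • x
      g_self := fun b x => by rw [c.w_self, one_smul]
      g_comp := fun b b' b'' x => by rw [smul_smul, c.w_comp]
      res_g := fun h b b' x => by rw [Scheme.Modules.res_smul, c.res_w] }
  odd :=
    { g := fun b b' x => c.w b b' • x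
      g_self := fun b x => by rw [c.w_self, one_smul]
      g_comp := fun b b' b'' x => by rw [smul_smul, c.w_comp]
      res_g := fun h b b' x => by rw [Scheme.Modules.res_smul, c.res_w] }
  isLinear_even := ⟨fun _ _ _ _ => smul_add _ _ _, fun _ _ _ _ => smul_comm _ _ _⟩
  isLinear_odd := ⟨fun _ _ _ _ => smul_add _ _ _, fun _ _ _ _ => smul_comm _ _ _⟩
  g_smulEven b b' s x := (map_smul ((structureSheaf X).smulEven _ s) _ _).symm
  g_smulOdd b b' s x := (map_smul ((structureSheaf X).smulOdd _ s) _ _).symm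

/-- The line bundle defined by a multiplicative cocycle. -/
noncomputable abbrev line : SuperModule X := c.twist.module

/-- The coordinate of an even section of the line bundle. -/
noncomputable def coordEven (b : B.obj U) : Γ(c.line.even, U) ≃ₗ[Γ(X.even, U)] Γ(X.even, U) :=
  c.twist.isLinear_even.coord b

/-- The coordinate of an odd section of the line bundle. -/
noncomputable def coordOdd (b : B.obj U) : Γ(c.line.odd, U) ≃ₗ[Γ(X.even, U)] Γ(X.odd, U) :=
  c.twist.isLinear_odd.coord b

/-- The generator of the line bundle given by a local trivialization. -/
noncomputable def gen (b : B.obj U) : Γ(c.line.even, U) := (c.coordEven b).symm 1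

lemma coordEven_res (h : V ≤ U) (b : B.obj U) (x : Γ(c.line.even, U)) :
    c.coordEven (B.res h b) (c.line.even.res h x) = X.even.res h (c.coordEven b x) :=
  c.twist.isLinear_even.coord_res h b x

lemma coordOdd_res (h : V ≤ U) (b : B.obj U) (x : Γ(c.line.odd, U)) :
    c.coordOdd (B.res h b) (c.line.odd.res h x) = X.odd.res h (c.coordOdd b x) :=
  c.twist.isLinear_odd.coord_res h b x

lemma coordEven_change (b b' : B.obj U) (x : Γ(c.line.even, U)) :
    c.coordEven b' x = c.w b b' * c.coordEven b x :=
  c.twist.isLinear_even.coord_change b b' x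

lemma coordOdd_change (b b' : B.obj U) (x : Γ(c.line.odd, U)) :
    c.coordOdd b' x = c.w b b' • c.coordOdd b x :=
  c.twist.isLinear_odd.coord_change b b' x

lemma coordOdd_smulEven (b : B.obj U) (s : Γ(X.odd, U)) (x : Γ(c.line.even, U)) :
    c.coordOdd b (c.line.smulEven U s x) = c.coordEven b x • s :=
  c.twist.coord_smulEven s x b

@[simp]
lemma coordEven_gen (b : B.obj U) : c.coordEven b (c.gen b) = 1 := by simp [gen]

lemma res_gen (h : V ≤ U) (b : B.obj U) : c.line.even.res h (c.gen b) = c.gen (B.res h b) := by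
  apply (c.coordEven (B.res h b)).injective
  rw [coordEven_res, coordEven_gen, coordEven_gen, map_one]

lemma isGenerator_gen (b : B.obj U) : c.line.IsGenerator U (c.gen b) := by
  rw [isGenerator_iff]
  intro V h
  rw [res_gen]
  constructor
  · convert! (c.coordEven (B.res h b)).symm.bijective using 1
    funext a
    apply (c.coordEven (B.res h b)).injective
    simp
  · convert! (c.coordOdd (B.res h b)).symm.bijective using 1
    funext a
    apply (c.coordOdd (B.res h b)).injective
    simp [coordOdd_smulEven]

lemma isLocallyFree_line (hB : ∀ x : X.even, ∃ U : X.even.Opens, x ∈ U ∧ Nonempty (B.obj U)) :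
    c.line.IsLocallyFree 1 0 := fun x => by
  obtain ⟨U, hx, ⟨b⟩⟩ := hB x
  exact ⟨U, hx, fun _ => c.gen b, fun j => j.elim0, c.isGenerator_gen b⟩

lemma isLocallyFree_shift_line
    (hB : ∀ x : X.even, ∃ U : X.even.Opens, x ∈ U ∧ Nonempty (B.obj U)) :
    c.line.shift.IsLocallyFree 0 1 := fun x => by
  obtain ⟨U, hx, ⟨b⟩⟩ := hB x
  refine ⟨U, hx, fun j => j.elim0, fun _ => c.gen b, ?_⟩
  refine (isBasis_zero_one_iff c.line.shift (c.gen b)).2 fun V h => ?_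
  obtain ⟨h1, h2⟩ := (c.line.isGenerator_iff _).1 (c.isGenerator_gen b) V h
  exact ⟨(Equiv.neg _).bijective.comp h2, h1⟩

end MulCocycle

/-- Affine transformations `(u, γ)` with `u` an even and `γ` an odd function, comparing any two
local trivializations: the odd coordinate `θ_b` of `b` and that of `b'` are related by
`θ_b' = u θ_b + γ`. -/
structure AffineCocycle (X : Superscheme.{u}) (B : TrivSystem X.even) where
  u {U : X.even.Opens} (b b' : B.obj U) : Γ(X.even, U)
  γ {U : X.even.Opens} (b b' : B.obj U) : Γ(X.odd, U)
  u_self {U : X.even.Opens} (b : B.obj U) : u b b = 1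
  γ_self {U : X.even.Opens} (b : B.obj U) : γ b b = 0
  u_comp {U : X.even.Opens} (b b' b'' : B.obj U) : u b' b'' * u b b' = u b b''
  γ_comp {U : X.even.Opens} (b b' b'' : B.obj U) : u b' b'' • γ b b' + γ b' b'' = γ b b''
  res_u {U V : X.even.Opens} (h : V ≤ U) (b b' : B.obj U) :
    X.even.res h (u b b') = u (B.res h b) (B.res h b')
  res_γ {U V : X.even.Opens} (h : V ≤ U) (b b' : B.obj U) :
    X.odd.res h (γ b b') = γ (B.res h b) (B.res h b')
  exists_triv (x : X.even) : ∃ U : X.even.Opens, x ∈ U ∧ Nonempty (B.obj U)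

namespace AffineCocycle

variable {X : Superscheme.{u}} {B : TrivSystem X.even} (c : AffineCocycle X B)
  {U V : X.even.Opens}

/-- The linear part of an affine cocycle. -/
def mulCocycle : MulCocycle X B where
  w := c.u
  w_self := c.u_self
  w_comp := c.u_comp
  res_w := c.res_u

/-- Coordinates of sections of the torsor of an affine cocycle: a section is a compatible family of
odd functions, on which the affine transformations act. -/
noncomputable def torsorCocycle : TwistCocycle X.odd B where
  g b b' x := c.u b b' • x + c.γ b b'
  g_self b x := by rw [c.u_self, c.γ_self, one_smul, add_zero]
  g_comp b b' b'' x := by rw [smul_add, smul_smul, c.u_comp, add_assoc, c.γ_comp]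
  res_g h b b' x := by rw [map_add, Scheme.Modules.res_smul, c.res_u, c.res_γ]

/-- The translate of a section of the torsor by an odd section of the line bundle. -/
noncomputable def vadd (l : Γ(c.mulCocycle.line.odd, U)) (t : c.torsorCocycle.Sec U) :
    c.torsorCocycle.Sec U :=
  ⟨fun W b => t.1 W b + c.mulCocycle.coordOdd b (c.mulCocycle.line.odd.res W.2 l), by
    intro W W' h h' b b'
    dsimp only
    rw [t.2 W W' h h' b b', ← Scheme.Modules.res_res _ h h' l,
      c.mulCocycle.coordOdd_change (B.res h' b) b', c.mulCocycle.coordOdd_res, map_add]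
    change (c.u _ _ • _ + c.γ _ _) + c.u _ _ • _ = c.u _ _ • (_ + _) + c.γ _ _
    rw [smul_add]
    abel⟩

lemma zero_vadd (t : c.torsorCocycle.Sec U) : c.vadd 0 t = t :=
  Subtype.ext <| funext fun ⟨W, hW⟩ => funext fun b => by
    simp [vadd]

lemma add_vadd (l l' : Γ(c.mulCocycle.line.odd, U)) (t : c.torsorCocycle.Sec U) :
    c.vadd (l + l') t = c.vadd l (c.vadd l' t) :=
  Subtype.ext <| funext fun ⟨W, hW⟩ => funext fun b => by
    simp only [vadd, map_add]
    abel

lemma res_vadd (h : V ≤ U) (l : Γ(c.mulCocycle.line.odd, U)) (t : c.torsorCocycle.Sec U) :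
    (c.vadd l t).res h = c.vadd (c.mulCocycle.line.odd.res h l) (t.res h) :=
  Subtype.ext <| funext fun ⟨W, hW⟩ => funext fun b => by
    simp only [vadd, TwistCocycle.Sec.res, Scheme.Modules.res_res]

lemma isSection_sub (t t' : c.torsorCocycle.Sec U) :
    c.mulCocycle.twist.odd.IsSection U (fun W b => t'.1 W b - t.1 W b) := by
  intro W W' h h' b b'
  have key : ∀ x y : Γ(X.odd, W), (c.u (B.res h' b) b' • X.odd.res h' x + c.γ (B.res h' b) b') -
      (c.u (B.res h' b) b' • X.odd.res h' y + c.γ (B.res h' b) b') =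
        c.u (B.res h' b) b' • X.odd.res h' (x - y) := by
    intro x y
    rw [map_sub, smul_sub]
    abel
  refine Eq.trans ?_ (key (t'.1 ⟨W, h⟩ b) (t.1 ⟨W, h⟩ b))
  exact congrArg₂ (· - ·) (t'.2 W W' h h' b b') (t.2 W W' h h' b b')

lemma existsUnique_vadd (t t' : c.torsorCocycle.Sec U) : ∃! l, c.vadd l t = t' := by
  refine ⟨c.mulCocycle.twist.isLinear_odd.ofCoord _ (c.isSection_sub t t'), ?_, ?_⟩
  · refine Subtype.ext <| funext fun ⟨W, hW⟩ => funext fun b => ?_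
    exact add_sub_cancel (t.1 ⟨W, hW⟩ b) _
  · intro l hl
    refine c.mulCocycle.twist.isLinear_odd.ext_coord fun W hW b => ?_
    have := congrFun (congrFun (congrArg Subtype.val hl) ⟨W, hW⟩) b
    exact eq_sub_of_add_eq' this

/-- The torsor under the shifted line bundle defined by an affine cocycle. -/
noncomputable def torsor : SheafTorsor c.mulCocycle.line.shift.even.presheaf where
  sections := c.torsorCocycle.sheaf
  vadd U l t := c.vadd l t
  zero_vadd t := c.zero_vadd t
  add_vadd l l' t := c.add_vadd l l' t
  map_vadd i l t := c.res_vadd i.le l t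
  existsUnique_vadd t t' := c.existsUnique_vadd t t'
  locally_nonempty x := by
    obtain ⟨U, hx, ⟨b⟩⟩ := c.exists_triv x
    exact ⟨U, hx, ⟨c.torsorCocycle.mkAt b 0⟩⟩

/-- The pair of a line bundle and a torsor defined by an affine cocycle. -/
noncomputable def pair : LineTorsorPair X where
  line := c.mulCocycle.line
  isLine := c.mulCocycle.isLocallyFree_line c.exists_triv
  torsor := c.torsor

/-- Coordinates of sections of the extension defined by an affine cocycle. The coordinates at `b'`
are obtained by substituting `θ_b = u θ_b' + γ`, with `u = u b' b` and `γ = γ b' b`, in `a + α θ_b`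
and in `a θ_b + α`. -/
noncomputable def extTwist : SuperTwist (freeOneOne X) B where
  even :=
    { g := fun {U} b b' (p : Γ(X.even, U) × Γ(X.odd, U)) =>
        (show Γ(X.even, U) × Γ(X.odd, U) from (p.1 + X.mul U p.2 (c.γ b' b), c.u b' b • p.2))
      g_self := fun {U} b (p : Γ(X.even, U) × Γ(X.odd, U)) => Prod.ext
        (by dsimp only; rw [c.γ_self, map_zero, add_zero])
        (by dsimp only; rw [c.u_self, one_smul])
      g_comp := fun {U} b b' b'' (p : Γ(X.even, U) × Γ(X.odd, U)) => Prod.ext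
        (by
          dsimp only
          rw [← c.γ_comp b'' b' b, map_add, map_smul, map_smul, LinearMap.smul_apply, add_assoc,
            add_comm (X.mul U p.2 _)])
        (by dsimp only; rw [smul_smul, mul_comm, c.u_comp])
      res_g := fun {U V} h b b' (p : Γ(X.even, U) × Γ(X.odd, U)) => Prod.ext
        (by
          change X.even.res h (p.1 + _) = X.even.res h p.1 + X.mul V (X.odd.res h p.2) _
          rw [map_add, Superscheme.res_mul, c.res_γ])
        (by
          change X.odd.res h (c.u b' b • p.2) = c.u (B.res h b') (B.res h b) • X.odd.res h p.2
          rw [Scheme.Modules.res_smul, c.res_u]) }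
  odd :=
    { g := fun {U} b b' (p : Γ(X.even, U) × Γ(X.odd, U)) =>
        (show Γ(X.even, U) × Γ(X.odd, U) from (p.1 * c.u b' b, p.1 • c.γ b' b + p.2))
      g_self := fun {U} b (p : Γ(X.even, U) × Γ(X.odd, U)) => Prod.ext
        (by dsimp only; rw [c.u_self, mul_one])
        (by dsimp only; rw [c.γ_self, smul_zero, zero_add])
      g_comp := fun {U} b b' b'' (p : Γ(X.even, U) × Γ(X.odd, U)) => Prod.ext
        (by dsimp only; rw [mul_assoc, c.u_comp])
        (by dsimp only; rw [← c.γ_comp b'' b' b, smul_add, smul_smul, add_assoc])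
      res_g := fun {U V} h b b' (p : Γ(X.even, U) × Γ(X.odd, U)) => Prod.ext
        (by
          change X.even.res h (p.1 * _) = X.even.res h p.1 * _
          rw [map_mul, c.res_u])
        (by
          change X.odd.res h (p.1 • _ + p.2) = X.even.res h p.1 • _ + X.odd.res h p.2
          rw [map_add, Scheme.Modules.res_smul, c.res_γ]) }
  isLinear_even :=
    { g_add := fun {U} b b' (p q : Γ(X.even, U) × Γ(X.odd, U)) => Prod.ext
        (by
          change (p.1 + q.1) + X.mul U (p.2 + q.2) _ = (p.1 + X.mul U p.2 _) + (q.1 + X.mul U q.2 _)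
          rw [map_add, LinearMap.add_apply]
          abel)
        (smul_add _ _ _)
      g_smul := fun {U} b b' a (p : Γ(X.even, U) × Γ(X.odd, U)) => Prod.ext
        (by
          change a * p.1 + X.mul U (a • p.2) _ = a * (p.1 + X.mul U p.2 _)
          rw [map_smul, LinearMap.smul_apply, smul_eq_mul, mul_add])
        (smul_comm _ _ _) }
  isLinear_odd :=
    { g_add := fun {U} b b' (p q : Γ(X.even, U) × Γ(X.odd, U)) => Prod.ext
        (add_mul (p.1 : Γ(X.even, U)) q.1 (c.u b' b))
        (by
          change (p.1 + q.1) • _ + (p.2 + q.2) = (p.1 • _ + p.2) + (q.1 • _ + q.2)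
          rw [add_smul]
          abel)
      g_smul := fun {U} b b' a (p : Γ(X.even, U) × Γ(X.odd, U)) => Prod.ext
        (mul_assoc (a : Γ(X.even, U)) p.1 (c.u b' b))
        (by
          change (a * p.1) • _ + a • p.2 = a • (p.1 • _ + p.2)
          rw [smul_add, mul_smul]) }
  g_smulEven {U} b b' s (p : Γ(X.even, U) × Γ(X.odd, U)) := Prod.ext
    (by
      change X.mul U s p.2 * c.u b' b = X.mul U s (c.u b' b • p.2)
      rw [map_smul, smul_eq_mul, mul_comm])
    (by
      change X.mul U s p.2 • c.γ b' b + p.1 • s = (p.1 + X.mul U p.2 (c.γ b' b)) • s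
      rw [X.mul_assoc, add_smul, add_comm])
  g_smulOdd {U} b b' s (p : Γ(X.even, U) × Γ(X.odd, U)) := Prod.ext
    (by
      change X.mul U s p.2 + X.mul U (p.1 • s) (c.γ b' b) = X.mul U s (p.1 • c.γ b' b + p.2)
      rw [map_add, map_smul, map_smul, LinearMap.smul_apply, add_comm])
    (by
      change c.u b' b • p.1 • s = (p.1 * c.u b' b) • s
      rw [smul_smul, mul_comm])

/-- The coordinates `(a, α)` of the even section `a + α θ` of the extension. -/
noncomputable def coordEven (b : B.obj U) :
    Γ(c.extTwist.module.even, U) ≃ₗ[Γ(X.even, U)] Γ(X.even, U) × Γ(X.odd, U) :=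
  c.extTwist.isLinear_even.coord b

/-- The coordinates `(b, β)` of the odd section `b θ + β` of the extension. -/
noncomputable def coordOdd (b : B.obj U) :
    Γ(c.extTwist.module.odd, U) ≃ₗ[Γ(X.even, U)] Γ(X.even, U) × Γ(X.odd, U) :=
  c.extTwist.isLinear_odd.coord b

lemma isSection_even (a : Γ(X.even, U)) :
    c.extTwist.even.IsSection U (fun W _ =>
      ((X.even.res W.2 a, 0) : Γ(X.even, W.1) × Γ(X.odd, W.1))) := by
  intro W W' h h' b b'
  refine Prod.ext ?_ ?_
  · change X.even.res _ a = X.even.res h' (X.even.res h a) + X.mul W' (X.odd.res h' 0) _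
    rw [map_zero, map_zero, LinearMap.zero_apply, add_zero, Scheme.res_res]
  · change 0 = _ • X.odd.res h' 0
    rw [map_zero, smul_zero]

lemma isSection_odd (a : Γ(X.odd, U)) :
    c.extTwist.odd.IsSection U (fun W _ =>
      ((0, X.odd.res W.2 a) : Γ(X.even, W.1) × Γ(X.odd, W.1))) := by
  intro W W' h h' b b'
  refine Prod.ext ?_ ?_
  · change 0 = X.even.res h' 0 * _
    rw [map_zero, zero_mul]
  · change X.odd.res _ a = X.even.res h' 0 • _ + X.odd.res h' (X.odd.res h a)
    rw [map_zero, zero_smul, zero_add, Scheme.Modules.res_res]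

/-- The section `a` of the extension, for an even function `a`. -/
noncomputable def ofEven (U : X.even.Opens) (a : Γ(X.even, U)) : Γ(c.extTwist.module.even, U) :=
  c.extTwist.isLinear_even.ofCoord _ (c.isSection_even a)

/-- The section `α` of the extension, for an odd function `α`. -/
noncomputable def ofOdd (U : X.even.Opens) (a : Γ(X.odd, U)) : Γ(c.extTwist.module.odd, U) :=
  c.extTwist.isLinear_odd.ofCoord _ (c.isSection_odd a)

/-- The embedding of the structure sheaf into the extension. -/
noncomputable def extHom : structureSheaf X ⟶ c.extTwist.module where
  even := Scheme.Modules.homMk (fun U =>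
    { toFun := c.ofEven U
      map_add' := fun a a' => c.extTwist.isLinear_even.ext_coord fun W hW _ =>
        Prod.ext (map_add (X.even.res hW) a a') (add_zero (0 : Γ(X.odd, W))).symm
      map_smul' := fun a a' => c.extTwist.isLinear_even.ext_coord fun _ hW _ =>
        Prod.ext (map_mul (X.even.res hW) a a') (smul_zero (X.even.res hW a)).symm })
    (fun h a => c.extTwist.isLinear_even.ext_coord fun _ hW _ =>
      Prod.ext (X.even.res_res h hW a) rfl)
  odd := Scheme.Modules.homMk (fun U =>
    { toFun := c.ofOdd U
      map_add' := fun a a' => c.extTwist.isLinear_odd.ext_coord fun W hW _ =>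
        Prod.ext (add_zero (0 : Γ(X.even, W))).symm (map_add (X.odd.res hW) a a')
      map_smul' := fun a a' => c.extTwist.isLinear_odd.ext_coord fun _ hW _ =>
        Prod.ext (mul_zero (X.even.res hW a)).symm (X.odd.res_smul hW a a') })
    (fun h a => c.extTwist.isLinear_odd.ext_coord fun _ hW _ =>
      Prod.ext rfl (X.odd.res_res h hW a))
  app_smulEven {_} s a := c.extTwist.isLinear_odd.ext_coord fun W hW _ => Prod.ext
    (map_zero (X.mul W (X.odd.res hW s))).symm (X.odd.res_smul hW a s)
  app_smulOdd {_} s a := c.extTwist.isLinear_even.ext_coord fun W hW _ => Prod.ext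
    (Superscheme.res_mul hW s a) (zero_smul Γ(X.even, W) (X.odd.res hW s)).symm

/-- The extension defined by an affine cocycle. -/
noncomputable def ext : Under (structureSheaf X) := Under.mk c.extHom

/-- The frame of the extension given by a local trivialization. -/
noncomputable def frame (b : B.obj U) : Γ(c.ext.right.odd, U) := (c.coordOdd b).symm (1, 0)

lemma coordEven_one (b : B.obj U) : c.coordEven b (SuperExtension.one c.ext U) = (1, 0) :=
  Prod.ext (X.even.res_self le_rfl 1) rfl

lemma coordEven_smulOdd (b : B.obj U) (s : Γ(X.odd, U)) (x : Γ(c.ext.right.odd, U)) :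
    c.coordEven b (c.ext.right.smulOdd U s x) =
      (X.mul U s (c.coordOdd b x).2, (c.coordOdd b x).1 • s) :=
  c.extTwist.coord_smulOdd s x b

lemma coordOdd_smulEven (b : B.obj U) (s : Γ(X.odd, U)) (x : Γ(c.ext.right.even, U)) :
    c.coordOdd b (c.ext.right.smulEven U s x) =
      (X.mul U s (c.coordEven b x).2, (c.coordEven b x).1 • s) :=
  c.extTwist.coord_smulEven s x b

@[simp]
lemma coordOdd_frame (b : B.obj U) : c.coordOdd b (c.frame b) = (1, 0) :=
  (c.coordOdd b).apply_symm_apply _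

lemma coordEven_evenComb (b : B.obj U) (a : Γ(X.even, U)) (α : Γ(X.odd, U)) :
    c.coordEven b (SuperExtension.evenComb c.ext (c.frame b) a α) = (a, α) := by
  have h := c.coordEven_smulOdd b α (c.frame b)
  rw [coordOdd_frame] at h
  refine ((c.coordEven b).map_add _ _).trans ?_
  refine (congrArg₂ (· + ·) ((c.coordEven b).map_smul a (SuperExtension.one c.ext U)) h).trans ?_
  rw [coordEven_one]
  simp

lemma coordOdd_oddComb (b : B.obj U) (a : Γ(X.even, U)) (α : Γ(X.odd, U)) :
    c.coordOdd b (SuperExtension.oddComb c.ext (c.frame b) a α) = (a, α) := by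
  have h := c.coordOdd_smulEven b α (SuperExtension.one c.ext U)
  rw [coordEven_one] at h
  refine ((c.coordOdd b).map_add _ _).trans ?_
  refine (congrArg₂ (· + ·) ((c.coordOdd b).map_smul a (c.frame b)) h).trans ?_
  rw [coordOdd_frame]
  simp

lemma res_frame (h : V ≤ U) (b : B.obj U) :
    c.ext.right.odd.res h (c.frame b) = c.frame (B.res h b) := by
  apply (c.coordOdd (B.res h b)).injective
  rw [coordOdd_frame]
  refine (c.extTwist.isLinear_odd.coord_res h b (c.frame b)).trans ?_
  refine (congrArg ((freeOneOne X).odd.res h) (c.coordOdd_frame b)).trans ?_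
  exact Prod.ext (map_one (X.even.res h)) (map_zero (X.odd.res h))

lemma isFrame_frame (b : B.obj U) : SuperExtension.IsFrame c.ext U (c.frame b) := by
  rw [SuperExtension.isFrame_iff]
  intro V h
  rw [res_frame]
  constructor
  · convert! (c.coordEven (B.res h b)).symm.bijective using 1
    funext p
    apply (c.coordEven (B.res h b)).injective
    rw [coordEven_evenComb, LinearEquiv.apply_symm_apply]
  · convert! (c.coordOdd (B.res h b)).symm.bijective using 1
    funext p
    apply (c.coordOdd (B.res h b)).injective
    rw [coordOdd_oddComb, LinearEquiv.apply_symm_apply]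

lemma frame_change (b b' : B.obj U) :
    c.frame b' = SuperExtension.oddComb c.ext (c.frame b) (c.u b b') (c.γ b b') := by
  apply (c.coordOdd b).injective
  rw [coordOdd_oddComb]
  refine (c.extTwist.isLinear_odd.coord_change b' b (c.frame b')).trans ?_
  refine (congrArg (c.extTwist.odd.g b' b) (c.coordOdd_frame b')).trans ?_
  refine Prod.ext (one_mul (c.u b b')) ?_
  change (1 : Γ(X.even, U)) • c.γ b b' + 0 = c.γ b b'
  rw [one_smul, add_zero]

lemma hasLocalFrames_ext : SuperExtension.HasLocalFrames c.ext := fun x => by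
  obtain ⟨U, hx, ⟨b⟩⟩ := c.exists_triv x
  exact ⟨U, hx, c.frame b, c.isFrame_frame b⟩

end AffineCocycle

/-! ### The extension associated with a pair -/

namespace LineTorsorPair

variable {X : Superscheme.{u}} (P : LineTorsorPair X) {U V W : X.even.Opens}

/-- Restriction of sections of the torsor. -/
def resSec (h : V ≤ U) (t : P.sec U) : P.sec V := P.torsor.sections.presheaf.map (homOfLE h).op t

@[simp]
lemma resSec_self (t : P.sec U) : P.resSec le_rfl t = t :=
  ConcreteCategory.congr_hom (P.torsor.sections.presheaf.map_id (op U)) t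

@[simp]
lemma resSec_resSec (h : V ≤ U) (h' : W ≤ V) (t : P.sec U) :
    P.resSec h' (P.resSec h t) = P.resSec (h'.trans h) t :=
  (ConcreteCategory.congr_hom
    (P.torsor.sections.presheaf.map_comp (homOfLE h).op (homOfLE h').op) t).symm

/-- The translate `t + s e`. -/
noncomputable def translate (s : Γ(X.odd, U)) (e : Γ(P.line.even, U)) (t : P.sec U) : P.sec U :=
  P.torsor.vadd U (P.line.smulEven U s e) t

@[simp]
lemma translate_zero (e : Γ(P.line.even, U)) (t : P.sec U) : P.translate 0 e t = t := by
  rw [translate, map_zero]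
  exact P.torsor.zero_vadd t

lemma translate_translate (s s' : Γ(X.odd, U)) (e : Γ(P.line.even, U)) (t : P.sec U) :
    P.translate s e (P.translate s' e t) = P.translate (s + s') e t := by
  rw [translate, translate, translate, map_add]
  exact (P.torsor.add_vadd _ _ t).symm

lemma translate_smul (a : Γ(X.even, U)) (s : Γ(X.odd, U)) (e : Γ(P.line.even, U)) (t : P.sec U) :
    P.translate s (a • e) t = P.translate (a • s) e t := by
  rw [translate, translate, map_smul, map_smul, LinearMap.smul_apply]

lemma res_translate (h : V ≤ U) (s : Γ(X.odd, U)) (e : Γ(P.line.even, U)) (t : P.sec U) :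
    P.resSec h (P.translate s e t) =
      P.translate (X.odd.res h s) (P.line.even.res h e) (P.resSec h t) := by
  rw [translate, translate, ← res_smulEven]
  exact P.torsor.map_vadd (homOfLE h) _ t

variable {P}

lemma exists_translate {e : Γ(P.line.even, U)} (he : P.line.IsGenerator U e) (t t' : P.sec U) :
    ∃ s, P.translate s e t = t' := by
  obtain ⟨l, hl, -⟩ := P.torsor.existsUnique_vadd t t'
  obtain ⟨s, hs⟩ := he.bijective_smulEven.2 l
  refine ⟨s, ?_⟩
  rw [translate, ← hl]
  exact congrArg (fun l => P.torsor.vadd U l t) hs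

lemma translate_inj {e : Γ(P.line.even, U)} (he : P.line.IsGenerator U e) {t : P.sec U}
    {s s' : Γ(X.odd, U)} (h : P.translate s e t = P.translate s' e t) : s = s' :=
  he.bijective_smulEven.1 ((P.torsor.existsUnique_vadd t _).unique h rfl)

variable (P)

/-- Local trivializations of a pair: a section of the torsor and a generator of the bundle. -/
noncomputable def trivSystem : TrivSystem X.even where
  obj U := {b : P.sec U × Γ(P.line.even, U) // P.line.IsGenerator U b.2}
  res h b := ⟨(P.resSec h b.1.1, P.line.even.res h b.1.2), b.2.res h⟩
  res_self _ := Subtype.ext (Prod.ext (P.resSec_self _) (P.line.even.res_self _ _))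
  res_res h h' _ := Subtype.ext (Prod.ext (P.resSec_resSec h h' _) (P.line.even.res_res h h' _))

variable {P} in
/-- The local trivialization given by a section of the torsor and a generator. -/
noncomputable def triv (t : P.sec U) (e : Γ(P.line.even, U)) (he : P.line.IsGenerator U e) :
    P.trivSystem.obj U := ⟨(t, e), he⟩

variable {P} in
lemma exists_smul (b b' : P.trivSystem.obj U) : ∃ a : Γ(X.even, U), a • b'.1.2 = b.1.2 :=
  b'.2.bijective_smul.2 b.1.2

/-- The affine cocycle of a pair: the trivializations `(t, e)` and `(t', e')` are compared by
`(u, γ)`, where `e = u e'` and `t = t' + γ e'`. -/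
noncomputable def cocycle : AffineCocycle X P.trivSystem :=
  have hu : ∀ {U : X.even.Opens} (b b' : P.trivSystem.obj U) (a a' : Γ(X.even, U)),
      a • b'.1.2 = b.1.2 → a' • b'.1.2 = b.1.2 → a = a' := fun b b' a a' h h' =>
    b'.2.bijective_smul.1 (h.trans h'.symm)
  have hγ : ∀ {U : X.even.Opens} (b b' : P.trivSystem.obj U) (s s' : Γ(X.odd, U)),
      P.translate s b'.1.2 b'.1.1 = b.1.1 → P.translate s' b'.1.2 b'.1.1 = b.1.1 → s = s' :=
    fun b b' s s' h h' => translate_inj b'.2 (h.trans h'.symm)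
  have hu' {U : X.even.Opens} (b b' : P.trivSystem.obj U) := (exists_smul b b').choose_spec
  have hγ' {U : X.even.Opens} (b b' : P.trivSystem.obj U) :=
    (exists_translate b'.2 b'.1.1 b.1.1).choose_spec
  { u b b' := (exists_smul b b').choose
    γ b b' := (exists_translate b'.2 b'.1.1 b.1.1).choose
    u_self b := hu b b _ _ (hu' b b) (one_smul _ _)
    γ_self b := hγ b b _ _ (hγ' b b) (P.translate_zero _ _)
    u_comp b b' b'' := hu b b'' _ _ (by rw [mul_comm, mul_smul, hu', hu']) (hu' b b'')
    γ_comp b b' b'' := hγ b b'' _ _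
      (by rw [← translate_translate, hγ' b' b'', ← translate_smul, hu', hγ' b b']) (hγ' b b'')
    res_u h b b' := hu (P.trivSystem.res h b) (P.trivSystem.res h b') _ _
      ((P.line.even.res_smul h _ _).symm.trans (congrArg (P.line.even.res h) (hu' b b'))) (hu' _ _)
    res_γ h b b' := hγ (P.trivSystem.res h b) (P.trivSystem.res h b') _ _
      ((P.res_translate h _ _ _).symm.trans (congrArg (P.resSec h) (hγ' b b'))) (hγ' _ _)
    exists_triv x := by
      obtain ⟨U, hx, e, he⟩ := exists_isGenerator P.isLine x
      obtain ⟨V, hxV, ⟨t⟩⟩ := P.torsor.locally_nonempty x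
      exact ⟨U ⊓ V, ⟨hx, hxV⟩, ⟨⟨(P.resSec inf_le_right t, P.line.even.res inf_le_left e),
        he.res _⟩⟩⟩ }

variable {P}

lemma cocycle_u_eq {b b' : P.trivSystem.obj U} {a : Γ(X.even, U)} (h : a • b'.1.2 = b.1.2) :
    P.cocycle.u b b' = a :=
  b'.2.bijective_smul.1 ((exists_smul b b').choose_spec.trans h.symm)

lemma cocycle_γ_eq {b b' : P.trivSystem.obj U} {s : Γ(X.odd, U)}
    (h : P.translate s b'.1.2 b'.1.1 = b.1.1) : P.cocycle.γ b b' = s :=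
  translate_inj b'.2 ((exists_translate b'.2 b'.1.1 b.1.1).choose_spec.trans h.symm)

lemma frame_smul (t : P.sec U) {e : Γ(P.line.even, U)} {a b : Γ(X.even, U)} (hab : a * b = 1)
    (he : P.line.IsGenerator U e) (he' : P.line.IsGenerator U (a • e)) :
    P.cocycle.frame (triv t (a • e) he') = b • P.cocycle.frame (triv t e he) := by
  have h : b • a • e = e := by rw [smul_smul, mul_comm, hab, one_smul]
  rw [P.cocycle.frame_change (triv t e he) (triv t (a • e) he'), cocycle_u_eq (a := b) h,
    cocycle_γ_eq (b := triv t e he) (b' := triv t (a • e) he') (s := 0) (P.translate_zero _ _)]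
  simp [SuperExtension.oddComb]

lemma frame_translate (t : P.sec U) {e : Γ(P.line.even, U)} (he : P.line.IsGenerator U e)
    (s : Γ(X.odd, U)) :
    P.cocycle.frame (triv (P.translate s e t) e he) =
      P.cocycle.frame (triv t e he) -
        P.cocycle.ext.right.smulEven U s (SuperExtension.one P.cocycle.ext U) := by
  have h : P.translate (-s) e (P.translate s e t) = t := by
    rw [translate_translate, neg_add_cancel, translate_zero]
  rw [P.cocycle.frame_change (triv t e he) (triv (P.translate s e t) e he),
    cocycle_u_eq (b := triv t e he) (b' := triv (P.translate s e t) e he) (a := 1) (one_smul _ _),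
    cocycle_γ_eq (s := -s) h, SuperExtension.oddComb,
    one_smul, map_neg, sub_eq_add_neg]
  rfl

variable (P) in
/-- The extension built from the affine cocycle of a pair is associated with the pair. -/
noncomputable def associatedExtension : AssociatedExtension P P.cocycle.ext where
  coord t e he := P.cocycle.frame (triv t e he)
  map_coord i t e he _ := P.cocycle.res_frame i.le (triv t e he)
  isBasis t e he := P.cocycle.isFrame_frame (triv t e he)
  coord_smul t _ _ _ hab he he' := frame_smul t hab he he'
  coord_vadd t _ he s := frame_translate t he s

end LineTorsorPair

/-! ### The pair associated with an extension -/

namespace SuperExtension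

variable {X : Superscheme.{u}} (E : Under (structureSheaf X)) {U V W : X.even.Opens}

/-- Local trivializations of an extension: its frames. -/
noncomputable def trivSystem : TrivSystem X.even where
  obj U := {θ : Γ(E.right.odd, U) // IsFrame E U θ}
  res h b := ⟨E.right.odd.res h b.1, b.2.res h⟩
  res_self _ := Subtype.ext (E.right.odd.res_self _ _)
  res_res h h' _ := Subtype.ext (E.right.odd.res_res h h' _)

variable {E} in
lemma exists_oddComb (b b' : (trivSystem E).obj U) :
    ∃ p : Γ(X.even, U) × Γ(X.odd, U), oddComb E b.1 p.1 p.2 = b'.1 := by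
  obtain ⟨a, α, h⟩ := b.2.exists_odd b'.1
  exact ⟨(a, α), h.symm⟩

/-- The affine cocycle comparing the frames of an extension. -/
noncomputable def cocycle (hE : HasLocalFrames E) : AffineCocycle X (trivSystem E) :=
  have hu : ∀ {U : X.even.Opens} (b b' : (trivSystem E).obj U) (p p' : Γ(X.even, U) × Γ(X.odd, U)),
      oddComb E b.1 p.1 p.2 = b'.1 → oddComb E b.1 p'.1 p'.2 = b'.1 → p = p' :=
    fun b b' a a' h h' => Prod.ext_iff.2 (b.2.odd_inj (h.trans h'.symm))
  have hu' {U : X.even.Opens} (b b' : (trivSystem E).obj U) := (exists_oddComb b b').choose_spec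
  have hself {U : X.even.Opens} (b : (trivSystem E).obj U) :=
    hu b b _ (1, 0) (hu' b b) (oddComb_one_zero _)
  have hcomp {U : X.even.Opens} (b b' b'' : (trivSystem E).obj U) :=
    hu b b'' ((exists_oddComb b' b'').choose.1 * (exists_oddComb b b').choose.1,
      (exists_oddComb b' b'').choose.1 • (exists_oddComb b b').choose.2 +
        (exists_oddComb b' b'').choose.2) _
      (by rw [← oddComb_oddComb, hu', hu']) (hu' b b'')
  have hres {U V : X.even.Opens} (h : V ≤ U) (b b' : (trivSystem E).obj U) :=
    hu ((trivSystem E).res h b) ((trivSystem E).res h b')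
      (X.even.res h (exists_oddComb b b').choose.1, X.odd.res h (exists_oddComb b b').choose.2) _
      ((res_oddComb E h _ _ _).symm.trans (congrArg (E.right.odd.res h) (hu' b b'))) (hu' _ _)
  { u b b' := (exists_oddComb b b').choose.1
    γ b b' := (exists_oddComb b b').choose.2
    u_self b := congrArg Prod.fst (hself b)
    γ_self b := congrArg Prod.snd (hself b)
    u_comp b b' b'' := congrArg Prod.fst (hcomp b b' b'')
    γ_comp b b' b'' := congrArg Prod.snd (hcomp b b' b'')
    res_u h b b' := congrArg Prod.fst (hres h b b')
    res_γ h b b' := congrArg Prod.snd (hres h b b')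
    exists_triv x := by
      obtain ⟨U, hx, θ, hθ⟩ := hE x
      exact ⟨U, hx, ⟨θ, hθ⟩⟩ }

variable {E} (hE : HasLocalFrames E)

lemma oddComb_cocycle (b b' : (trivSystem E).obj U) :
    oddComb E b.1 ((cocycle E hE).u b b') ((cocycle E hE).γ b b') = b'.1 :=
  (exists_oddComb b b').choose_spec

lemma exists_inv_coordEven {e : Γ((cocycle E hE).mulCocycle.line.even, U)}
    (he : (cocycle E hE).mulCocycle.line.IsGenerator U e) (b : (trivSystem E).obj U) :
    ∃ l, (cocycle E hE).mulCocycle.coordEven b e * l = 1 := by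
  obtain ⟨a, l, hal, h, -⟩ :=
    ((cocycle E hE).mulCocycle.isGenerator_gen b).exists_smul_eq he
  refine ⟨l, ?_⟩
  rw [h, map_smul, MulCocycle.coordEven_gen, smul_eq_mul, mul_one, hal]

lemma smul_oddComb (θ : Γ(E.right.odd, U)) (a b : Γ(X.even, U)) (β : Γ(X.odd, U)) :
    a • oddComb E θ b β = oddComb E θ (a * b) (a • β) := by
  simp [oddComb, mul_smul]

/-- The odd section `l (θ_b - τ)` of the extension. When `l` is inverse to the coordinate at `b` of
a generator `e`, and `τ` is the coordinate of a section `t` of the torsor, it does not depend on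
`b`, and is thought of as `e⁻¹ (θ - t)`. -/
noncomputable def localCoord (b : (trivSystem E).obj U) (l : Γ(X.even, U)) (τ : Γ(X.odd, U)) :
    Γ(E.right.odd, U) :=
  oddComb E b.1 l (-(l • τ))

lemma res_localCoord (h : V ≤ U) (b : (trivSystem E).obj U) (l : Γ(X.even, U)) (τ : Γ(X.odd, U)) :
    E.right.odd.res h (localCoord b l τ) =
      localCoord ((trivSystem E).res h b) (X.even.res h l) (X.odd.res h τ) := by
  simp only [localCoord, res_oddComb, map_neg, Scheme.Modules.res_smul]
  rfl

lemma localCoord_change (b b' : (trivSystem E).obj U) {l l' : Γ(X.even, U)}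
    (τ : Γ(X.odd, U)) (h : l' * (cocycle E hE).u b b' = l) :
    localCoord b' l' ((cocycle E hE).torsorCocycle.g b b' τ) = localCoord b l τ := by
  change oddComb E b'.1 l' (-(l' • ((cocycle E hE).u b b' • τ + (cocycle E hE).γ b b'))) = _
  rw [← oddComb_cocycle hE b b', oddComb_oddComb, h, smul_add, smul_smul, h, localCoord]
  congr 1
  abel

/-- The section `e⁻¹ (θ - t)` is glued from its local values. -/
lemma exists_coord (t : (cocycle E hE).torsorCocycle.Sec U)
    {e : Γ((cocycle E hE).mulCocycle.line.even, U)}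
    (he : (cocycle E hE).mulCocycle.line.IsGenerator U e) :
    ∃ θ : Γ(E.right.odd, U), ∀ (V : X.even.Opens) (h : V ≤ U) (b : (trivSystem E).obj V)
      (l : Γ(X.even, V)), (cocycle E hE).mulCocycle.coordEven b
        ((cocycle E hE).mulCocycle.line.even.res h e) * l = 1 →
        E.right.odd.res h θ = localCoord b l (t.1 ⟨V, h⟩ b) := by
  refine (E.right.odd.exists_glue (U := U)
    (fun V h θ => ∃ (b : (trivSystem E).obj V) (l : Γ(X.even, V)),
      (cocycle E hE).mulCocycle.coordEven b
        ((cocycle E hE).mulCocycle.line.even.res h e) * l = 1 ∧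
      θ = localCoord b l (t.1 ⟨V, h⟩ b)) ?_ ?_ ?_).imp
    fun θ hθ V h b l hl => hθ V h _ ⟨b, l, hl, rfl⟩
  · rintro V W hV h _ ⟨b, l, hl, rfl⟩
    refine ⟨(trivSystem E).res h b, X.even.res h l, ?_, ?_⟩
    · rw [← Scheme.Modules.res_res _ hV h, MulCocycle.coordEven_res, ← map_mul, hl, map_one]
    · rw [res_localCoord, t.2 V W hV h b ((trivSystem E).res h b), TwistCocycle.g_self]
  · intro x hx
    obtain ⟨V, hV, hxV, θ, hθ⟩ := hE.exists_le hx
    obtain ⟨l, hl⟩ := exists_inv_coordEven hE (he.res hV) ⟨θ, hθ⟩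
    exact ⟨V, hV, hxV, _, _, l, hl, rfl⟩
  · rintro V hV _ _ ⟨b, l, hl, rfl⟩ ⟨b', l', hl', rfl⟩
    have h := t.2 V V hV le_rfl b b'
    rw [TrivSystem.res_self, Scheme.Modules.res_self] at h
    rw [h, localCoord_change hE b b' (l := l)]
    rw [MulCocycle.coordEven_change _ b b'] at hl'
    change (cocycle E hE).u b b' * _ * l' = 1 at hl'
    linear_combination hl' * l - l' * (cocycle E hE).u b b' * hl

/-- The section `e⁻¹ (θ - t)` of the extension. -/
noncomputable def coord (t : (cocycle E hE).torsorCocycle.Sec U)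
    {e : Γ((cocycle E hE).mulCocycle.line.even, U)}
    (he : (cocycle E hE).mulCocycle.line.IsGenerator U e) : Γ(E.right.odd, U) :=
  (exists_coord hE t he).choose

lemma res_coord (t : (cocycle E hE).torsorCocycle.Sec U)
    {e : Γ((cocycle E hE).mulCocycle.line.even, U)}
    (he : (cocycle E hE).mulCocycle.line.IsGenerator U e) (h : V ≤ U) (b : (trivSystem E).obj V)
    {l : Γ(X.even, V)} (hl : (cocycle E hE).mulCocycle.coordEven b
        ((cocycle E hE).mulCocycle.line.even.res h e) * l = 1) :
    E.right.odd.res h (coord hE t he) = localCoord b l (t.1 ⟨V, h⟩ b) :=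
  (exists_coord hE t he).choose_spec V h b l hl

lemma eq_coord (t : (cocycle E hE).torsorCocycle.Sec U)
    {e : Γ((cocycle E hE).mulCocycle.line.even, U)}
    (he : (cocycle E hE).mulCocycle.line.IsGenerator U e) {θ : Γ(E.right.odd, U)}
    (h : ∀ (V : X.even.Opens) (h : V ≤ U) (b : (trivSystem E).obj V)
      (l : Γ(X.even, V)), (cocycle E hE).mulCocycle.coordEven b
        ((cocycle E hE).mulCocycle.line.even.res h e) * l = 1 →
        E.right.odd.res h θ = localCoord b l (t.1 ⟨V, h⟩ b)) : coord hE t he = θ := by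
  refine E.right.odd.eq_of_locally fun x hx => ?_
  obtain ⟨V, hV, hxV, θ, hθ⟩ := hE.exists_le hx
  obtain ⟨l, hl⟩ := exists_inv_coordEven hE (he.res hV) ⟨θ, hθ⟩
  exact ⟨V, hV, hxV, (res_coord hE t he hV _ hl).trans (h V hV _ l hl).symm⟩

lemma isFrame_coord (t : (cocycle E hE).torsorCocycle.Sec U)
    {e : Γ((cocycle E hE).mulCocycle.line.even, U)}
    (he : (cocycle E hE).mulCocycle.line.IsGenerator U e) : IsFrame E U (coord hE t he) := by
  refine isFrame_of_locally fun x hx => ?_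
  obtain ⟨V, hV, hxV, θ, hθ⟩ := hE.exists_le hx
  obtain ⟨l, hl⟩ := exists_inv_coordEven hE (he.res hV) ⟨θ, hθ⟩
  refine ⟨V, hV, hxV, ?_⟩
  rw [res_coord hE t he hV _ hl]
  exact hθ.oddComb ((mul_comm _ _).trans hl) _

lemma coord_res (t : (cocycle E hE).torsorCocycle.Sec U)
    {e : Γ((cocycle E hE).mulCocycle.line.even, U)}
    (he : (cocycle E hE).mulCocycle.line.IsGenerator U e) (h : V ≤ U)
    (he' : (cocycle E hE).mulCocycle.line.IsGenerator V
      ((cocycle E hE).mulCocycle.line.even.res h e)) :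
    coord hE (t.res h) he' = E.right.odd.res h (coord hE t he) := by
  refine eq_coord hE _ _ fun W hW b l hl => ?_
  rw [Scheme.Modules.res_res] at hl ⊢
  exact res_coord hE t he (hW.trans h) b hl

lemma coord_smul (t : (cocycle E hE).torsorCocycle.Sec U)
    {e : Γ((cocycle E hE).mulCocycle.line.even, U)} {a a' : Γ(X.even, U)} (haa' : a * a' = 1)
    (he : (cocycle E hE).mulCocycle.line.IsGenerator U e)
    (he' : (cocycle E hE).mulCocycle.line.IsGenerator U (a • e)) :
    coord hE t he' = a' • coord hE t he := by
  refine eq_coord hE _ _ fun W hW b l hl => ?_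
  have hl' : (cocycle E hE).mulCocycle.coordEven b
      ((cocycle E hE).mulCocycle.line.even.res hW e) * (X.even.res hW a * l) = 1 := by
    rw [Scheme.Modules.res_smul, map_smul, smul_eq_mul] at hl
    rw [← hl]
    ring
  have h2 : X.even.res hW a' * (X.even.res hW a * l) = l := by
    rw [← mul_assoc, ← map_mul, mul_comm a', haa', map_one, one_mul]
  rw [Scheme.Modules.res_smul, res_coord hE t he hW b hl', localCoord, localCoord, smul_oddComb, h2,
    smul_neg, smul_smul, h2]

lemma coord_vadd (t : (cocycle E hE).torsorCocycle.Sec U)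
    {e : Γ((cocycle E hE).mulCocycle.line.even, U)}
    (he : (cocycle E hE).mulCocycle.line.IsGenerator U e) (s : Γ(X.odd, U)) :
    coord hE ((cocycle E hE).vadd ((cocycle E hE).mulCocycle.line.smulEven U s e) t) he =
      coord hE t he - E.right.smulEven U s (one E U) := by
  refine eq_coord hE _ _ fun W hW b l hl => ?_
  have h : ((cocycle E hE).vadd ((cocycle E hE).mulCocycle.line.smulEven U s e) t).1 ⟨W, hW⟩ b =
      t.1 ⟨W, hW⟩ b + (cocycle E hE).mulCocycle.coordEven b
        ((cocycle E hE).mulCocycle.line.even.res hW e) • X.odd.res hW s := by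
    rw [← MulCocycle.coordOdd_smulEven, ← res_smulEven]
    rfl
  rw [h, map_sub, res_coord hE t he hW b hl, res_smulEven, res_one, localCoord, localCoord,
    oddComb, oddComb, smul_add, smul_smul, mul_comm, hl, one_smul, neg_add, map_add, map_neg,
    map_neg, LinearMap.add_apply, LinearMap.neg_apply, LinearMap.neg_apply]
  abel

/-- Every extension with local frames is associated with the pair built from its affine cocycle. -/
noncomputable def associatedExtension : AssociatedExtension (cocycle E hE).pair E where
  coord t _ he := coord hE t he
  map_coord i t _ he he' := (coord_res hE t he i.le he').symm
  isBasis t _ he := isFrame_coord hE t he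
  coord_smul t _ _ _ hab he he' := coord_smul hE t hab he he'
  coord_vadd t _ he s := coord_vadd hE t he s

end SuperExtension

/-! ### Extensions by a line bundle and local frames -/

namespace SuperExtension

variable {X : Superscheme.{u}} {E : Under (structureSheaf X)} {U V W : X.even.Opens}

lemma evenComb_add (θ : Γ(E.right.odd, U)) (a a' : Γ(X.even, U)) (α α' : Γ(X.odd, U)) :
    evenComb E θ (a + a') (α + α') = evenComb E θ a α + evenComb E θ a' α' := by
  simp only [evenComb, add_smul, map_add, LinearMap.add_apply]
  abel

lemma oddComb_add (θ : Γ(E.right.odd, U)) (a a' : Γ(X.even, U)) (α α' : Γ(X.odd, U)) :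
    oddComb E θ (a + a') (α + α') = oddComb E θ a α + oddComb E θ a' α' := by
  simp only [oddComb, add_smul, map_add, LinearMap.add_apply]
  abel

lemma smul_evenComb (θ : Γ(E.right.odd, U)) (a b : Γ(X.even, U)) (β : Γ(X.odd, U)) :
    a • evenComb E θ b β = evenComb E θ (a * b) (a • β) := by
  simp [evenComb, mul_smul]

lemma smulEven_evenComb (θ : Γ(E.right.odd, U)) (s : Γ(X.odd, U)) (a : Γ(X.even, U))
    (α : Γ(X.odd, U)) :
    E.right.smulEven U s (evenComb E θ a α) = oddComb E θ (X.mul U s α) (a • s) := by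
  simp only [evenComb, oddComb, map_add, map_smul, LinearMap.smul_apply, E.right.smulEven_smulOdd]
  abel

lemma smulOdd_oddComb (θ : Γ(E.right.odd, U)) (s : Γ(X.odd, U)) (a : Γ(X.even, U))
    (α : Γ(X.odd, U)) :
    E.right.smulOdd U s (oddComb E θ a α) = evenComb E θ (X.mul U s α) (a • s) := by
  simp only [evenComb, oddComb, map_add, map_smul, LinearMap.smul_apply, E.right.smulOdd_smulEven]
  abel

lemma hom_even_app_eq (θ : Γ(E.right.odd, U)) (a : Γ(X.even, U)) :
    E.hom.even.app U a = evenComb E θ a 0 := by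
  rw [evenComb, map_zero, LinearMap.zero_apply, add_zero]
  exact hom_even_app E a

lemma hom_odd_app_eq (θ : Γ(E.right.odd, U)) (a : Γ(X.odd, U)) :
    E.hom.odd.app U a = oddComb E θ 0 a := by
  rw [oddComb, zero_smul, zero_add]
  exact hom_odd_app E a

/-- The coordinates `(a, α)` of the even section `a + α θ`. -/
noncomputable def evenCoord (b : (trivSystem E).obj U) :
    Γ(E.right.even, U) ≃ₗ[Γ(X.even, U)] Γ(X.even, U) × Γ(X.odd, U) :=
  (LinearEquiv.ofBijective
    { toFun := fun p => evenComb E b.1 p.1 p.2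
      map_add' := fun p p' => evenComb_add b.1 p.1 p'.1 p.2 p'.2
      map_smul' := fun a p => (smul_evenComb b.1 a p.1 p.2).symm }
    ⟨fun _ _ h => Prod.ext_iff.2 (b.2.even_inj h), fun x => by
      obtain ⟨a, α, rfl⟩ := b.2.exists_even x
      exact ⟨(a, α), rfl⟩⟩).symm

/-- The coordinates `(b, β)` of the odd section `b θ + β`. -/
noncomputable def oddCoord (b : (trivSystem E).obj U) :
    Γ(E.right.odd, U) ≃ₗ[Γ(X.even, U)] Γ(X.even, U) × Γ(X.odd, U) :=
  (LinearEquiv.ofBijective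
    { toFun := fun p => oddComb E b.1 p.1 p.2
      map_add' := fun p p' => oddComb_add b.1 p.1 p'.1 p.2 p'.2
      map_smul' := fun a p => (smul_oddComb b.1 a p.1 p.2).symm }
    ⟨fun _ _ h => Prod.ext_iff.2 (b.2.odd_inj h), fun x => by
      obtain ⟨a, α, rfl⟩ := b.2.exists_odd x
      exact ⟨(a, α), rfl⟩⟩).symm

lemma evenComb_evenCoord (b : (trivSystem E).obj U) (x : Γ(E.right.even, U)) :
    evenComb E b.1 (evenCoord b x).1 (evenCoord b x).2 = x :=
  (evenCoord b).symm_apply_apply x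

lemma oddComb_oddCoord (b : (trivSystem E).obj U) (x : Γ(E.right.odd, U)) :
    oddComb E b.1 (oddCoord b x).1 (oddCoord b x).2 = x :=
  (oddCoord b).symm_apply_apply x

lemma evenCoord_evenComb (b : (trivSystem E).obj U) (a : Γ(X.even, U)) (α : Γ(X.odd, U)) :
    evenCoord b (evenComb E b.1 a α) = (a, α) :=
  (evenCoord b).apply_symm_apply (a, α)

lemma oddCoord_oddComb (b : (trivSystem E).obj U) (a : Γ(X.even, U)) (α : Γ(X.odd, U)) :
    oddCoord b (oddComb E b.1 a α) = (a, α) :=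
  (oddCoord b).apply_symm_apply (a, α)

lemma evenCoord_res (h : V ≤ U) (b : (trivSystem E).obj U) (x : Γ(E.right.even, U)) :
    evenCoord ((trivSystem E).res h b) (E.right.even.res h x) =
      (X.even.res h (evenCoord b x).1, X.odd.res h (evenCoord b x).2) := by
  conv_lhs => rw [← evenComb_evenCoord b x, res_evenComb]
  exact evenCoord_evenComb ((trivSystem E).res h b) _ _

lemma oddCoord_res (h : V ≤ U) (b : (trivSystem E).obj U) (x : Γ(E.right.odd, U)) :
    oddCoord ((trivSystem E).res h b) (E.right.odd.res h x) =
      (X.even.res h (oddCoord b x).1, X.odd.res h (oddCoord b x).2) := by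
  conv_lhs => rw [← oddComb_oddCoord b x, res_oddComb]
  exact oddCoord_oddComb ((trivSystem E).res h b) _ _

lemma evenCoord_change (hE : HasLocalFrames E) (b b' : (trivSystem E).obj U)
    (x : Γ(E.right.even, U)) :
    evenCoord b' x = ((evenCoord b x).1 + X.mul U (evenCoord b x).2 ((cocycle E hE).γ b' b),
      (cocycle E hE).u b' b • (evenCoord b x).2) := by
  conv_lhs => rw [← evenComb_evenCoord b x, ← oddComb_cocycle hE b' b, evenComb_oddComb]
  exact evenCoord_evenComb b' _ _

lemma oddCoord_change (hE : HasLocalFrames E) (b b' : (trivSystem E).obj U)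
    (x : Γ(E.right.odd, U)) :
    oddCoord b' x = ((oddCoord b x).1 * (cocycle E hE).u b' b,
      (oddCoord b x).1 • (cocycle E hE).γ b' b + (oddCoord b x).2) := by
  conv_lhs => rw [← oddComb_oddCoord b x, ← oddComb_cocycle hE b' b, oddComb_oddComb]
  exact oddCoord_oddComb b' _ _

variable (hE : HasLocalFrames E)

/-- The line bundle of the coefficients of `θ`. They are transformed by the inverses of the
functions that transform `θ`. -/
noncomputable abbrev quotientLine : SuperModule X := (cocycle E hE).mulCocycle.inv.line

lemma isSection_evenCoord (x : Γ(E.right.even, U)) :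
    (cocycle E hE).mulCocycle.inv.twist.odd.IsSection U
      (fun W b => -(evenCoord b (E.right.even.res W.2 x)).2) := by
  intro W W' h h' b b'
  have key : -((cocycle E hE).u b' ((trivSystem E).res h' b) •
      X.odd.res h' (evenCoord b (E.right.even.res h x)).2) =
      (cocycle E hE).u b' ((trivSystem E).res h' b) •
        X.odd.res h' (-(evenCoord b (E.right.even.res h x)).2) := by
    rw [map_neg, smul_neg]
  refine Eq.trans (congrArg Neg.neg ?_) key
  have h2 := congrArg Prod.snd (evenCoord_change hE ((trivSystem E).res h' b) b'
    (E.right.even.res h' (E.right.even.res h x)))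
  rw [evenCoord_res, Scheme.Modules.res_res] at h2
  exact h2

lemma isSection_oddCoord (x : Γ(E.right.odd, U)) :
    (cocycle E hE).mulCocycle.inv.twist.even.IsSection U
      (fun W b => (oddCoord b (E.right.odd.res W.2 x)).1) := by
  intro W W' h h' b b'
  have h2 := congrArg Prod.fst (oddCoord_change hE ((trivSystem E).res h' b) b'
    (E.right.odd.res h' (E.right.odd.res h x)))
  rw [oddCoord_res, Scheme.Modules.res_res] at h2
  exact h2.trans (mul_comm _ _)

/-- The class of an even section modulo `𝒪_X`. -/
noncomputable def quotientEven (U : X.even.Opens) (x : Γ(E.right.even, U)) :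
    Γ((quotientLine hE).odd, U) :=
  (cocycle E hE).mulCocycle.inv.twist.isLinear_odd.ofCoord _ (isSection_evenCoord hE x)

/-- The class of an odd section modulo `𝒪_X`. -/
noncomputable def quotientOdd (U : X.even.Opens) (x : Γ(E.right.odd, U)) :
    Γ((quotientLine hE).even, U) :=
  (cocycle E hE).mulCocycle.inv.twist.isLinear_even.ofCoord _ (isSection_oddCoord hE x)

lemma coordOdd_quotientEven (h : V ≤ U) (b : (trivSystem E).obj V) (x : Γ(E.right.even, U)) :
    (cocycle E hE).mulCocycle.inv.coordOdd b
      ((quotientLine hE).odd.res h (quotientEven hE U x)) =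
        -(evenCoord b (E.right.even.res h x)).2 := rfl

lemma coordEven_quotientOdd (h : V ≤ U) (b : (trivSystem E).obj V) (x : Γ(E.right.odd, U)) :
    (cocycle E hE).mulCocycle.inv.coordEven b
      ((quotientLine hE).even.res h (quotientOdd hE U x)) =
        (oddCoord b (E.right.odd.res h x)).1 := rfl

lemma quotient_ext_odd {x y : Γ((quotientLine hE).odd, U)}
    (h : ∀ (V : X.even.Opens) (h : V ≤ U) (b : (trivSystem E).obj V),
      (cocycle E hE).mulCocycle.inv.coordOdd b ((quotientLine hE).odd.res h x) =
        (cocycle E hE).mulCocycle.inv.coordOdd b ((quotientLine hE).odd.res h y)) : x = y :=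
  (cocycle E hE).mulCocycle.inv.twist.isLinear_odd.ext_coord h

lemma quotient_ext_even {x y : Γ((quotientLine hE).even, U)}
    (h : ∀ (V : X.even.Opens) (h : V ≤ U) (b : (trivSystem E).obj V),
      (cocycle E hE).mulCocycle.inv.coordEven b ((quotientLine hE).even.res h x) =
        (cocycle E hE).mulCocycle.inv.coordEven b ((quotientLine hE).even.res h y)) : x = y :=
  (cocycle E hE).mulCocycle.inv.twist.isLinear_even.ext_coord h

lemma quotientEven_smulOdd (s : Γ(X.odd, U)) (x : Γ(E.right.odd, U)) :
    quotientEven hE U (E.right.smulOdd U s x) =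
      -(quotientLine hE).smulEven U s (quotientOdd hE U x) := by
  refine quotient_ext_odd hE fun V h b => ?_
  rw [map_neg, map_neg, res_smulEven, MulCocycle.coordOdd_smulEven, coordOdd_quotientEven,
    coordEven_quotientOdd, res_smulOdd, neg_inj]
  conv_lhs => rw [← oddComb_oddCoord b (E.right.odd.res h x), smulOdd_oddComb]
  exact congrArg Prod.snd (evenCoord_evenComb b _ _)

end SuperExtension

lemma MulCocycle.coordEven_smulOdd {X : Superscheme.{u}} {B : TrivSystem X.even}
    (c : MulCocycle X B) {U : X.even.Opens} (b : B.obj U) (s : Γ(X.odd, U))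
    (x : Γ(c.line.odd, U)) :
    c.coordEven b (c.line.smulOdd U s x) = X.mul U s (c.coordOdd b x) :=
  c.twist.coord_smulOdd s x b

namespace SuperExtension

variable {X : Superscheme.{u}} {E : Under (structureSheaf X)} {U V W : X.even.Opens}
variable (hE : HasLocalFrames E)

lemma quotientOdd_smulEven (s : Γ(X.odd, U)) (x : Γ(E.right.even, U)) :
    quotientOdd hE U (E.right.smulEven U s x) =
      -(quotientLine hE).smulOdd U s (quotientEven hE U x) := by
  refine quotient_ext_even hE fun V h b => ?_
  rw [map_neg, map_neg, res_smulOdd, MulCocycle.coordEven_smulOdd, coordOdd_quotientEven,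
    coordEven_quotientOdd, res_smulEven, map_neg, neg_neg]
  conv_lhs => rw [← evenComb_evenCoord b (E.right.even.res h x), smulEven_evenComb]
  exact congrArg Prod.fst (oddCoord_oddComb b _ _)

lemma quotientEven_add (x y : Γ(E.right.even, U)) :
    quotientEven hE U (x + y) = quotientEven hE U x + quotientEven hE U y :=
  quotient_ext_odd hE fun V h b => by
    rw [map_add, map_add, coordOdd_quotientEven, coordOdd_quotientEven, coordOdd_quotientEven,
      map_add, map_add, Prod.snd_add, neg_add]

lemma quotientEven_smul (a : Γ(X.even, U)) (x : Γ(E.right.even, U)) :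
    quotientEven hE U (a • x) = a • quotientEven hE U x :=
  quotient_ext_odd hE fun V h b => by
    rw [Scheme.Modules.res_smul, map_smul, coordOdd_quotientEven, coordOdd_quotientEven,
      Scheme.Modules.res_smul, map_smul, Prod.smul_snd, smul_neg]

lemma quotientEven_res (h : V ≤ U) (x : Γ(E.right.even, U)) :
    quotientEven hE V (E.right.even.res h x) = (quotientLine hE).odd.res h (quotientEven hE U x) :=
  quotient_ext_odd hE fun V h b => by
    rw [Scheme.Modules.res_res, coordOdd_quotientEven, coordOdd_quotientEven,
      Scheme.Modules.res_res]

lemma quotientOdd_add (x y : Γ(E.right.odd, U)) :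
    quotientOdd hE U (x + y) = quotientOdd hE U x + quotientOdd hE U y :=
  quotient_ext_even hE fun V h b => by
    rw [map_add, map_add, coordEven_quotientOdd, coordEven_quotientOdd, coordEven_quotientOdd,
      map_add, map_add, Prod.fst_add]

lemma quotientOdd_smul (a : Γ(X.even, U)) (x : Γ(E.right.odd, U)) :
    quotientOdd hE U (a • x) = a • quotientOdd hE U x :=
  quotient_ext_even hE fun V h b => by
    rw [Scheme.Modules.res_smul, map_smul, coordEven_quotientOdd, coordEven_quotientOdd,
      Scheme.Modules.res_smul, map_smul, Prod.smul_fst]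

lemma quotientOdd_res (h : V ≤ U) (x : Γ(E.right.odd, U)) :
    quotientOdd hE V (E.right.odd.res h x) = (quotientLine hE).even.res h (quotientOdd hE U x) :=
  quotient_ext_even hE fun V h b => by
    rw [Scheme.Modules.res_res, coordEven_quotientOdd, coordEven_quotientOdd,
      Scheme.Modules.res_res]

/-- The projection of an extension with local frames onto a line bundle of rank `0|1`: the odd
section `b θ + β` is sent to `b` and the even section `a + α θ` to `-α`, where the sign comes from
the parity shift. -/
noncomputable def quotientHom : E.right ⟶ (quotientLine hE).shift where
  even := Scheme.Modules.homMk (N := (quotientLine hE).odd)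
    (fun U => ⟨⟨quotientEven hE U, quotientEven_add hE⟩, quotientEven_smul hE⟩)
    (fun h x => quotientEven_res hE h x)
  odd := Scheme.Modules.homMk (N := (quotientLine hE).even)
    (fun U => ⟨⟨quotientOdd hE U, quotientOdd_add hE⟩, quotientOdd_smul hE⟩)
    (fun h x => quotientOdd_res hE h x)
  app_smulEven s x := quotientOdd_smulEven hE s x
  app_smulOdd s x := quotientEven_smulOdd hE s x

lemma quotientEven_eq_zero_iff (b : (trivSystem E).obj U) (x : Γ(E.right.even, U)) :
    quotientEven hE U x = 0 ↔ (evenCoord b x).2 = 0 := by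
  rw [← ((cocycle E hE).mulCocycle.inv.coordOdd b).map_eq_zero_iff]
  have := coordOdd_quotientEven hE le_rfl b x
  rw [Scheme.Modules.res_self, Scheme.Modules.res_self] at this
  rw [this, neg_eq_zero]

lemma quotientOdd_eq_zero_iff (b : (trivSystem E).obj U) (x : Γ(E.right.odd, U)) :
    quotientOdd hE U x = 0 ↔ (oddCoord b x).1 = 0 := by
  rw [← ((cocycle E hE).mulCocycle.inv.coordEven b).map_eq_zero_iff]
  have := coordEven_quotientOdd hE le_rfl b x
  rw [Scheme.Modules.res_self, Scheme.Modules.res_self] at this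
  rw [this]

lemma quotientEven_evenComb (b : (trivSystem E).obj U) (y : Γ((quotientLine hE).odd, U)) :
    quotientEven hE U (evenComb E b.1 0 (-(cocycle E hE).mulCocycle.inv.coordOdd b y)) = y := by
  apply ((cocycle E hE).mulCocycle.inv.coordOdd b).injective
  have := coordOdd_quotientEven hE le_rfl b
    (evenComb E b.1 0 (-(cocycle E hE).mulCocycle.inv.coordOdd b y))
  rw [Scheme.Modules.res_self, Scheme.Modules.res_self, evenCoord_evenComb, neg_neg] at this
  exact this

lemma quotientOdd_oddComb (b : (trivSystem E).obj U) (y : Γ((quotientLine hE).even, U)) :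
    quotientOdd hE U (oddComb E b.1 ((cocycle E hE).mulCocycle.inv.coordEven b y) 0) = y := by
  apply ((cocycle E hE).mulCocycle.inv.coordEven b).injective
  have := coordEven_quotientOdd hE le_rfl b
    (oddComb E b.1 ((cocycle E hE).mulCocycle.inv.coordEven b y) 0)
  rw [Scheme.Modules.res_self, Scheme.Modules.res_self, oddCoord_oddComb] at this
  exact this

end SuperExtension

namespace SuperModule

/-- A sequence of sheaves that is exact on the sections over a basis of small open sets is exact. -/
lemma isShortExactSheaf_of_locally {Z : Scheme.{u}} {A B C : Z.Modules} (f : A ⟶ B) (g : B ⟶ C)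
    (h : ∀ (U : Z.Opens), ∀ x ∈ U, ∃ (V : Z.Opens) (_ : V ≤ U), x ∈ V ∧
      Function.Injective (f.app V) ∧
      (∀ b : Γ(B, V), g.app V b = 0 ↔ ∃ a : Γ(A, V), f.app V a = b) ∧
      Function.Surjective (g.app V)) : IsShortExactSheaf f g := by
  have hinj (U : Z.Opens) : Function.Injective (f.app U) := fun a a' haa' => by
    refine A.eq_of_locally fun x hx => ?_
    obtain ⟨V, hV, hxV, hi, -, -⟩ := h U x hx
    refine ⟨V, hV, hxV, hi ?_⟩
    rw [Scheme.Modules.Hom.app_res, Scheme.Modules.Hom.app_res, haa']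
  refine ⟨hinj, fun U b => ⟨fun hb => ?_, ?_⟩, fun U c x hx => ?_⟩
  · obtain ⟨a, ha⟩ := A.exists_glue (U := U) (fun V hV a => f.app V a = B.res hV b)
      (fun V W hV hW a ha => by
        rw [Scheme.Modules.Hom.app_res, ha, Scheme.Modules.res_res])
      (fun x hx => by
        obtain ⟨V, hV, hxV, -, hk, -⟩ := h U x hx
        exact ⟨V, hV, hxV, (hk _).1 (by rw [Scheme.Modules.Hom.app_res, hb, map_zero])⟩)
      (fun V hV a a' ha ha' => hinj V (ha.trans ha'.symm))
    refine ⟨a, B.eq_of_locally fun x hx => ?_⟩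
    obtain ⟨V, hV, hxV, -, hk, -⟩ := h U x hx
    obtain ⟨a', ha'⟩ := (hk (B.res hV b)).1 (by rw [Scheme.Modules.Hom.app_res, hb, map_zero])
    refine ⟨V, hV, hxV, ?_⟩
    rw [← Scheme.Modules.Hom.app_res, ha V hV a' ha', ha']
  · rintro ⟨a, rfl⟩
    refine C.eq_of_locally fun x hx => ?_
    obtain ⟨V, hV, hxV, -, hk, -⟩ := h U x hx
    refine ⟨V, hV, hxV, ?_⟩
    rw [map_zero, ← Scheme.Modules.Hom.app_res]
    exact (hk _).2 ⟨A.res hV a, Scheme.Modules.Hom.app_res f hV a⟩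
  · obtain ⟨V, hV, hxV, -, -, hs⟩ := h U x hx
    obtain ⟨b, hb⟩ := hs (C.res hV c)
    exact ⟨V, hxV, hV, b, hb⟩

end SuperModule

namespace SuperExtension

variable {X : Superscheme.{u}} {E : Under (structureSheaf X)} {U V W : X.even.Opens}

lemma HasLocalFrames.isBundleExtension (hE : HasLocalFrames E) : IsBundleExtension E := by
  refine ⟨fun x => ?_, _, quotientHom hE, (cocycle E hE).mulCocycle.inv.isLocallyFree_shift_line
    (cocycle E hE).exists_triv, isShortExactSheaf_of_locally _ _ fun U x hx => ?_,
    isShortExactSheaf_of_locally _ _ fun U x hx => ?_⟩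
  · obtain ⟨U, hx, θ, hθ⟩ := hE x
    exact ⟨U, hx, _, _, hθ⟩
  · obtain ⟨V, hV, hxV, θ, hθ⟩ := hE.exists_le hx
    refine ⟨V, hV, hxV, fun a a' h => ?_, fun y => ?_, fun y =>
      ⟨_, quotientEven_evenComb hE ⟨θ, hθ⟩ y⟩⟩
    · exact (hθ.even_inj (((hom_even_app_eq θ a).symm.trans h).trans (hom_even_app_eq θ a'))).1
    · refine (quotientEven_eq_zero_iff hE ⟨θ, hθ⟩ y).trans ⟨fun h => ?_, ?_⟩
      · refine ⟨(evenCoord ⟨θ, hθ⟩ y).1, ?_⟩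
        refine Eq.trans ?_ (evenComb_evenCoord (E := E) ⟨θ, hθ⟩ y)
        rw [h]
        exact hom_even_app_eq θ _
      · rintro ⟨a, rfl⟩
        exact congrArg Prod.snd ((congrArg (evenCoord (E := E) ⟨θ, hθ⟩) (hom_even_app_eq θ a)).trans
          (evenCoord_evenComb (E := E) ⟨θ, hθ⟩ a 0))
  · obtain ⟨V, hV, hxV, θ, hθ⟩ := hE.exists_le hx
    refine ⟨V, hV, hxV, fun a a' h => ?_, fun y => ?_, fun y =>
      ⟨_, quotientOdd_oddComb hE ⟨θ, hθ⟩ y⟩⟩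
    · exact (hθ.odd_inj (((hom_odd_app_eq θ a).symm.trans h).trans (hom_odd_app_eq θ a'))).2
    · refine (quotientOdd_eq_zero_iff hE ⟨θ, hθ⟩ y).trans ⟨fun h => ?_, ?_⟩
      · refine ⟨(oddCoord ⟨θ, hθ⟩ y).2, ?_⟩
        refine Eq.trans ?_ (oddComb_oddCoord (E := E) ⟨θ, hθ⟩ y)
        rw [h]
        exact hom_odd_app_eq θ _
      · rintro ⟨a, rfl⟩
        exact congrArg Prod.fst ((congrArg (oddCoord (E := E) ⟨θ, hθ⟩) (hom_odd_app_eq θ a)).trans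
          (oddCoord_oddComb (E := E) ⟨θ, hθ⟩ 0 a))

/-- A local lift of a generator of the quotient is a frame. -/
lemma hasLocalFrames_of_isShortExact {M : SuperModule X} (q : E.right ⟶ M)
    (hM : M.IsLocallyFree 0 1) (hq : IsShortExact E.hom q) : HasLocalFrames E := by
  intro x
  obtain ⟨U, hx, e, m, hm⟩ := hM x
  obtain ⟨V, hxV, hV, θ, hθ⟩ := hq.2.2.2 U (m 0) x hx
  have hm' : M.IsBasis U (fun j : Fin 0 => j.elim0) (fun _ : Fin 1 => m 0) := by
    convert! hm using 1
    exact funext fun j => congrArg m (Subsingleton.elim 0 j)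
  rw [isBasis_zero_one_iff] at hm'
  refine ⟨V, hxV, θ, isFrame_iff.2 fun W hW => ?_⟩
  obtain ⟨h0, h1⟩ := hm' W (hW.trans hV)
  have hqθ : q.odd.app W (E.right.odd.res hW θ) = M.odd.res (hW.trans hV) (m 0) := by
    rw [Scheme.Modules.Hom.app_res, hθ]
    exact M.odd.res_res hV hW _
  -- As `q` vanishes on `𝒪_X`, it reads off the coefficient of `θ`; the difference with the
  -- corresponding multiple of `θ` then lies in the kernel `𝒪_X` of `q`.
  have he (a : Γ(X.even, W)) (α : Γ(X.odd, W)) :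
      q.even.app W (evenComb E (E.right.odd.res hW θ) a α) =
        M.smulOdd W α (M.odd.res (hW.trans hV) (m 0)) := by
    rw [evenComb, map_add, q.app_smulOdd, hqθ, ← hom_even_app]
    exact (congrArg (· + _) ((hq.1.2.1 W _).2 ⟨a, rfl⟩)).trans (zero_add _)
  have ho (a : Γ(X.even, W)) (α : Γ(X.odd, W)) :
      q.odd.app W (oddComb E (E.right.odd.res hW θ) a α) = a • M.odd.res (hW.trans hV) (m 0) := by
    rw [oddComb, map_add, Scheme.Modules.Hom.app_smul, hqθ, ← hom_odd_app]
    exact (congrArg (_ + ·) ((hq.2.2.1 W _).2 ⟨α, rfl⟩)).trans (add_zero _)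
  refine ⟨⟨fun p p' h => ?_, fun y => ?_⟩, ⟨fun p p' h => ?_, fun y => ?_⟩⟩
  · have h2 : p.2 = p'.2 := h0.1 (by
      have := congrArg (q.even.app W) h
      rwa [he, he] at this)
    refine Prod.ext (hq.1.1 W ?_) h2
    simp only [evenComb, h2] at h
    exact (hom_even_app E _).trans ((add_right_cancel h).trans (hom_even_app E _).symm)
  · obtain ⟨α, hα⟩ := h0.2 (q.even.app W y)
    obtain ⟨a, ha⟩ := (hq.1.2.1 W (y - E.right.smulOdd W α (E.right.odd.res hW θ))).1
      (by rw [map_sub, q.app_smulOdd, hqθ]; exact sub_eq_zero.2 hα.symm)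
    refine ⟨(a, α), ?_⟩
    exact (congrArg (· + _) ((hom_even_app E a).symm.trans ha)).trans (sub_add_cancel _ _)
  · have h2 : p.1 = p'.1 := h1.1 (by
      have := congrArg (q.odd.app W) h
      rwa [ho, ho] at this)
    refine Prod.ext h2 (hq.2.1 W ?_)
    simp only [oddComb, h2] at h
    exact (hom_odd_app E _).trans ((add_left_cancel h).trans (hom_odd_app E _).symm)
  · obtain ⟨a, ha⟩ := h1.2 (q.odd.app W y)
    obtain ⟨α, hα⟩ := (hq.2.2.1 W (y - a • E.right.odd.res hW θ)).1
      (by rw [map_sub, Scheme.Modules.Hom.app_smul, hqθ]; exact sub_eq_zero.2 ha.symm)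
    refine ⟨(a, α), ?_⟩
    exact (congrArg (_ + ·) ((hom_odd_app E α).symm.trans hα)).trans (add_sub_cancel _ _)

lemma isBundleExtension_iff : IsBundleExtension E ↔ HasLocalFrames E :=
  ⟨fun ⟨_, _, q, hM, hq⟩ => hasLocalFrames_of_isShortExact q hM hq, fun h => h.isBundleExtension⟩

end SuperExtension

/-! ### Homomorphisms of extensions and their frames -/

namespace SuperExtension

variable {X : Superscheme.{u}} {E E' : Under (structureSheaf X)} {U V W : X.even.Opens}

lemma app_one (φ : E ⟶ E') (U : X.even.Opens) : φ.right.even.app U (one E U) = one E' U := by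
  have h : (E.hom ≫ φ.right).even.app U (1 : Γ(X.even, U)) =
      E'.hom.even.app U (1 : Γ(X.even, U)) := by
    rw [Under.w φ]
  exact h

lemma app_evenComb (φ : E ⟶ E') (θ : Γ(E.right.odd, U)) (a : Γ(X.even, U)) (α : Γ(X.odd, U)) :
    φ.right.even.app U (evenComb E θ a α) = evenComb E' (φ.right.odd.app U θ) a α := by
  rw [evenComb, map_add, Scheme.Modules.Hom.app_smul, app_one, φ.right.app_smulOdd]
  rfl

lemma app_oddComb (φ : E ⟶ E') (θ : Γ(E.right.odd, U)) (a : Γ(X.even, U)) (α : Γ(X.odd, U)) :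
    φ.right.odd.app U (oddComb E θ a α) = oddComb E' (φ.right.odd.app U θ) a α := by
  rw [oddComb, map_add, Scheme.Modules.Hom.app_smul, φ.right.app_smulEven, app_one]
  rfl

/-- A homomorphism of extensions is determined by the images of local frames. -/
lemma hom_ext_of_frames {φ ψ : E ⟶ E'} (h : ∀ x : X.even, ∃ (U : X.even.Opens) (_ : x ∈ U)
    (θ : Γ(E.right.odd, U)), IsFrame E U θ ∧ φ.right.odd.app U θ = ψ.right.odd.app U θ) :
    φ = ψ := by
  have h' : ∀ (U : X.even.Opens), ∀ x ∈ U, ∃ (V : X.even.Opens) (_ : V ≤ U), x ∈ V ∧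
      ∃ θ : Γ(E.right.odd, V), IsFrame E V θ ∧ φ.right.odd.app V θ = ψ.right.odd.app V θ := by
    intro U x hx
    obtain ⟨V, hxV, θ, hθ, e⟩ := h x
    refine ⟨U ⊓ V, inf_le_left, ⟨hx, hxV⟩, _, hθ.res inf_le_right, ?_⟩
    rw [Scheme.Modules.Hom.app_res, Scheme.Modules.Hom.app_res, e]
  apply Under.UnderMorphism.ext
  refine SuperModule.hom_ext (fun U y => ?_) (fun U y => ?_)
  · refine E'.right.even.eq_of_locally fun x hx => ?_
    obtain ⟨V, hV, hxV, θ, hθ, e⟩ := h' U x hx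
    refine ⟨V, hV, hxV, ?_⟩
    obtain ⟨a, α, ha⟩ := hθ.exists_even (E.right.even.res hV y)
    rw [← Scheme.Modules.Hom.app_res, ← Scheme.Modules.Hom.app_res, ha, app_evenComb, app_evenComb,
      e]
  · refine E'.right.odd.eq_of_locally fun x hx => ?_
    obtain ⟨V, hV, hxV, θ, hθ, e⟩ := h' U x hx
    refine ⟨V, hV, hxV, ?_⟩
    obtain ⟨a, α, ha⟩ := hθ.exists_odd (E.right.odd.res hV y)
    rw [← Scheme.Modules.Hom.app_res, ← Scheme.Modules.Hom.app_res, ha, app_oddComb, app_oddComb,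
      e]

lemma app_injective (φ : E ≅ E') (U : X.even.Opens) :
    Function.Bijective (φ.hom.right.even.app U) ∧ Function.Bijective (φ.hom.right.odd.app U) := by
  have h1 : φ.hom.right ≫ φ.inv.right = 𝟙 _ := congrArg CommaMorphism.right φ.hom_inv_id
  have h2 : φ.inv.right ≫ φ.hom.right = 𝟙 _ := congrArg CommaMorphism.right φ.inv_hom_id
  have e1 (x : Γ(E.right.even, U)) : φ.inv.right.even.app U (φ.hom.right.even.app U x) = x :=
    congrArg (fun f : E.right ⟶ E.right => f.even.app U x) h1
  have e2 (x : Γ(E'.right.even, U)) : φ.hom.right.even.app U (φ.inv.right.even.app U x) = x :=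
    congrArg (fun f : E'.right ⟶ E'.right => f.even.app U x) h2
  have o1 (x : Γ(E.right.odd, U)) : φ.inv.right.odd.app U (φ.hom.right.odd.app U x) = x :=
    congrArg (fun f : E.right ⟶ E.right => f.odd.app U x) h1
  have o2 (x : Γ(E'.right.odd, U)) : φ.hom.right.odd.app U (φ.inv.right.odd.app U x) = x :=
    congrArg (fun f : E'.right ⟶ E'.right => f.odd.app U x) h2
  exact ⟨⟨Function.LeftInverse.injective e1, Function.RightInverse.surjective e2⟩,
    ⟨Function.LeftInverse.injective o1, Function.RightInverse.surjective o2⟩⟩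

lemma IsFrame.app (φ : E ≅ E') {θ : Γ(E.right.odd, U)} (hθ : IsFrame E U θ) :
    IsFrame E' U (φ.hom.right.odd.app U θ) := by
  rw [isFrame_iff] at hθ ⊢
  intro V h
  rw [← Scheme.Modules.Hom.app_res]
  refine ⟨?_, ?_⟩
  · convert! (app_injective φ V).1.comp (hθ V h).1 using 1
    funext c
    exact (app_evenComb φ.hom _ _ _).symm
  · convert! (app_injective φ V).2.comp (hθ V h).2 using 1
    funext c
    exact (app_oddComb φ.hom _ _ _).symm

/-- Matched local frames of two extensions, compatible with affine transformations, define a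
homomorphism of extensions. -/
lemma exists_hom_of_frames (S : ∀ U : X.even.Opens, Γ(E.right.odd, U) → Γ(E'.right.odd, U) → Prop)
    (hS : ∀ U θ θ', S U θ θ' → IsFrame E U θ)
    (hres : ∀ (U V : X.even.Opens) (h : V ≤ U) θ θ', S U θ θ' →
      S V (E.right.odd.res h θ) (E'.right.odd.res h θ'))
    (hex : ∀ x : X.even, ∃ (U : X.even.Opens) (_ : x ∈ U) (θ : _) (θ' : _), S U θ θ')
    (hchange : ∀ U θ θ' θ₁ θ₁' (v : Γ(X.even, U)) (γ : Γ(X.odd, U)), S U θ θ' → S U θ₁ θ₁' →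
      θ₁ = oddComb E θ v γ → θ₁' = oddComb E' θ' v γ) :
    ∃ φ : E ⟶ E', ∀ U θ θ', S U θ θ' → φ.right.odd.app U θ = θ' := by
  have hex' : ∀ (U : X.even.Opens), ∀ x ∈ U, ∃ (V : X.even.Opens) (_ : V ≤ U), x ∈ V ∧
      ∃ θ θ', S V θ θ' := by
    intro U x hx
    obtain ⟨V, hxV, θ, θ', h⟩ := hex x
    exact ⟨U ⊓ V, inf_le_left, ⟨hx, hxV⟩, _, _, hres _ _ inf_le_right _ _ h⟩
  -- The relations defined by matching coordinates do not depend on the matched frames.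
  let R₀ (V : X.even.Opens) (x : Γ(E.right.even, V)) (y : Γ(E'.right.even, V)) : Prop :=
    ∃ θ θ' a α, S V θ θ' ∧ x = evenComb E θ a α ∧ y = evenComb E' θ' a α
  let R₁ (V : X.even.Opens) (x : Γ(E.right.odd, V)) (y : Γ(E'.right.odd, V)) : Prop :=
    ∃ θ θ' a α, S V θ θ' ∧ x = oddComb E θ a α ∧ y = oddComb E' θ' a α
  have norm₀ : ∀ V θ θ' x y, S V θ θ' → R₀ V x y →
      ∃ a α, x = evenComb E θ a α ∧ y = evenComb E' θ' a α := by
    rintro V θ θ' _ _ hθ ⟨θ₁, θ₁', a, α, h, rfl, rfl⟩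
    obtain ⟨v, γ, e⟩ := (hS _ _ _ hθ).exists_odd θ₁
    have e' := hchange V _ _ _ _ v γ hθ h e
    exact ⟨a + X.mul V α γ, v • α, by rw [e, evenComb_oddComb], by rw [e', evenComb_oddComb]⟩
  have norm₁ : ∀ V θ θ' x y, S V θ θ' → R₁ V x y →
      ∃ a α, x = oddComb E θ a α ∧ y = oddComb E' θ' a α := by
    rintro V θ θ' _ _ hθ ⟨θ₁, θ₁', a, α, h, rfl, rfl⟩
    obtain ⟨v, γ, e⟩ := (hS _ _ _ hθ).exists_odd θ₁
    have e' := hchange V _ _ _ _ v γ hθ h e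
    exact ⟨a * v, a • γ + α, by rw [e, oddComb_oddComb], by rw [e', oddComb_oddComb]⟩
  obtain ⟨f, hf⟩ := Scheme.Modules.exists_hom_of_rel E.right.even E'.right.even R₀
    (by
      rintro V W h _ _ ⟨θ, θ', a, α, hθ, rfl, rfl⟩
      exact ⟨_, _, X.even.res h a, X.odd.res h α, hres _ _ h _ _ hθ, by simp, by simp⟩)
    (fun U x z hz => by
      obtain ⟨V, hV, hzV, θ, θ', h⟩ := hex' U z hz
      obtain ⟨a, α, ha⟩ := (hS _ _ _ h).exists_even (E.right.even.res hV x)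
      exact ⟨V, hV, hzV, _, θ, θ', a, α, h, ha, rfl⟩)
    (by
      rintro V _ t _ ht ⟨θ, θ', a, α, hθ, rfl, rfl⟩
      obtain ⟨a', α', e, rfl⟩ := norm₀ _ _ _ _ _ hθ ht
      obtain ⟨rfl, rfl⟩ := (hS _ _ _ hθ).even_inj e
      rfl)
    (by
      rintro V _ _ s t ⟨θ, θ', a, α, hθ, rfl, rfl⟩ h
      obtain ⟨a', α', rfl, rfl⟩ := norm₀ _ _ _ _ _ hθ h
      exact ⟨θ, θ', a + a', α + α', hθ, (evenComb_add _ _ _ _ _).symm,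
        (evenComb_add _ _ _ _ _).symm⟩)
    (by
      rintro V c _ _ ⟨θ, θ', a, α, hθ, rfl, rfl⟩
      exact ⟨θ, θ', c * a, c • α, hθ, smul_evenComb _ _ _ _, smul_evenComb _ _ _ _⟩)
  obtain ⟨g, hg⟩ := Scheme.Modules.exists_hom_of_rel E.right.odd E'.right.odd R₁
    (by
      rintro V W h _ _ ⟨θ, θ', a, α, hθ, rfl, rfl⟩
      exact ⟨_, _, X.even.res h a, X.odd.res h α, hres _ _ h _ _ hθ, by simp, by simp⟩)
    (fun U x z hz => by
      obtain ⟨V, hV, hzV, θ, θ', h⟩ := hex' U z hz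
      obtain ⟨a, α, ha⟩ := (hS _ _ _ h).exists_odd (E.right.odd.res hV x)
      exact ⟨V, hV, hzV, _, θ, θ', a, α, h, ha, rfl⟩)
    (by
      rintro V _ t _ ht ⟨θ, θ', a, α, hθ, rfl, rfl⟩
      obtain ⟨a', α', e, rfl⟩ := norm₁ _ _ _ _ _ hθ ht
      obtain ⟨rfl, rfl⟩ := (hS _ _ _ hθ).odd_inj e
      rfl)
    (by
      rintro V _ _ s t ⟨θ, θ', a, α, hθ, rfl, rfl⟩ h
      obtain ⟨a', α', rfl, rfl⟩ := norm₁ _ _ _ _ _ hθ h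
      exact ⟨θ, θ', a + a', α + α', hθ, (oddComb_add _ _ _ _ _).symm, (oddComb_add _ _ _ _ _).symm⟩)
    (by
      rintro V c _ _ ⟨θ, θ', a, α, hθ, rfl, rfl⟩
      exact ⟨θ, θ', c * a, c • α, hθ, smul_oddComb _ _ _ _, smul_oddComb _ _ _ _⟩)
  have hf' : ∀ V θ θ' a α, S V θ θ' → f.app V (evenComb E θ a α) = evenComb E' θ' a α :=
    fun V θ θ' a α h => hf V _ _ ⟨θ, θ', a, α, h, rfl, rfl⟩
  have hg' : ∀ V θ θ' a α, S V θ θ' → g.app V (oddComb E θ a α) = oddComb E' θ' a α :=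
    fun V θ θ' a α h => hg V _ _ ⟨θ, θ', a, α, h, rfl, rfl⟩
  have hs₀ : ∀ (U : X.even.Opens) (s : Γ(X.odd, U)) (m : Γ(E.right.even, U)),
      g.app U (E.right.smulEven U s m) = E'.right.smulEven U s (f.app U m) := fun U s m => by
    refine E'.right.odd.eq_of_locally fun x hx => ?_
    obtain ⟨V, hV, hxV, θ, θ', h⟩ := hex' U x hx
    refine ⟨V, hV, hxV, ?_⟩
    obtain ⟨a, α, ha⟩ := (hS _ _ _ h).exists_even (E.right.even.res hV m)
    rw [← Scheme.Modules.Hom.app_res, res_smulEven, res_smulEven, ← Scheme.Modules.Hom.app_res, ha,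
      smulEven_evenComb, hf' V _ _ _ _ h, hg' V _ _ _ _ h, smulEven_evenComb]
  have hs₁ : ∀ (U : X.even.Opens) (s : Γ(X.odd, U)) (m : Γ(E.right.odd, U)),
      f.app U (E.right.smulOdd U s m) = E'.right.smulOdd U s (g.app U m) := fun U s m => by
    refine E'.right.even.eq_of_locally fun x hx => ?_
    obtain ⟨V, hV, hxV, θ, θ', h⟩ := hex' U x hx
    refine ⟨V, hV, hxV, ?_⟩
    obtain ⟨a, α, ha⟩ := (hS _ _ _ h).exists_odd (E.right.odd.res hV m)
    rw [← Scheme.Modules.Hom.app_res, res_smulOdd, res_smulOdd, ← Scheme.Modules.Hom.app_res, ha,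
      smulOdd_oddComb, hf' V _ _ _ _ h, hg' V _ _ _ _ h, smulOdd_oddComb]
  have hone (U : X.even.Opens) : f.app U (one E U) = one E' U := by
    refine E'.right.even.eq_of_locally fun x hx => ?_
    obtain ⟨V, hV, hxV, θ, θ', h⟩ := hex' U x hx
    refine ⟨V, hV, hxV, ?_⟩
    rw [← Scheme.Modules.Hom.app_res, res_one, res_one]
    simpa [evenComb] using hf' V _ _ 1 0 h
  refine ⟨Under.homMk ⟨f, g, fun s m => hs₀ _ s m, fun s m => hs₁ _ s m⟩
    (SuperModule.hom_ext (fun U a => ?_) (fun U a => ?_)), fun U θ θ' h => ?_⟩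
  · refine (congrArg (f.app U) (hom_even_app E a)).trans ?_
    refine (Scheme.Modules.Hom.app_smul f _ _).trans ?_
    rw [hone]
    exact (hom_even_app E' a).symm
  · refine (congrArg (g.app U) (hom_odd_app E a)).trans ?_
    refine (hs₀ U _ _).trans ?_
    rw [hone]
    exact (hom_odd_app E' a).symm
  · have := hg' U θ θ' 1 0 h
    rwa [oddComb_one_zero, oddComb_one_zero] at this

end SuperExtension

/-! ### Extensions associated with pairs -/

namespace AssociatedExtension

variable {X : Superscheme.{u}} {P Q : LineTorsorPair X} {E E' : Under (structureSheaf X)}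
  (A : AssociatedExtension P E) (A' : AssociatedExtension Q E') {U V : X.even.Opens}

open SuperExtension

lemma isFrame_coord (t : P.sec U) {e : Γ(P.line.even, U)} (he : P.line.IsGenerator U e) :
    IsFrame E U (A.coord t e he) := A.isBasis t e he

lemma res_coord (h : V ≤ U) (t : P.sec U) {e : Γ(P.line.even, U)} (he : P.line.IsGenerator U e) :
    E.right.odd.res h (A.coord t e he) =
      A.coord (P.resSec h t) (P.line.even.res h e) (he.res h) :=
  A.map_coord (homOfLE h) t e he (he.res h)

lemma coord_translate_smul (t : P.sec U) {e : Γ(P.line.even, U)} (he : P.line.IsGenerator U e)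
    {a b : Γ(X.even, U)} (hab : a * b = 1) (s : Γ(X.odd, U)) :
    A.coord (P.translate s e t) (a • e) (he.smul hab) =
      oddComb E (A.coord t e he) b (-(b • s)) := by
  rw [A.coord_smul _ e a b hab he]
  refine (congrArg (b • ·) (A.coord_vadd t e he s)).trans ?_
  change b • (A.coord t e he - E.right.smulEven U s (one E U)) = _
  rw [oddComb, smul_sub, map_neg, map_smul, sub_eq_add_neg]
  rfl

lemma coord_inj {t t' : P.sec U} {e e' : Γ(P.line.even, U)} {he : P.line.IsGenerator U e}
    {he' : P.line.IsGenerator U e'} (h : A.coord t e he = A.coord t' e' he') :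
    t = t' ∧ e = e' := by
  obtain ⟨a, b, hab, rfl, -⟩ := he.exists_smul_eq he'
  obtain ⟨s, rfl⟩ := LineTorsorPair.exists_translate he t t'
  rw [A.coord_translate_smul t he hab s, ← oddComb_one_zero (A.coord t e he), oddComb_oddComb] at h
  obtain ⟨h1, h2⟩ := (A.isFrame_coord t he).odd_inj h
  rw [mul_one] at h1
  subst h1
  rw [mul_one] at hab
  subst hab
  simp only [smul_zero, zero_add, one_smul, zero_eq_neg] at h2
  subst h2
  simp

/-- If a pair is trivial over `U`, every frame over `U` comes from a trivialization. -/
lemma exists_coord (t : P.sec U) {e : Γ(P.line.even, U)} (he : P.line.IsGenerator U e)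
    {θ : Γ(E.right.odd, U)} (hθ : IsFrame E U θ) :
    ∃ (t' : P.sec U) (e' : Γ(P.line.even, U)) (he' : P.line.IsGenerator U e'),
      A.coord t' e' he' = θ := by
  obtain ⟨b, a, γ, hba, rfl⟩ := (A.isFrame_coord t he).exists_eq_oddComb hθ
  have hab : a * b = 1 := by rw [mul_comm, hba]
  refine ⟨P.translate (-(a • γ)) e t, a • e, he.smul hab, ?_⟩
  rw [A.coord_translate_smul t he hab, smul_neg, neg_neg, smul_smul, hba, one_smul]

end AssociatedExtension

namespace LineTorsorPair

variable {X : Superscheme.{u}} {P Q : LineTorsorPair X} {U V : X.even.Opens}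

lemma exists_triv_le {x : X.even} (hx : x ∈ U) : ∃ (V : X.even.Opens) (_ : V ≤ U), x ∈ V ∧
    ∃ (_ : P.sec V) (e : Γ(P.line.even, V)), P.line.IsGenerator V e := by
  obtain ⟨V, hxV, ⟨b⟩⟩ := P.cocycle.exists_triv x
  exact ⟨U ⊓ V, inf_le_left, ⟨hx, hxV⟩, P.resSec inf_le_right b.1.1, _, b.2.res inf_le_right⟩

lemma Hom.app_resSec (f : P ⟶ Q) (h : V ≤ U) (t : P.sec U) :
    f.torsor.app (op V) (P.resSec h t) = Q.resSec h (f.torsor.app (op U) t) :=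
  ConcreteCategory.congr_hom (f.torsor.naturality (homOfLE h).op) t

lemma Hom.app_translate (f : P ⟶ Q) (s : Γ(X.odd, U)) (e : Γ(P.line.even, U)) (t : P.sec U) :
    f.torsor.app (op U) (P.translate s e t) =
      Q.translate s (f.line.even.app U e) (f.torsor.app (op U) t) := by
  rw [translate, translate, ← f.line.app_smulEven]
  exact f.app_vadd _ t

lemma sec_eq_of_locally {t t' : P.sec U}
    (h : ∀ x ∈ U, ∃ (V : X.even.Opens) (hV : V ≤ U), x ∈ V ∧ P.resSec hV t = P.resSec hV t') :
    t = t' :=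
  TopCat.Sheaf.eq_of_locally (F := P.torsor.sections) t t' h

/-- Isomorphisms of line bundles preserve generators. -/
lemma isGenerator_app {L M : SuperModule X} (f : L ≅ M) {e : Γ(L.even, U)}
    (he : L.IsGenerator U e) : M.IsGenerator U (f.hom.even.app U e) := by
  have e1 (U : X.even.Opens) (x : Γ(L.even, U)) : f.inv.even.app U (f.hom.even.app U x) = x :=
    congrArg (fun f : L ⟶ L => f.even.app U x) f.hom_inv_id
  have e2 (U : X.even.Opens) (x : Γ(M.even, U)) : f.hom.even.app U (f.inv.even.app U x) = x :=
    congrArg (fun f : M ⟶ M => f.even.app U x) f.inv_hom_id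
  have o1 (U : X.even.Opens) (x : Γ(L.odd, U)) : f.inv.odd.app U (f.hom.odd.app U x) = x :=
    congrArg (fun f : L ⟶ L => f.odd.app U x) f.hom_inv_id
  have o2 (U : X.even.Opens) (x : Γ(M.odd, U)) : f.hom.odd.app U (f.inv.odd.app U x) = x :=
    congrArg (fun f : M ⟶ M => f.odd.app U x) f.inv_hom_id
  rw [isGenerator_iff] at he ⊢
  intro V h
  obtain ⟨h1, h2⟩ := he V h
  rw [← Scheme.Modules.Hom.app_res]
  refine ⟨?_, ?_⟩
  · convert! (Function.bijective_iff_has_inverse.2 ⟨_, e1 V, e2 V⟩).comp h1 using 1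
    funext a
    exact (Scheme.Modules.Hom.app_smul f.hom.even _ _).symm
  · convert! (Function.bijective_iff_has_inverse.2 ⟨_, o1 V, o2 V⟩).comp h2 using 1
    funext a
    exact (f.hom.app_smulEven _ _).symm

lemma Hom.ext_of_eq {f g : Hom P Q} (hl : f.line = g.line) (ht : f.torsor = g.torsor) : f = g := by
  cases f
  cases g
  cases hl
  cases ht
  rfl

/-- A morphism of pairs is determined by the images of local trivializations. -/
lemma hom_ext_of_locally {f g : P ⟶ Q}
    (h : ∀ (U : X.even.Opens) (t : P.sec U) (e : Γ(P.line.even, U)), P.line.IsGenerator U e →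
      ∀ x ∈ U, ∃ (V : X.even.Opens) (hV : V ≤ U), x ∈ V ∧
        f.torsor.app (op V) (P.resSec hV t) = g.torsor.app (op V) (P.resSec hV t) ∧
        f.line.even.app V (P.line.even.res hV e) = g.line.even.app V (P.line.even.res hV e)) :
    f = g := by
  have h' (U : X.even.Opens) (t : P.sec U) (e : Γ(P.line.even, U)) (he : P.line.IsGenerator U e) :
      f.torsor.app (op U) t = g.torsor.app (op U) t ∧
        f.line.even.app U e = g.line.even.app U e := by
    refine ⟨sec_eq_of_locally fun x hx => ?_, Q.line.even.eq_of_locally fun x hx => ?_⟩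
    · obtain ⟨V, hV, hxV, h1, -⟩ := h U t e he x hx
      exact ⟨V, hV, hxV, by rw [← Hom.app_resSec, ← Hom.app_resSec, h1]⟩
    · obtain ⟨V, hV, hxV, -, h1⟩ := h U t e he x hx
      exact ⟨V, hV, hxV, by rw [← Scheme.Modules.Hom.app_res, ← Scheme.Modules.Hom.app_res, h1]⟩
  have hl : f.line = g.line := by
    refine SuperModule.hom_ext (fun U y => ?_) (fun U y => ?_)
    · refine Q.line.even.eq_of_locally fun x hx => ?_
      obtain ⟨V, hV, hxV, t, e, he⟩ := exists_triv_le (P := P) hx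
      refine ⟨V, hV, hxV, ?_⟩
      obtain ⟨a, ha⟩ := he.bijective_smul.2 (P.line.even.res hV y)
      rw [← Scheme.Modules.Hom.app_res, ← Scheme.Modules.Hom.app_res, ← ha,
        Scheme.Modules.Hom.app_smul, Scheme.Modules.Hom.app_smul, (h' V t e he).2]
    · refine Q.line.odd.eq_of_locally fun x hx => ?_
      obtain ⟨V, hV, hxV, t, e, he⟩ := exists_triv_le (P := P) hx
      refine ⟨V, hV, hxV, ?_⟩
      obtain ⟨a, ha⟩ := he.bijective_smulEven.2 (P.line.odd.res hV y)
      rw [← Scheme.Modules.Hom.app_res, ← Scheme.Modules.Hom.app_res, ← ha, f.line.app_smulEven,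
        g.line.app_smulEven, (h' V t e he).2]
  have ht : f.torsor = g.torsor := by
    apply NatTrans.ext
    funext U
    refine ConcreteCategory.hom_ext _ _ fun t => ?_
    refine sec_eq_of_locally fun x hx => ?_
    obtain ⟨V, hV, hxV, -, e, he⟩ := exists_triv_le (P := P) hx
    refine ⟨V, hV, hxV, ?_⟩
    have := (h' V (P.resSec hV t) e he).1
    rw [Hom.app_resSec, Hom.app_resSec] at this
    exact this
  exact Hom.ext_of_eq hl ht

end LineTorsorPair

/-! ### The equivalence between pairs and extensions -/

/-- A relation between sections of two sheaves of sets that is stable under restriction and locally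
the graph of a map is contained in the graph of a morphism. -/
lemma TopCat.Sheaf.exists_hom_of_rel {Z : TopCat.{u}} (F G : TopCat.Sheaf (Type u) Z)
    (R : ∀ V : Opens Z, F.presheaf.obj (op V) → G.presheaf.obj (op V) → Prop)
    (hres : ∀ (V W : Opens Z) (h : W ≤ V) s t, R V s t →
      R W (F.presheaf.map (homOfLE h).op s) (G.presheaf.map (homOfLE h).op t))
    (hex : ∀ (U : Opens Z) (s : F.presheaf.obj (op U)), ∀ x ∈ U, ∃ (V : Opens Z) (hV : V ≤ U),
      x ∈ V ∧ ∃ t, R V (F.presheaf.map (homOfLE hV).op s) t)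
    (huniq : ∀ (V : Opens Z) s t t', R V s t → R V s t' → t = t') :
    ∃ f : F.presheaf ⟶ G.presheaf, ∀ V s t, R V s t → f.app (op V) s = t := by
  have hF {U V W : Opens Z} (h : V ≤ U) (h' : W ≤ V) (s : F.presheaf.obj (op U)) :
      F.presheaf.map (homOfLE h').op (F.presheaf.map (homOfLE h).op s) =
        F.presheaf.map (homOfLE (h'.trans h)).op s :=
    (ConcreteCategory.congr_hom (F.presheaf.map_comp (homOfLE h).op (homOfLE h').op) s).symm
  have hG {U V W : Opens Z} (h : V ≤ U) (h' : W ≤ V) (s : G.presheaf.obj (op U)) :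
      G.presheaf.map (homOfLE h').op (G.presheaf.map (homOfLE h).op s) =
        G.presheaf.map (homOfLE (h'.trans h)).op s :=
    (ConcreteCategory.congr_hom (G.presheaf.map_comp (homOfLE h).op (homOfLE h').op) s).symm
  have hid {U : Opens Z} (s : F.presheaf.obj (op U)) : F.presheaf.map (homOfLE le_rfl).op s = s :=
    ConcreteCategory.congr_hom (F.presheaf.map_id (op U)) s
  have hid' {U : Opens Z} (s : G.presheaf.obj (op U)) : G.presheaf.map (homOfLE le_rfl).op s = s :=
    ConcreteCategory.congr_hom (G.presheaf.map_id (op U)) s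
  have key : ∀ (U : Opens Z) (s : F.presheaf.obj (op U)), ∃ t : G.presheaf.obj (op U),
      ∀ (V : Opens Z) (hV : V ≤ U) t', R V (F.presheaf.map (homOfLE hV).op s) t' →
        G.presheaf.map (homOfLE hV).op t = t' := fun U s =>
    TopCat.Sheaf.exists_glue G (U := U) (fun V hV t => R V (F.presheaf.map (homOfLE hV).op s) t)
      (fun V W hV h t ht => by
        have := hres V W h _ _ ht
        rw [hF] at this
        exact this) (hex U s)
      (fun V hV t t' h h' => huniq V _ t t' h h')
  choose φ hφ using key
  refine ⟨{ app := fun U => TypeCat.ofHom (φ U.unop), naturality := fun U V i => ?_ },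
    fun V s t ht => ?_⟩
  · refine ConcreteCategory.hom_ext _ _ fun s => ?_
    refine TopCat.Sheaf.eq_of_locally G (U := V.unop) _ _ fun x hx => ?_
    obtain ⟨W, hW, hxW, t, ht⟩ := hex U.unop s x (i.unop.le hx)
    refine ⟨V.unop ⊓ W, inf_le_left, ⟨hx, hxW⟩, ?_⟩
    have h1 := hres _ _ (inf_le_right : V.unop ⊓ W ≤ W) _ _ ht
    rw [hF] at h1
    have h2 := hφ V.unop (F.presheaf.map (homOfLE i.unop.le).op s) (V.unop ⊓ W) inf_le_left
      _ (by rw [hF]; exact h1)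
    refine h2.trans ?_
    have h3 := hφ U.unop s W hW t ht
    rw [← h3, hG]
    exact (hG i.unop.le (inf_le_left : V.unop ⊓ W ≤ V.unop) (φ U.unop s)).symm
  · have := hφ V s V le_rfl t (by rwa [hid])
    rw [hid'] at this
    exact this

lemma LineTorsorPair.res_vadd {X : Superscheme.{u}} (P : LineTorsorPair X) {U V : X.even.Opens}
    (h : V ≤ U) (l : Γ(P.line.odd, U)) (t : P.sec U) :
    P.resSec h (P.torsor.vadd U l t) = P.torsor.vadd V (P.line.odd.res h l) (P.resSec h t) :=
  P.torsor.map_vadd (homOfLE h) l t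

namespace AssociatedExtension

variable {X : Superscheme.{u}} {P Q : LineTorsorPair X} {E E' : Under (structureSheaf X)}
  (A : AssociatedExtension P E) (A' : AssociatedExtension Q E') {U V : X.even.Opens}

open SuperExtension LineTorsorPair

/-- The trivializations `(t, e)` and `(t', e')` have frames that are matched by `φ`. -/
def Match (φ : E ⟶ E') (t : P.sec U) (e : Γ(P.line.even, U)) (t' : Q.sec U)
    (e' : Γ(Q.line.even, U)) : Prop :=
  ∃ (he : P.line.IsGenerator U e) (he' : Q.line.IsGenerator U e'),
    φ.right.odd.app U (A.coord t e he) = A'.coord t' e' he'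

variable {A A'} {φ : E ⟶ E'}

lemma Match.res {t : P.sec U} {e : Γ(P.line.even, U)} {t' : Q.sec U} {e' : Γ(Q.line.even, U)}
    (h : Match A A' φ t e t' e') (hV : V ≤ U) :
    Match A A' φ (P.resSec hV t) (P.line.even.res hV e)
      (Q.resSec hV t') (Q.line.even.res hV e') := by
  obtain ⟨he, he', h⟩ := h
  refine ⟨he.res hV, he'.res hV, ?_⟩
  rw [← A.res_coord hV t he, ← A'.res_coord hV t' he', Scheme.Modules.Hom.app_res, h]

lemma Match.translate_smul {t : P.sec U} {e : Γ(P.line.even, U)} {t' : Q.sec U}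
    {e' : Γ(Q.line.even, U)} (h : Match A A' φ t e t' e') {a b : Γ(X.even, U)} (hab : a * b = 1)
    (s : Γ(X.odd, U)) :
    Match A A' φ (P.translate s e t) (a • e) (Q.translate s e' t') (a • e') := by
  obtain ⟨he, he', h⟩ := h
  refine ⟨he.smul hab, he'.smul hab, ?_⟩
  rw [A.coord_translate_smul t he hab, A'.coord_translate_smul t' he' hab, app_oddComb, h]

lemma Match.unique {t : P.sec U} {e : Γ(P.line.even, U)} {t' t'' : Q.sec U}
    {e' e'' : Γ(Q.line.even, U)} (h : Match A A' φ t e t' e') (h' : Match A A' φ t e t'' e'') :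
    t' = t'' ∧ e' = e'' := by
  obtain ⟨he, he', h⟩ := h
  obtain ⟨_, he'', h'⟩ := h'
  exact A'.coord_inj (h.symm.trans h')

/-- Two matches over the same open set differ by the same affine transformation. -/
lemma Match.exists_affine {t t₁ : P.sec U} {e e₁ : Γ(P.line.even, U)} {t' t₁' : Q.sec U}
    {e' e₁' : Γ(Q.line.even, U)} (h : Match A A' φ t e t' e') (h₁ : Match A A' φ t₁ e₁ t₁' e₁') :
    ∃ (a b : Γ(X.even, U)) (s : Γ(X.odd, U)), a * b = 1 ∧ e₁ = a • e ∧ e₁' = a • e' ∧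
      t₁ = P.translate s e t ∧ t₁' = Q.translate s e' t' := by
  obtain ⟨a, b, hab, rfl, -⟩ := h.choose.exists_smul_eq h₁.choose
  obtain ⟨s, rfl⟩ := LineTorsorPair.exists_translate h.choose t t₁
  obtain ⟨rfl, rfl⟩ := (h.translate_smul hab s).unique h₁
  exact ⟨a, b, s, hab, rfl, rfl, rfl, rfl⟩

/-- Locally, an isomorphism of extensions matches every section of the first torsor. -/
lemma exists_match (A : AssociatedExtension P E) (A' : AssociatedExtension Q E') (φ : E ≅ E')
    (t : P.sec U) {x : X.even} (hx : x ∈ U) :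
    ∃ (V : X.even.Opens) (hV : V ≤ U), x ∈ V ∧ ∃ e t' e',
      Match A A' φ.hom (P.resSec hV t) e t' e' := by
  obtain ⟨V, hV, hxV, -, e, he⟩ := LineTorsorPair.exists_triv_le (P := P) hx
  obtain ⟨W, hW, hxW, t', e', he'⟩ := LineTorsorPair.exists_triv_le (P := Q) hxV
  obtain ⟨t₁, e₁, he₁, h⟩ := A'.exists_coord t' he'
    ((A.isFrame_coord (P.resSec (hW.trans hV) t) (he.res hW)).app φ)
  exact ⟨W, hW.trans hV, hxW, _, t₁, e₁, he.res hW, he₁, h.symm⟩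

/-- Matched trivializations exist locally. -/
lemma exists_match' (A : AssociatedExtension P E) (A' : AssociatedExtension Q E') (φ : E ≅ E')
    {x : X.even} (hx : x ∈ U) :
    ∃ (V : X.even.Opens) (_ : V ≤ U), x ∈ V ∧ ∃ t e t' e', Match A A' φ.hom (U := V) t e t' e' := by
  obtain ⟨V, hV, hxV, t, -, -⟩ := LineTorsorPair.exists_triv_le (P := P) hx
  obtain ⟨W, hW, hxW, h⟩ := exists_match A A' φ t hxV
  exact ⟨W, hW.trans hV, hxW, _, h⟩

/-- Sending `a e` to `a e'`, for matched trivializations `(t, e)` and `(t', e')`, defines a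
homomorphism of line bundles. -/
lemma exists_line_hom_of_match (A : AssociatedExtension P E) (A' : AssociatedExtension Q E')
    (φ : E ≅ E') :
    ∃ f : P.line ⟶ Q.line, ∀ (U : X.even.Opens) t e t' e', Match A A' φ.hom (U := U) t e t' e' →
      f.even.app U e = e' ∧
      ∀ a : Γ(X.odd, U), f.odd.app U (P.line.smulEven U a e) = Q.line.smulEven U a e' := by
  obtain ⟨f₀, hf₀⟩ := Scheme.Modules.exists_hom_of_rel P.line.even Q.line.even
    (fun V x y => ∃ (t : _) (e : _) (t' : _) (e' : _) (a : Γ(X.even, V)),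
      Match A A' φ.hom t e t' e' ∧ x = a • e ∧ y = a • e')
    (by
      rintro V W h _ _ ⟨t, e, t', e', a, hm, rfl, rfl⟩
      exact ⟨_, _, _, _, X.even.res h a, hm.res h, by simp, by simp⟩)
    (fun U y x hx => by
      obtain ⟨V, hV, hxV, t, e, t', e', h⟩ := exists_match' A A' φ hx
      obtain ⟨a, ha⟩ := h.choose.bijective_smul.2 (P.line.even.res hV y)
      exact ⟨V, hV, hxV, _, t, e, t', e', a, h, ha.symm, rfl⟩)
    (by
      rintro V _ _ _ ⟨t, e, t', e', a, hm, rfl, rfl⟩ ⟨t₁, e₁, t₁', e₁', a₁, hm₁, h, rfl⟩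
      obtain ⟨c, d, s, -, rfl, rfl, -, -⟩ := hm.exists_affine hm₁
      rw [smul_smul] at h ⊢
      rw [hm.choose.bijective_smul.1 h])
    (by
      rintro V _ _ _ _ ⟨t, e, t', e', a, hm, rfl, rfl⟩ ⟨t₁, e₁, t₁', e₁', a₁, hm₁, rfl, rfl⟩
      obtain ⟨c, d, s, -, rfl, rfl, -, -⟩ := hm.exists_affine hm₁
      exact ⟨t, e, t', e', a + a₁ * c, hm, by rw [add_smul, mul_smul], by rw [add_smul, mul_smul]⟩)
    (by
      rintro V b _ _ ⟨t, e, t', e', a, hm, rfl, rfl⟩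
      exact ⟨t, e, t', e', b * a, hm, by rw [mul_smul], by rw [mul_smul]⟩)
  obtain ⟨f₁, hf₁⟩ := Scheme.Modules.exists_hom_of_rel P.line.odd Q.line.odd
    (fun V x y => ∃ (t : _) (e : _) (t' : _) (e' : _) (a : Γ(X.odd, V)),
      Match A A' φ.hom t e t' e' ∧ x = P.line.smulEven V a e ∧ y = Q.line.smulEven V a e')
    (by
      rintro V W h _ _ ⟨t, e, t', e', a, hm, rfl, rfl⟩
      exact ⟨_, _, _, _, X.odd.res h a, hm.res h, by simp, by simp⟩)
    (fun U y x hx => by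
      obtain ⟨V, hV, hxV, t, e, t', e', h⟩ := exists_match' A A' φ hx
      obtain ⟨a, ha⟩ := h.choose.bijective_smulEven.2 (P.line.odd.res hV y)
      exact ⟨V, hV, hxV, _, t, e, t', e', a, h, ha.symm, rfl⟩)
    (by
      rintro V _ _ _ ⟨t, e, t', e', a, hm, rfl, rfl⟩ ⟨t₁, e₁, t₁', e₁', a₁, hm₁, h, rfl⟩
      obtain ⟨c, d, s, -, rfl, rfl, -, -⟩ := hm.exists_affine hm₁
      rw [map_smul, ← LinearMap.smul_apply, ← map_smul] at h
      rw [map_smul, ← LinearMap.smul_apply, ← map_smul, hm.choose.bijective_smulEven.1 h])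
    (by
      rintro V _ _ _ _ ⟨t, e, t', e', a, hm, rfl, rfl⟩ ⟨t₁, e₁, t₁', e₁', a₁, hm₁, rfl, rfl⟩
      obtain ⟨c, d, s, -, rfl, rfl, -, -⟩ := hm.exists_affine hm₁
      exact ⟨t, e, t', e', a + c • a₁, hm, by simp, by simp⟩)
    (by
      rintro V b _ _ ⟨t, e, t', e', a, hm, rfl, rfl⟩
      exact ⟨t, e, t', e', b • a, hm, by simp, by simp⟩)
  have h₀ {U : X.even.Opens} {t e t' e'} (hm : Match A A' φ.hom (U := U) t e t' e')
      (a : Γ(X.even, U)) : f₀.app U (a • e) = a • e' := hf₀ _ _ _ ⟨t, e, t', e', a, hm, rfl, rfl⟩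
  have h₁ {U : X.even.Opens} {t e t' e'} (hm : Match A A' φ.hom (U := U) t e t' e')
      (a : Γ(X.odd, U)) : f₁.app U (P.line.smulEven U a e) = Q.line.smulEven U a e' :=
    hf₁ _ _ _ ⟨t, e, t', e', a, hm, rfl, rfl⟩
  refine ⟨⟨f₀, f₁, fun {U} s m => ?_, fun {U} s m => ?_⟩,
    fun U t e t' e' hm => ⟨?_, fun a => h₁ hm a⟩⟩
  · refine Q.line.odd.eq_of_locally fun x hx => ?_
    obtain ⟨V, hV, hxV, t, e, t', e', hm⟩ := exists_match' A A' φ hx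
    refine ⟨V, hV, hxV, ?_⟩
    obtain ⟨a, ha⟩ := hm.choose.bijective_smul.2 (P.line.even.res hV m)
    rw [← Scheme.Modules.Hom.app_res, res_smulEven, res_smulEven, ← Scheme.Modules.Hom.app_res,
      ← ha, h₀ hm, map_smul, Scheme.Modules.Hom.app_smul, h₁ hm, map_smul]
  · refine Q.line.even.eq_of_locally fun x hx => ?_
    obtain ⟨V, hV, hxV, t, e, t', e', hm⟩ := exists_match' A A' φ hx
    refine ⟨V, hV, hxV, ?_⟩
    obtain ⟨a, ha⟩ := hm.choose.bijective_smulEven.2 (P.line.odd.res hV m)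
    rw [← Scheme.Modules.Hom.app_res, res_smulOdd, res_smulOdd, ← Scheme.Modules.Hom.app_res,
      ← ha, h₁ hm, P.line.smulOdd_smulEven, Q.line.smulOdd_smulEven, h₀ hm]
  · have := h₀ hm 1
    rwa [one_smul, one_smul] at this

/-- Sending `t` to `t'`, for matched trivializations `(t, e)` and `(t', e')`, defines a map of
torsors. -/
lemma exists_torsor_hom_of_match (A : AssociatedExtension P E) (A' : AssociatedExtension Q E')
    (φ : E ≅ E') :
    ∃ g : P.torsor.sections.presheaf ⟶ Q.torsor.sections.presheaf, ∀ (U : X.even.Opens) t e t' e',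
      Match A A' φ.hom (U := U) t e t' e' → g.app (op U) t = t' := by
  obtain ⟨g, hg⟩ := TopCat.Sheaf.exists_hom_of_rel P.torsor.sections Q.torsor.sections
    (fun V t t' => ∃ e e', Match A A' φ.hom (U := V) t e t' e')
    (by
      rintro V W h t t' ⟨e, e', hm⟩
      exact ⟨_, _, hm.res h⟩)
    (fun U t x hx => by
      obtain ⟨V, hV, hxV, e, t', e', h⟩ := exists_match A A' φ t hx
      exact ⟨V, hV, hxV, t', e, e', h⟩)
    (by
      rintro V t t' t'' ⟨e, e', hm⟩ ⟨e₁, e₁', hm₁⟩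
      obtain ⟨c, d, s, -, rfl, rfl, h, rfl⟩ := hm.exists_affine hm₁
      have hs : s = 0 := translate_inj hm.choose (h.symm.trans (P.translate_zero e t).symm)
      rw [hs, translate_zero])
  exact ⟨g, fun U t e t' e' hm => hg _ _ _ ⟨e, e', hm⟩⟩

/-- Matched trivializations define a morphism of pairs. -/
lemma exists_hom_of_match (A : AssociatedExtension P E) (A' : AssociatedExtension Q E')
    (φ : E ≅ E') :
    ∃ f : P ⟶ Q, ∀ (U : X.even.Opens) t e t' e', Match A A' φ.hom (U := U) t e t' e' →
      f.torsor.app (op U) t = t' ∧ f.line.even.app U e = e' := by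
  obtain ⟨f, hf⟩ := exists_line_hom_of_match A A' φ
  obtain ⟨g, hg⟩ := exists_torsor_hom_of_match A A' φ
  have hgres {U V : X.even.Opens} (h : V ≤ U) (t : P.sec U) :
      g.app (op V) (P.resSec h t) = Q.resSec h (g.app (op U) t) :=
    ConcreteCategory.congr_hom (g.naturality (homOfLE h).op) t
  refine ⟨⟨f, g, fun {U} l t => ?_⟩, fun U t e t' e' hm => ⟨hg _ _ _ _ _ hm, (hf _ _ _ _ _ hm).1⟩⟩
  refine sec_eq_of_locally fun x hx => ?_
  obtain ⟨V, hV, hxV, e, t', e', hm⟩ := exists_match A A' φ t hx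
  refine ⟨V, hV, hxV, ?_⟩
  obtain ⟨a, ha⟩ := hm.choose.bijective_smulEven.2 (P.line.odd.res hV l)
  have e1 : P.resSec hV (P.torsor.vadd U l t) = P.translate a e (P.resSec hV t) :=
    (P.res_vadd hV l t).trans (congrArg (fun l => P.torsor.vadd V l (P.resSec hV t)) ha.symm)
  have e2 : Q.resSec hV (Q.torsor.vadd U (f.odd.app U l) (g.app (op U) t)) =
      Q.translate a e' t' := by
    refine (Q.res_vadd hV _ _).trans ?_
    refine (congrArg₂ (Q.torsor.vadd V) ((Scheme.Modules.Hom.app_res f.odd hV l).symm.trans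
      ((congrArg (f.odd.app V) ha.symm).trans ((hf _ _ _ _ _ hm).2 a)))
      ((hgres hV t).symm.trans (hg _ _ _ _ _ hm)))
  refine (hgres hV _).symm.trans ((congrArg (g.app (op V)) e1).trans (Eq.trans ?_ e2.symm))
  have h1 := hm.translate_smul (mul_one 1) a
  exact hg _ _ _ _ _ h1

/-- An isomorphism between the extensions associated with two pairs comes from an isomorphism of
the pairs. -/
lemma exists_iso_of_match (A : AssociatedExtension P E) (A' : AssociatedExtension Q E')
    (φ : E ≅ E') :
    ∃ f : P ≅ Q, ∀ (U : X.even.Opens) t e t' e', Match A A' φ.hom (U := U) t e t' e' →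
      f.hom.torsor.app (op U) t = t' ∧ f.hom.line.even.app U e = e' := by
  obtain ⟨f, hf⟩ := exists_hom_of_match A A' φ
  obtain ⟨g, hg⟩ := exists_hom_of_match A' A φ.symm
  have hsymm {U : X.even.Opens} {t e t' e'} (hm : Match A A' φ.hom (U := U) t e t' e') :
      Match A' A φ.symm.hom (U := U) t' e' t e := by
    obtain ⟨he, he', h⟩ := hm
    refine ⟨he', he, ?_⟩
    rw [← h]
    have : φ.hom.right ≫ φ.inv.right = 𝟙 _ := congrArg CommaMorphism.right φ.hom_inv_id
    exact congrArg (fun f : E.right ⟶ E.right => f.odd.app U (A.coord t e he)) this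
  refine ⟨⟨f, g, ?_, ?_⟩, hf⟩
  · refine LineTorsorPair.hom_ext_of_locally fun U t e he x hx => ?_
    obtain ⟨V, hV, hxV, e₁, t', e', hm⟩ := exists_match A A' φ t hx
    obtain ⟨a, b, hab, h, -⟩ := hm.choose.exists_smul_eq (he.res hV)
    refine ⟨V, hV, hxV, ?_⟩
    have hm' := hm.translate_smul hab 0
    rw [translate_zero, translate_zero, ← h] at hm'
    obtain ⟨h1, h2⟩ := hf _ _ _ _ _ hm'
    obtain ⟨h3, h4⟩ := hg _ _ _ _ _ (hsymm hm')
    exact ⟨(congrArg (g.torsor.app (op V)) h1).trans h3,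
      (congrArg (g.line.even.app V) h2).trans h4⟩
  · refine LineTorsorPair.hom_ext_of_locally fun U t e he x hx => ?_
    obtain ⟨V, hV, hxV, t₁, e₁, t', e', hm⟩ := exists_match' A A' φ hx
    obtain ⟨a, b, hab, h, -⟩ := hm.choose_spec.choose.exists_smul_eq (he.res hV)
    -- A matched trivialization of `Q` is moved to the given one by an affine transformation.
    obtain ⟨s, hs⟩ := LineTorsorPair.exists_translate hm.choose_spec.choose t' (Q.resSec hV t)
    refine ⟨V, hV, hxV, ?_⟩
    have hm' := hm.translate_smul hab s
    rw [hs, ← h] at hm'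
    obtain ⟨h1, h2⟩ := hf _ _ _ _ _ hm'
    obtain ⟨h3, h4⟩ := hg _ _ _ _ _ (hsymm hm')
    exact ⟨(congrArg (f.torsor.app (op V)) h3).trans h1,
      (congrArg (f.line.even.app V) h4).trans h2⟩

/-- An isomorphism of pairs induces a homomorphism between the associated extensions. -/
lemma exists_hom (A : AssociatedExtension P E) (A' : AssociatedExtension Q E') (f : P ≅ Q) :
    ∃ φ : E ⟶ E', ∀ (U : X.even.Opens) (t : P.sec U) (e : Γ(P.line.even, U))
      (he : P.line.IsGenerator U e) (he' : Q.line.IsGenerator U (f.hom.line.even.app U e)),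
      φ.right.odd.app U (A.coord t e he) =
        A'.coord (f.hom.torsor.app (op U) t) (f.hom.line.even.app U e) he' := by
  let S (U : X.even.Opens) (θ : Γ(E.right.odd, U)) (θ' : Γ(E'.right.odd, U)) : Prop :=
    ∃ t e he he', θ = A.coord t e he ∧
      θ' = A'.coord (f.hom.torsor.app (op U) t) (f.hom.line.even.app U e) he'
  obtain ⟨φ, hφ⟩ := exists_hom_of_frames (E := E) (E' := E') S
    (by
      rintro U _ _ ⟨t, e, he, he', rfl, rfl⟩
      exact A.isFrame_coord t he)
    (by
      rintro U V h _ _ ⟨t, e, he, he', rfl, rfl⟩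
      have he₁ := he'.res h
      rw [← Scheme.Modules.Hom.app_res] at he₁
      refine ⟨_, _, he.res h, he₁, A.res_coord h t he, ?_⟩
      rw [A'.res_coord]
      congr 1
      · exact (Hom.app_resSec f.hom h t).symm
      · exact (Scheme.Modules.Hom.app_res f.hom.line.even h e).symm)
    (fun x => by
      obtain ⟨U, hx, ⟨b⟩⟩ := P.cocycle.exists_triv x
      exact ⟨U, hx, _, _, b.1.1, b.1.2, b.2,
        isGenerator_app ⟨f.hom.line, f.inv.line, congrArg Hom.line f.hom_inv_id,
          congrArg Hom.line f.inv_hom_id⟩ b.2, rfl, rfl⟩)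
    (by
      rintro U _ _ _ _ v γ ⟨t, e, he, he', rfl, rfl⟩ ⟨t₁, e₁, he₁, he₁', rfl, rfl⟩ h
      obtain ⟨a, b, hab, rfl, -⟩ := he.exists_smul_eq he₁
      obtain ⟨s, rfl⟩ := LineTorsorPair.exists_translate he t t₁
      rw [A.coord_translate_smul t he hab] at h
      obtain ⟨rfl, rfl⟩ := (A.isFrame_coord t he).odd_inj h
      rw [← A'.coord_translate_smul _ he' hab]
      congr 1
      · exact Hom.app_translate f.hom s e t
      · exact Scheme.Modules.Hom.app_smul f.hom.line.even a e)
  exact ⟨φ, fun U t e he he' => hφ _ _ _ ⟨t, e, he, he', rfl, rfl⟩⟩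

end AssociatedExtension

namespace LineTorsorPair

variable {X : Superscheme.{u}}

open AssociatedExtension SuperExtension

lemma isGenerator_hom {P Q : LineTorsorPair X} (f : P ≅ Q) {U : X.even.Opens}
    {e : Γ(P.line.even, U)} (he : P.line.IsGenerator U e) :
    Q.line.IsGenerator U (f.hom.line.even.app U e) :=
  isGenerator_app ⟨f.hom.line, f.inv.line, congrArg Hom.line f.hom_inv_id,
          congrArg Hom.line f.inv_hom_id⟩ he

/-- The homomorphism of extensions induced by an isomorphism of pairs. -/
noncomputable def extensionMap {P Q : LineTorsorPair X} (f : P ≅ Q) :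
    P.cocycle.ext ⟶ Q.cocycle.ext :=
  (exists_hom P.associatedExtension Q.associatedExtension f).choose

lemma extensionMap_coord {P Q : LineTorsorPair X} (f : P ≅ Q) (U : X.even.Opens) (t : P.sec U)
    (e : Γ(P.line.even, U)) (he : P.line.IsGenerator U e)
    (he' : Q.line.IsGenerator U (f.hom.line.even.app U e)) :
    (extensionMap f).right.odd.app U (P.associatedExtension.coord t e he) =
      Q.associatedExtension.coord (f.hom.torsor.app (op U) t) (f.hom.line.even.app U e) he' :=
  (exists_hom P.associatedExtension Q.associatedExtension f).choose_spec U t e he he'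

lemma extension_hom_ext {P : LineTorsorPair X} {E : Under (structureSheaf X)}
    {φ ψ : P.cocycle.ext ⟶ E} (h : ∀ (U : X.even.Opens) (t : P.sec U) (e : Γ(P.line.even, U))
      (he : P.line.IsGenerator U e), ∀ x ∈ U, ∃ (V : X.even.Opens) (hV : V ≤ U), x ∈ V ∧
      φ.right.odd.app V (P.associatedExtension.coord (P.resSec hV t) _ (he.res hV)) =
        ψ.right.odd.app V (P.associatedExtension.coord (P.resSec hV t) _ (he.res hV))) : φ = ψ := by
  refine hom_ext_of_frames fun x => ?_
  obtain ⟨U, hx, ⟨b⟩⟩ := P.cocycle.exists_triv x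
  obtain ⟨V, hV, hxV, e⟩ := h U b.1.1 b.1.2 b.2 x hx
  exact ⟨V, hxV, _, P.associatedExtension.isFrame_coord _ (b.2.res hV), e⟩

variable (X) in
/-- The functor sending a pair to its extension. -/
noncomputable def extensionFunctor : LineTorsor X ⥤ BundleExtension X :=
  Core.functorToCore (ObjectProperty.lift _
    { obj := fun P => P.of.cocycle.ext
      map := fun f => extensionMap f.iso
      map_id := fun P => extension_hom_ext fun U t e he x hx => ⟨U, le_rfl, hx,
        extensionMap_coord (Iso.refl P.of) U _ _ (he.res le_rfl) (he.res le_rfl)⟩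
      map_comp := fun {P Q R} f g => extension_hom_ext fun U t e he x hx => by
        refine ⟨U, le_rfl, hx, ?_⟩
        have h1 := isGenerator_hom f.iso (he.res le_rfl)
        have h2 := isGenerator_hom g.iso h1
        refine (extensionMap_coord (f.iso ≪≫ g.iso) U _ _ (he.res le_rfl) h2).trans ?_
        refine (extensionMap_coord g.iso U _ _ h1 h2).symm.trans ?_
        exact congrArg ((extensionMap g.iso).right.odd.app U)
          (extensionMap_coord f.iso U _ _ (he.res le_rfl) h1).symm }
    (fun P => isBundleExtension_iff.2 P.of.cocycle.hasLocalFrames_ext))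

instance : (extensionFunctor X).Faithful where
  map_injective {P Q} f g h := by
    have h' : extensionMap f.iso = extensionMap g.iso :=
      congrArg (fun φ => (BundleExtension.forget X).map φ) h
    apply Core.hom_ext
    refine LineTorsorPair.hom_ext_of_locally fun U t e he x hx => ⟨U, le_rfl, hx, ?_⟩
    have h1 := extensionMap_coord f.iso U (P.of.resSec le_rfl t) _ (he.res le_rfl)
      (isGenerator_hom f.iso (he.res le_rfl))
    rw [h', extensionMap_coord g.iso U (P.of.resSec le_rfl t) _ (he.res le_rfl)
      (isGenerator_hom g.iso (he.res le_rfl))] at h1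
    obtain ⟨h2, h3⟩ := coord_inj _ h1
    exact ⟨h2.symm, h3.symm⟩

instance : (extensionFunctor X).Full where
  map_surjective {P Q} φ := by
    let φ' : P.of.cocycle.ext ≅ Q.of.cocycle.ext := (ObjectProperty.ι _).mapIso φ.iso
    obtain ⟨f, hf⟩ := exists_iso_of_match P.of.associatedExtension Q.of.associatedExtension φ'
    refine ⟨⟨f⟩, Core.hom_ext (ObjectProperty.hom_ext _ ?_)⟩
    refine extension_hom_ext fun U t e he x hx => ?_
    obtain ⟨V, hV, hxV, e₁, t', e', hm⟩ :=
      exists_match P.of.associatedExtension Q.of.associatedExtension φ' t hx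
    obtain ⟨a, b, hab, h, -⟩ := hm.choose.exists_smul_eq (he.res hV)
    have hm' := hm.translate_smul hab 0
    rw [translate_zero, translate_zero, ← h] at hm'
    obtain ⟨h1, h2⟩ := hf _ _ _ _ _ hm'
    obtain ⟨he₁, he₁', h3⟩ := hm'
    refine ⟨V, hV, hxV, ?_⟩
    refine (extensionMap_coord f V _ _ he₁ (isGenerator_hom f he₁)).trans ?_
    refine Eq.trans ?_ h3.symm
    congr 1

instance : (extensionFunctor X).EssSurj where
  mem_essImage E := by
    have hE := isBundleExtension_iff.1 E.of.property
    let P := (SuperExtension.cocycle E.of.obj hE).pair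
    have A := SuperExtension.associatedExtension hE
    -- Both extensions are associated with `P`, so their frames correspond to each other.
    obtain ⟨φ, hφ⟩ := exists_hom P.associatedExtension A (Iso.refl P)
    obtain ⟨ψ, hψ⟩ := exists_hom A P.associatedExtension (Iso.refl P)
    have h1 : φ ≫ ψ = 𝟙 _ := extension_hom_ext fun U t e he x hx => by
      refine ⟨U, le_rfl, hx, ?_⟩
      exact (congrArg (ψ.right.odd.app U) (hφ U _ _ (he.res le_rfl) (he.res le_rfl))).trans
        (hψ U _ _ (he.res le_rfl) (he.res le_rfl))
    have h2 : ψ ≫ φ = 𝟙 _ := hom_ext_of_frames fun x => by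
      obtain ⟨U, hx, ⟨b⟩⟩ := P.cocycle.exists_triv x
      refine ⟨U, hx, _, A.isFrame_coord b.1.1 b.2, ?_⟩
      exact (congrArg (φ.right.odd.app U) (hψ U _ _ b.2 b.2)).trans (hφ U _ _ b.2 b.2)
    exact ⟨⟨P⟩, ⟨(Groupoid.isoEquivHom _ _).symm
      ⟨ObjectProperty.isoMk _ (⟨φ, ψ, h1, h2⟩ : P.cocycle.ext ≅ E.of.obj)⟩⟩⟩

instance : (extensionFunctor X).IsEquivalence where

end LineTorsorPair

/-! ### Quasi-coherence and localization of sections -/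

namespace AlgebraicGeometry

lemma IsAffineOpen.image_fromSpec_le {X : Scheme.{u}} {U : X.Opens} (hU : IsAffineOpen U)
    (V : (Spec Γ(X, U)).Opens) : hU.fromSpec ''ᵁ V ≤ U := by
  refine le_trans (Scheme.Hom.image_mono _ le_top) ?_
  rw [Scheme.Hom.image_top_eq_opensRange, hU.opensRange_fromSpec]

lemma IsAffineOpen.appIso_fromSpec_inv {X : Scheme.{u}} {U : X.Opens} (hU : IsAffineOpen U)
    (V : (Spec Γ(X, U)).Opens) (r : Γ(X, U)) :
    (hU.fromSpec.appIso V).inv ((Spec Γ(X, U)).presheaf.map V.leTop.op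
      ((Scheme.ΓSpecIso Γ(X, U)).inv r)) = X.res (hU.image_fromSpec_le V) r := by
  have h : (Scheme.ΓSpecIso Γ(X, U)).inv ≫ (Spec Γ(X, U)).presheaf.map V.leTop.op ≫
      (hU.fromSpec.appIso V).inv = X.presheaf.map (homOfLE (hU.image_fromSpec_le V)).op := by
    rw [← Category.assoc, Iso.comp_inv_eq, Scheme.Hom.appIso_hom, hU.fromSpec.naturality_assoc,
      hU.fromSpec_app_self]
    simp only [Category.assoc, ← Functor.map_comp]
    rfl
  exact ConcreteCategory.congr_hom h r

namespace Scheme.Modules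

variable {X : Scheme.{u}}

/-- Sections of `M` over `D(r) ⊆ U` are obtained from sections over `U` by inverting `r`. -/
structure IsLocalizingAt (M : X.Modules) (U : X.Opens) (r : Γ(X, U)) : Prop where
  exists_pow_smul_eq_zero (s : Γ(M, U)) (hs : M.res (X.basicOpen_le r) s = 0) :
    ∃ n : ℕ, r ^ n • s = 0
  exists_pow_smul (t : Γ(M, X.basicOpen r)) :
    ∃ (n : ℕ) (s : Γ(M, U)), M.res (X.basicOpen_le r) s = X.res (X.basicOpen_le r) r ^ n • t

lemma smul_restrict_fromSpec (M : X.Modules) {U : X.Opens} (hU : IsAffineOpen U)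
    (V : (Spec Γ(X, U)).Opens) (r : Γ(X, U)) (x : Γ(M.restrict hU.fromSpec, V)) :
    (M.restrictAppIso hU.fromSpec V).hom (r • x) =
      X.res (hU.image_fromSpec_le V) r • (M.restrictAppIso hU.fromSpec V).hom x := by
  rw [smul_Spec_def, ← hU.appIso_fromSpec_inv]
  rfl

lemma isLocalizingAt_iff (M : X.Modules) {U U' V : X.Opens} {r : Γ(X, U)} (hU : U' = U)
    (hV : V = X.basicOpen r) (h : V ≤ U') :
    M.IsLocalizingAt U r ↔
      (∀ s : Γ(M, U'), M.res h s = 0 → ∃ n : ℕ, X.res hU.le r ^ n • s = 0) ∧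
      ∀ t : Γ(M, V), ∃ (n : ℕ) (s : Γ(M, U')),
        M.res h s = X.res (hV.le.trans (X.basicOpen_le r)) r ^ n • t := by
  subst hU hV
  simp only [Scheme.res_self]
  exact ⟨fun h => ⟨h.1, h.2⟩, fun h => ⟨h.1, h.2⟩⟩

/-- On an affine open set, the algebraic form of localization and the one for sheaves of modules
on the spectrum agree. -/
lemma isLocalizing_restrict_fromSpec_iff (M : X.Modules) {U : X.Opens} (hU : IsAffineOpen U) :
    IsLocalizing (modulesSpecToSheaf.obj (M.restrict hU.fromSpec)) ↔
      ∀ r, M.IsLocalizingAt U r := by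
  have htop : hU.fromSpec ''ᵁ ⊤ = U := by
    rw [Scheme.Hom.image_top_eq_opensRange, hU.opensRange_fromSpec]
  refine forall_congr' fun r => ?_
  rw [M.isLocalizingAt_iff htop (hU.fromSpec_image_basicOpen r)
    (Scheme.Hom.image_mono _ le_top)]
  have hpow : ∀ (V : (Spec Γ(X, U)).Opens) (n : ℕ) (x : Γ(M.restrict hU.fromSpec, V)),
      (show Γ(M, hU.fromSpec ''ᵁ V) from r ^ n • x) =
        X.res (hU.image_fromSpec_le V) r ^ n • (show Γ(M, hU.fromSpec ''ᵁ V) from x) := by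
    intro V n x
    rw [← map_pow]
    exact M.smul_restrict_fromSpec hU V (r ^ n) x
  constructor
  · intro h
    constructor
    · intro s hs
      obtain ⟨⟨_, n, rfl⟩, hn⟩ := (IsLocalizedModule.eq_zero_iff (.powers r)
        ((modulesSpecToSheaf.obj (M.restrict hU.fromSpec)).obj.map
          (PrimeSpectrum.basicOpen r).leTop.op).hom).mp hs
      exact ⟨n, (hpow ⊤ n s).symm.trans hn⟩
    · intro t
      have key : ∀ (V : (Spec Γ(X, U)).Opens)
          (_ : IsLocalizedModule (.powers r)
            ((modulesSpecToSheaf.obj (M.restrict hU.fromSpec)).obj.map V.leTop.op).hom)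
          (t' : Γ(M.restrict hU.fromSpec, V)), ∃ (n : ℕ) (s : Γ(M.restrict hU.fromSpec, ⊤)),
            r ^ n • t' = (M.restrict hU.fromSpec).presheaf.map V.leTop.op s := fun V h t' =>
        @IsLocalizedModule.Away.surj _ _ _ _ _ _ _ _ _ r h t'
      obtain ⟨n, s, hs⟩ := key _ h t
      exact ⟨n, s, hs.symm.trans (hpow _ n t)⟩
  · rintro ⟨h₁, h₂⟩
    refine IsLocalizedModule.Away.mk_of_addCommGroup ?_ ?_ ?_
    · exact isUnit_algebraMap_end_of_le_basicOpen r le_rfl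
    · intro t
      obtain ⟨n, s, hs⟩ := h₂ t
      exact ⟨n, s, (hpow _ n t).trans hs.symm⟩
    · intro s hs
      obtain ⟨n, hn⟩ := h₁ s hs
      exact ⟨n, (hpow ⊤ n s).trans hn⟩

lemma isLocalizingAt_of_isQuasicoherent (M : X.Modules) (hM : M.IsQuasicoherent) {U : X.Opens}
    (hU : IsAffineOpen U) (r : Γ(X, U)) : M.IsLocalizingAt U r := by
  refine (M.isLocalizing_restrict_fromSpec_iff hU).1 ?_ r
  have := hM
  rw [← isIso_fromTildeΓ_iff_isLocalizing]
  infer_instance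

/-- Transport of a presentation along an isomorphism. -/
noncomputable def presentationOfIso {M N : X.Modules} (e : M ≅ N) (p : M.Presentation) :
    N.Presentation :=
  haveI : @IsIso (SheafOfModules X.ringCatSheaf) _ M N e.hom :=
    ⟨e.inv, e.hom_inv_id, e.inv_hom_id⟩
  SheafOfModules.Presentation.ofIsIso.{u, u, u} (R := X.ringCatSheaf) (M := M) (N := N) e.hom p

/-- A presentation of the restriction of `M` to `U`, from one on the spectrum. -/
lemma nonempty_presentation_over (M : X.Modules) {U : X.Opens} (hU : IsAffineOpen U)
    (hr : ∀ r, M.IsLocalizingAt U r) :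
    Nonempty (SheafOfModules.Presentation (SheafOfModules.over (R := X.ringCatSheaf) M U)) := by
  have : IsIso (M.restrict hU.fromSpec).fromTildeΓ := by
    rw [isIso_fromTildeΓ_iff_isLocalizing]
    exact (M.isLocalizing_restrict_fromSpec_iff hU).2 hr
  let p₁ : (M.restrict hU.fromSpec).Presentation :=
    presentationOfIso (asIso (M.restrict hU.fromSpec).fromTildeΓ)
      (presentationTilde _ .univ (by simp) _ (Submodule.span_eq _))
  let p₂ := presentationRestrict hU.isoSpec.hom p₁
  let e : (M.restrict hU.fromSpec).restrict hU.isoSpec.hom ≅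
      (overEquiv U).functor.obj (SheafOfModules.over M U) :=
    (restrictFunctorComp hU.isoSpec.hom hU.fromSpec).symm.app M ≪≫
      (restrictFunctorCongr (by simp [IsAffineOpen.isoSpec_hom])).app M ≪≫
      (overFunctorEquiv U).symm.app M
  let p₃ := presentationOfIso e p₂
  let F := Opens.sheafOfModulesEquivOver U X.ringCatSheaf
  have : Limits.PreservesColimitsOfSize.{u, u} F.inverse :=
    F.symm.toAdjunction.leftAdjoint_preservesColimits
  let p₄ := SheafOfModules.Presentation.map (R := U.sheafRestrict.obj X.ringCatSheaf)
    (S := X.ringCatSheaf.over U) p₃ F.inverse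
    (Opens.sheafOfModulesEquivOverInverseUnit U X.ringCatSheaf).symm
  exact ⟨SheafOfModules.Presentation.ofIsIso.{u, u, u}
    (F.unitIso.app (SheafOfModules.over M U)).inv p₄⟩

/-- A module all of whose sections over the members of an affine open cover localize is
quasi-coherent. -/
lemma isQuasicoherent_of_isLocalizingAt (M : X.Modules)
    (h : ∀ x : X, ∃ U : X.Opens, x ∈ U ∧ IsAffineOpen U ∧ ∀ r, M.IsLocalizingAt U r) :
    M.IsQuasicoherent := by
  choose U hx hU hr using h
  let q : SheafOfModules.QuasicoherentData (R := X.ringCatSheaf) M :=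
    { I := X
      X := U
      coversTop := by
        rw [Opens.coversTop_iff]
        exact eq_top_iff.2 fun x _ => Opens.mem_iSup.2 ⟨x, hx x⟩
      presentation := fun x => (M.nonempty_presentation_over (hU x) (hr x)).some }
  exact q.isQuasicoherent

end Scheme.Modules
end AlgebraicGeometry

/-! ### The relative spectrum of a sheaf of algebras -/

lemma AlgebraicGeometry.IsAffineOpen.appLE_fromSpec_top {X : Scheme.{u}} {U : X.Opens}
    (hU : IsAffineOpen U) (h : ⊤ ≤ hU.fromSpec ⁻¹ᵁ U) :
    hU.fromSpec.appLE U ⊤ h = (Scheme.ΓSpecIso Γ(X, U)).inv := by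
  rw [Scheme.Hom.appLE, hU.fromSpec_app_self, Category.assoc]
  refine (congrArg _ (((Spec Γ(X, U)).presheaf.map_comp _ _).symm.trans
    ((Spec Γ(X, U)).presheaf.map_id _))).trans (Category.comp_id _)

/-- A continuous map that becomes a homeomorphism onto `U` on a chart of the preimage of `U` is a
homeomorphism over `U`. -/
lemma Topology.IsEmbedding.isHomeomorph_restrictPreimage {S Y X : Type*} [TopologicalSpace S]
    [TopologicalSpace Y] [TopologicalSpace X] {f : Y → X} {j : S → Y} {U : Set X}
    (hcont : Continuous f) (hj : IsEmbedding j) (hjU : Set.range j = f ⁻¹' U)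
    (hfj : IsEmbedding (f ∘ j))
    (hU : Set.range (f ∘ j) = U) : IsHomeomorph (U.restrictPreimage f) := by
  let e : S ≃ₜ f ⁻¹' U := hj.toHomeomorph.trans (Homeomorph.setCongr hjU)
  have h : IsHomeomorph (U.restrictPreimage f ∘ e) := by
    rw [isHomeomorph_iff_isEmbedding_surjective]
    constructor
    · exact .of_comp (hcont.restrictPreimage.comp e.continuous) continuous_subtype_val hfj
    · rintro ⟨x, hx⟩
      obtain ⟨s, hs⟩ := hU.ge hx
      exact ⟨s, Subtype.ext hs⟩
  have := h.comp e.symm.isHomeomorph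
  rwa [Function.comp_assoc, e.self_comp_symm] at this

namespace AlgebraicGeometry.Scheme

open AffineZariskiSite

variable {X : Scheme.{u}}

/-- A sheaf of algebras over the structure sheaf whose sections over `D(r)`, for a function `r` on
an affine open set `U`, are obtained from those over `U` by inverting `r`. -/
structure QuasicoherentAlgebra (X : Scheme.{u}) where
  presheaf : TopCat.Presheaf CommRingCat.{u} X
  isSheaf : presheaf.IsSheaf
  algebra : X.presheaf ⟶ presheaf
  coequifibered : ((toOpensFunctor X).op.whiskerLeft algebra).Coequifibered

namespace QuasicoherentAlgebra

variable (A : QuasicoherentAlgebra X)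

/-- The spectra of the sections over affine open sets, as a gluing datum. -/
noncomputable def gluingData : (directedCover X).RelativeGluingData :=
  relativeGluingData A.coequifibered

instance : (A.gluingData.functor ⋙ Scheme.forget).IsLocallyDirected :=
  Cover.RelativeGluingData.instIsLocallyDirectedI₀CompFunctorForgetOfIsThin ..

/-- The relative spectrum. -/
noncomputable def spec : Scheme.{u} := A.gluingData.glued

/-- The projection of the relative spectrum. -/
noncomputable def proj : A.spec ⟶ X := A.gluingData.toBase

variable {U V : X.Opens}

/-- The chart of the relative spectrum over an affine open set `U`, the spectrum of the sections of
the algebra over `U`. -/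
noncomputable def chart (hU : IsAffineOpen U) : Spec (A.presheaf.obj (op U)) ⟶ A.spec :=
  A.gluingData.cover.f ⟨U, hU⟩

instance (hU : IsAffineOpen U) : IsOpenImmersion (A.chart hU) :=
  A.gluingData.cover.map_prop ⟨U, hU⟩

lemma chart_proj (hU : IsAffineOpen U) :
    A.chart hU ≫ A.proj = Spec.map (A.algebra.app (op U)) ≫ hU.fromSpec :=
  Limits.colimit.ι_desc (F := A.gluingData.functor) _ _

lemma map_chart (hU : IsAffineOpen U) (hV : IsAffineOpen V) (h : V ≤ U)
    (hr : ∃ r : Γ(X, U), X.basicOpen r = V) :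
    Spec.map (A.presheaf.map (homOfLE h).op) ≫ A.chart hU = A.chart hV :=
  let V' : X.AffineZariskiSite := ⟨V, hV⟩
  let U' : X.AffineZariskiSite := ⟨U, hU⟩
  have h : V' ≤ U' := hr
  Limits.colimit.w A.gluingData.functor (homOfLE h)

lemma proj_preimage (hU : IsAffineOpen U) : A.proj ⁻¹ᵁ U = (A.chart hU).opensRange := by
  have := A.gluingData.toBase_preimage_eq_opensRange_ι ⟨U, hU⟩
  rwa [show ((directedCover X).f ⟨U, hU⟩).opensRange = U from Opens.opensRange_ι _] at this

lemma le_chart_preimage (hU : IsAffineOpen U) : ⊤ ≤ A.chart hU ⁻¹ᵁ (A.proj ⁻¹ᵁ U) := by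
  rw [A.proj_preimage hU, Scheme.Hom.preimage_opensRange]

/-- The sections of the relative spectrum over an affine open set. -/
noncomputable def sections (hU : IsAffineOpen U) :
    Γ(A.spec, A.proj ⁻¹ᵁ U) ⟶ A.presheaf.obj (op U) :=
  (A.chart hU).appLE _ ⊤ (A.le_chart_preimage hU) ≫ (Scheme.ΓSpecIso _).hom

instance (hU : IsAffineOpen U) : IsIso (A.sections hU) := by
  have h1 : IsIso ((A.chart hU).app (A.proj ⁻¹ᵁ U)) :=
    Scheme.Hom.isIso_app _ _ (A.proj_preimage hU).le
  have h2 : IsIso ((A.chart hU).appLE _ ⊤ (A.le_chart_preimage hU)) := by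
    have : (A.chart hU).appLE _ ⊤ (A.le_chart_preimage hU) = (A.chart hU).app (A.proj ⁻¹ᵁ U) ≫
        (Spec _).presheaf.map (eqToHom (top_le_iff.1 (A.le_chart_preimage hU)).symm).op := by
      rw [Scheme.Hom.app_eq_appLE, Scheme.Hom.appLE_map]
    rw [this]
    infer_instance
  unfold sections
  infer_instance

lemma sections_res (hU : IsAffineOpen U) (hV : IsAffineOpen V) (h : V ≤ U)
    (hr : ∃ r : Γ(X, U), X.basicOpen r = V) :
    A.sections hU ≫ A.presheaf.map (homOfLE h).op =
      A.spec.presheaf.map (homOfLE (A.proj.preimage_mono h)).op ≫ A.sections hV := by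
  unfold sections
  have h' : (A.chart hV).appLE _ ⊤ ((A.le_chart_preimage hV).trans
      ((A.chart hV).preimage_mono (A.proj.preimage_mono h))) =
      (A.chart hU).appLE _ ⊤ (A.le_chart_preimage hU) ≫
        (Spec.map (A.presheaf.map (homOfLE h).op)).appTop := by
    simp only [← A.map_chart hU hV h hr]
    refine Eq.trans ?_ (congrArg _ (Scheme.Hom.app_eq_appLE _).symm)
    exact (Scheme.Hom.appLE_comp_appLE _ _ _ _ _ _ _).symm
  rw [Scheme.Hom.map_appLE_assoc, h', Category.assoc, Category.assoc, Scheme.ΓSpecIso_naturality]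

lemma app_sections (hU : IsAffineOpen U) :
    A.proj.app U ≫ A.sections hU = A.algebra.app (op U) := by
  unfold sections
  have h : A.proj.app U ≫ (A.chart hU).appLE _ ⊤ (A.le_chart_preimage hU) =
      hU.fromSpec.appLE U ⊤ (by simp) ≫ (Spec.map (A.algebra.app (op U))).appTop := by
    refine (Scheme.Hom.comp_appLE (A.chart hU) A.proj U ⊤ (A.le_chart_preimage hU)).symm.trans ?_
    simp only [A.chart_proj hU]
    refine Eq.trans ?_ (congrArg _ (Scheme.Hom.app_eq_appLE _).symm)
    exact (Scheme.Hom.appLE_comp_appLE _ _ _ _ _ _ _).symm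
  rw [reassoc_of% h, Scheme.ΓSpecIso_naturality, hU.appLE_fromSpec_top, Iso.inv_hom_id_assoc]

/-- A retraction of `Γ(X, U) → A(U)` with nil kernel exhibits the projection as a homeomorphism
over `U`. -/
lemma isHomeomorph_restrictPreimage_proj (hU : IsAffineOpen U)
    (ρ : A.presheaf.obj (op U) →+* Γ(X, U)) (hρ : ∀ a, ρ (A.algebra.app (op U) a) = a)
    (hker : RingHom.ker ρ ≤ _root_.nilradical _) :
    IsHomeomorph ((U : Set X).restrictPreimage A.proj) := by
  have h1 : IsHomeomorph (PrimeSpectrum.comap ρ) :=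
    PrimeSpectrum.isHomeomorph_comap ρ (fun x => ⟨1, one_pos, ⟨_, (hρ x).trans (pow_one x).symm⟩⟩)
      hker
  have h2 : IsHomeomorph (PrimeSpectrum.comap (A.algebra.app (op U)).hom) := by
    have h4 : ∀ x, PrimeSpectrum.comap (A.algebra.app (op U)).hom
        (PrimeSpectrum.comap ρ x) = x := by
      intro x
      rw [← PrimeSpectrum.comap_comp_apply, show ρ.comp (A.algebra.app (op U)).hom = RingHom.id _
        from RingHom.ext hρ, PrimeSpectrum.comap_id]
    have h5 : PrimeSpectrum.comap (A.algebra.app (op U)).hom = (h1.homeomorph _).symm := by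
      funext x
      obtain ⟨y, rfl⟩ := h1.surjective x
      rw [h4]
      exact ((h1.homeomorph _).symm_apply_apply y).symm
    rw [h5]
    exact (h1.homeomorph _).symm.isHomeomorph
  have h6 : A.proj ∘ A.chart hU = hU.fromSpec ∘ PrimeSpectrum.comap (A.algebra.app (op U)).hom :=
    congrArg (fun f : _ ⟶ X => (f : _ → X)) (A.chart_proj hU)
  refine (A.chart hU).isOpenEmbedding.isEmbedding.isHomeomorph_restrictPreimage
    A.proj.continuous ?_ ?_ ?_
  · exact congrArg (fun V : A.spec.Opens => (V : Set A.spec)) (A.proj_preimage hU).symm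
  · rw [h6]
    exact hU.fromSpec.isOpenEmbedding.isEmbedding.comp h2.isEmbedding
  · rw [h6]
    exact (h2.surjective.range_comp hU.fromSpec).trans hU.range_fromSpec

/-- Restriction of sections of the algebra. -/
noncomputable def res (h : V ≤ U) : A.presheaf.obj (op U) →+* A.presheaf.obj (op V) :=
  (A.presheaf.map (homOfLE h).op).hom

@[simp]
lemma res_res {W : X.Opens} (h : V ≤ U) (h' : W ≤ V) (a : A.presheaf.obj (op U)) :
    A.res h' (A.res h a) = A.res (h'.trans h) a :=
  (ConcreteCategory.congr_hom (A.presheaf.map_comp (homOfLE h).op (homOfLE h').op) a).symm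

lemma algebra_res (h : V ≤ U) (a : Γ(X, U)) :
    A.algebra.app (op V) (X.res h a) = A.res h (A.algebra.app (op U) a) :=
  ConcreteCategory.congr_hom (A.algebra.naturality (homOfLE h).op) a

lemma eq_of_locally {s t : A.presheaf.obj (op U)}
    (h : ∀ x ∈ U, ∃ (V : X.Opens) (hV : V ≤ U), x ∈ V ∧ A.res hV s = A.res hV t) : s = t :=
  TopCat.Sheaf.eq_of_locally (F := ⟨A.presheaf, A.isSheaf⟩) s t h

lemma sections_res_of_le (hU : IsAffineOpen U) (hV : IsAffineOpen V) (h : V ≤ U)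
    (s : Γ(A.spec, A.proj ⁻¹ᵁ U)) :
    A.sections hV (A.spec.res (A.proj.preimage_mono h) s) = A.res h (A.sections hU s) := by
  refine A.eq_of_locally fun x hx => ?_
  obtain ⟨f, g, hfg, hxf⟩ := exists_basicOpen_le_affine_inter hU hV x ⟨h hx, hx⟩
  have hg : X.basicOpen g ≤ V := X.basicOpen_le g
  have key₁ := ConcreteCategory.congr_hom
    (A.sections_res hV (hV.basicOpen g) hg ⟨g, rfl⟩) (A.spec.res (A.proj.preimage_mono h) s)
  have key₂ := ConcreteCategory.congr_hom
    (A.sections_res hU (hV.basicOpen g) (hg.trans h) ⟨f, hfg⟩) s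
  refine ⟨X.basicOpen g, hg, hfg ▸ hxf, ?_⟩
  rw [A.res_res]
  refine key₁.trans (Eq.trans ?_ key₂.symm)
  exact congrArg (A.sections (hV.basicOpen g)) (A.spec.res_res _ _ s)

/-- Functions on the relative spectrum over `U` and sections of the algebra over `U` that agree over
all affine open subsets. -/
def Rel (U : X.Opens) (s : Γ(A.spec, A.proj ⁻¹ᵁ U)) (t : A.presheaf.obj (op U)) : Prop :=
  ∀ (V : X.Opens) (hV : IsAffineOpen V) (h : V ≤ U),
    A.sections hV (A.spec.res (A.proj.preimage_mono h) s) = A.res h t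

variable {A}

lemma Rel.res {s : Γ(A.spec, A.proj ⁻¹ᵁ U)} {t : A.presheaf.obj (op U)} (hst : A.Rel U s t)
    (h : V ≤ U) : A.Rel V (A.spec.res (A.proj.preimage_mono h) s) (A.res h t) := by
  intro W hW hWV
  rw [A.spec.res_res, A.res_res]
  exact hst W hW (hWV.trans h)

lemma exists_affine_le {x : X} (hx : x ∈ U) :
    ∃ (V : X.Opens), V ≤ U ∧ x ∈ V ∧ IsAffineOpen V := by
  obtain ⟨_, ⟨V, hV, rfl⟩, hxV, hVU⟩ := X.isBasis_affineOpens.exists_subset_of_mem_open hx U.2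
  exact ⟨V, hVU, hxV, hV⟩

lemma Rel.of_affine (hU : IsAffineOpen U) (s : Γ(A.spec, A.proj ⁻¹ᵁ U)) :
    A.Rel U s (A.sections hU s) :=
  fun _ hV h => A.sections_res_of_le hU hV h s

lemma Rel.unique_right {s : Γ(A.spec, A.proj ⁻¹ᵁ U)} {t t' : A.presheaf.obj (op U)}
    (h : A.Rel U s t) (h' : A.Rel U s t') : t = t' := by
  refine A.eq_of_locally fun x hx => ?_
  obtain ⟨V, hVU, hxV, hV⟩ := exists_affine_le hx
  exact ⟨V, hVU, hxV, (h V hV hVU).symm.trans (h' V hV hVU)⟩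

lemma Rel.unique_left {s s' : Γ(A.spec, A.proj ⁻¹ᵁ U)} {t : A.presheaf.obj (op U)}
    (h : A.Rel U s t) (h' : A.Rel U s' t) : s = s' := by
  refine A.spec.eq_of_locally fun y hy => ?_
  obtain ⟨V, hVU, hxV, hV⟩ := exists_affine_le (x := A.proj y) hy
  refine ⟨A.proj ⁻¹ᵁ V, A.proj.preimage_mono hVU, hxV, ?_⟩
  exact (ConcreteCategory.bijective_of_isIso (A.sections hV)).1
    ((h V hV hVU).trans (h' V hV hVU).symm)

lemma Rel.of_locally {s : Γ(A.spec, A.proj ⁻¹ᵁ U)} {t : A.presheaf.obj (op U)}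
    (h : ∀ x ∈ U, ∃ (V : X.Opens) (hV : V ≤ U), x ∈ V ∧
      A.Rel V (A.spec.res (A.proj.preimage_mono hV) s) (A.res hV t)) : A.Rel U s t := by
  intro W hW hWU
  refine A.eq_of_locally fun x hx => ?_
  obtain ⟨V, hVU, hxV, hV⟩ := h x (hWU hx)
  obtain ⟨V', hV', hxV', haff⟩ := exists_affine_le (show x ∈ V ⊓ W from ⟨hxV, hx⟩)
  refine ⟨V', hV'.trans inf_le_right, hxV', ?_⟩
  rw [← A.sections_res_of_le hW haff, A.spec.res_res, A.res_res]
  have := hV V' haff (hV'.trans inf_le_left)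
  rwa [A.spec.res_res, A.res_res] at this

variable (A)

lemma exists_rel_right (s : Γ(A.spec, A.proj ⁻¹ᵁ U)) : ∃ t, A.Rel U s t := by
  obtain ⟨t, ht⟩ := TopCat.Sheaf.exists_glue (F := ⟨A.presheaf, A.isSheaf⟩) (U := U)
    (fun V h t => A.Rel V (A.spec.res (A.proj.preimage_mono h) s) t)
    (fun V W hV h t ht => by
      have := ht.res h
      rwa [A.spec.res_res] at this)
    (fun x hx => by
      obtain ⟨V, hVU, hxV, hV⟩ := exists_affine_le hx
      exact ⟨V, hVU, hxV, _, Rel.of_affine hV _⟩)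
    (fun V h _ _ => Rel.unique_right)
  refine ⟨t, Rel.of_locally fun x hx => ?_⟩
  obtain ⟨V, hVU, hxV, hV⟩ := exists_affine_le hx
  refine ⟨V, hVU, hxV, ?_⟩
  have h := Rel.of_affine hV (A.spec.res (A.proj.preimage_mono hVU) s)
  rwa [← show A.res hVU t = _ from ht V hVU _ h] at h

lemma exists_rel_left (t : A.presheaf.obj (op U)) : ∃ s, A.Rel U s t := by
  obtain ⟨s, hs⟩ := TopCat.Sheaf.exists_glue
    (F := (TopCat.Sheaf.pushforward CommRingCat A.proj.base).obj A.spec.sheaf) (U := U)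
    (fun V h (s : Γ(A.spec, A.proj ⁻¹ᵁ V)) => A.Rel V s (A.res h t))
    (fun V W hV h s hs => by
      have := hs.res h
      rw [A.res_res] at this
      exact this)
    (fun x hx => by
      obtain ⟨V, hVU, hxV, hV⟩ := exists_affine_le hx
      obtain ⟨s, hs⟩ := (ConcreteCategory.bijective_of_isIso (A.sections hV)).2 (A.res hVU t)
      exact ⟨V, hVU, hxV, s, hs ▸ Rel.of_affine hV s⟩)
    (fun V h _ _ => Rel.unique_left)
  refine ⟨s, Rel.of_locally fun x hx => ?_⟩
  obtain ⟨V, hVU, hxV, hV⟩ := exists_affine_le hx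
  refine ⟨V, hVU, hxV, ?_⟩
  obtain ⟨s', hs'⟩ := (ConcreteCategory.bijective_of_isIso (A.sections hV)).2 (A.res hVU t)
  have h : A.Rel V s' (A.res hVU t) := hs' ▸ Rel.of_affine hV s'
  rwa [← show A.spec.res (A.proj.preimage_mono hVU) s = _ from hs V hVU _ h] at h

/-- The functions on the relative spectrum over `U` are the sections of the algebra over `U`. -/
noncomputable def sectionsEquiv (U : X.Opens) :
    Γ(A.spec, A.proj ⁻¹ᵁ U) ≃+* A.presheaf.obj (op U) where
  toFun s := (A.exists_rel_right s).choose
  invFun t := (A.exists_rel_left t).choose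
  left_inv s := Rel.unique_left (A.exists_rel_left _).choose_spec (A.exists_rel_right s).choose_spec
  right_inv t := Rel.unique_right (A.exists_rel_right _).choose_spec
    (A.exists_rel_left t).choose_spec
  map_mul' s s' := Rel.unique_right (A.exists_rel_right _).choose_spec fun V hV h => by
    rw [map_mul, map_mul, map_mul, (A.exists_rel_right s).choose_spec V hV h,
      (A.exists_rel_right s').choose_spec V hV h]
  map_add' s s' := Rel.unique_right (A.exists_rel_right _).choose_spec fun V hV h => by
    rw [map_add, map_add, map_add, (A.exists_rel_right s).choose_spec V hV h,
      (A.exists_rel_right s').choose_spec V hV h]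

lemma sectionsEquiv_eq {s : Γ(A.spec, A.proj ⁻¹ᵁ U)} {t : A.presheaf.obj (op U)}
    (h : A.Rel U s t) : A.sectionsEquiv U s = t :=
  Rel.unique_right (A.exists_rel_right s).choose_spec h

lemma sectionsEquiv_res (h : V ≤ U) (s : Γ(A.spec, A.proj ⁻¹ᵁ U)) :
    A.sectionsEquiv V (A.spec.res (A.proj.preimage_mono h) s) = A.res h (A.sectionsEquiv U s) :=
  A.sectionsEquiv_eq ((A.exists_rel_right s).choose_spec.res h)

lemma sectionsEquiv_app (a : Γ(X, U)) :
    A.sectionsEquiv U (A.proj.app U a) = A.algebra.app (op U) a := by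
  refine A.sectionsEquiv_eq fun V hV h => ?_
  have h1 : A.spec.res (A.proj.preimage_mono h) (A.proj.app U a) = A.proj.app V (X.res h a) :=
    (ConcreteCategory.congr_hom (A.proj.naturality (homOfLE h).op) a).symm
  rw [h1, ← A.algebra_res]
  exact ConcreteCategory.congr_hom (A.app_sections hV) _

end QuasicoherentAlgebra

end AlgebraicGeometry.Scheme

/-! ### The algebra `𝒪[θ]` and its twisted forms -/

namespace Superscheme

variable (X : Superscheme.{u}) (U : X.even.Opens)

/-- The even part of `𝒪(U)[θ]`: the pair `(a, α)` stands for `a + α θ`. -/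
def EvenTheta : Type u := Γ(X.even, U) × Γ(X.odd, U)

/-- The odd part of `𝒪(U)[θ]`: the pair `(b, β)` stands for `b θ + β`. -/
def OddTheta : Type u := Γ(X.even, U) × Γ(X.odd, U)

noncomputable instance : AddCommGroup (EvenTheta X U) :=
  inferInstanceAs (AddCommGroup (Γ(X.even, U) × Γ(X.odd, U)))

noncomputable instance : AddCommGroup (OddTheta X U) :=
  inferInstanceAs (AddCommGroup (Γ(X.even, U) × Γ(X.odd, U)))

/-- `(a + α θ) (b + β θ) = a b + (a β + b α) θ`. -/
noncomputable instance : CommRing (EvenTheta X U) where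
  mul p q := (p.1 * q.1, p.1 • q.2 + q.1 • p.2)
  one := (1, 0)
  mul_assoc p q r := Prod.ext (_root_.mul_assoc p.1 q.1 r.1) (by
    change (p.1 * q.1) • r.2 + r.1 • (p.1 • q.2 + q.1 • p.2) =
      p.1 • (q.1 • r.2 + r.1 • q.2) + (q.1 * r.1) • p.2
    module)
  one_mul p := Prod.ext (_root_.one_mul p.1) (by
    change (1 : Γ(X.even, U)) • p.2 + p.1 • (0 : Γ(X.odd, U)) = p.2
    module)
  mul_one p := Prod.ext (_root_.mul_one p.1) (by
    change p.1 • (0 : Γ(X.odd, U)) + (1 : Γ(X.even, U)) • p.2 = p.2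
    module)
  mul_comm p q := Prod.ext (_root_.mul_comm p.1 q.1) (add_comm (p.1 • q.2) _)
  left_distrib p q r := Prod.ext (_root_.mul_add p.1 q.1 r.1) (by
    change p.1 • (q.2 + r.2) + (q.1 + r.1) • p.2 = (p.1 • q.2 + q.1 • p.2) + (p.1 • r.2 + r.1 • p.2)
    module)
  right_distrib p q r := Prod.ext (_root_.add_mul p.1 q.1 r.1) (by
    change (p.1 + q.1) • r.2 + r.1 • (p.2 + q.2) = (p.1 • r.2 + r.1 • p.2) + (q.1 • r.2 + r.1 • q.2)
    module)
  zero_mul p := Prod.ext (zero_mul p.1) (by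
    change (0 : Γ(X.even, U)) • p.2 + p.1 • (0 : Γ(X.odd, U)) = 0
    module)
  mul_zero p := Prod.ext (mul_zero p.1) (by
    change p.1 • (0 : Γ(X.odd, U)) + (0 : Γ(X.even, U)) • p.2 = 0
    module)
  zsmul := zsmulRec
  neg_add_cancel p := neg_add_cancel p
  sub_eq_add_neg p q := sub_eq_add_neg p q

/-- `(a + α θ) (b θ + β) = (a b - α β) θ + a β`. -/
noncomputable instance : Module (EvenTheta X U) (OddTheta X U) where
  smul p x := (p.1 * x.1 - X.mul U p.2 x.2, p.1 • x.2)
  one_smul x := Prod.ext (by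
    change 1 * x.1 - X.mul U 0 x.2 = x.1
    rw [map_zero, LinearMap.zero_apply]; ring) (one_smul _ x.2)
  mul_smul p q x := Prod.ext (by
    change p.1 * q.1 * x.1 - X.mul U (p.1 • q.2 + q.1 • p.2) x.2 =
      p.1 * (q.1 * x.1 - X.mul U q.2 x.2) - X.mul U p.2 (q.1 • x.2)
    simp only [map_add, map_smul, LinearMap.add_apply, LinearMap.smul_apply, smul_eq_mul]
    ring) (mul_smul p.1 q.1 x.2)
  smul_zero p := Prod.ext (by
    change p.1 * 0 - X.mul U p.2 0 = 0
    rw [map_zero]; ring) (smul_zero p.1)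
  smul_add p x y := Prod.ext (by
    change p.1 * (x.1 + y.1) - X.mul U p.2 (x.2 + y.2) =
      (p.1 * x.1 - X.mul U p.2 x.2) + (p.1 * y.1 - X.mul U p.2 y.2)
    rw [map_add]; ring) (smul_add p.1 x.2 y.2)
  add_smul p q x := Prod.ext (by
    change (p.1 + q.1) * x.1 - X.mul U (p.2 + q.2) x.2 =
      (p.1 * x.1 - X.mul U p.2 x.2) + (q.1 * x.1 - X.mul U q.2 x.2)
    rw [map_add, LinearMap.add_apply]; ring) (add_smul p.1 q.1 x.2)
  zero_smul x := Prod.ext (by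
    change 0 * x.1 - X.mul U 0 x.2 = 0
    rw [map_zero, LinearMap.zero_apply]; ring) (zero_smul _ x.2)

variable {X U}

/-- `(b θ + β) (b' θ + β') = β β' + (b' β - b β') θ`. -/
noncomputable def oddThetaMul (x y : OddTheta X U) : EvenTheta X U :=
  (X.mul U x.2 y.2, y.1 • x.2 - x.1 • y.2)

lemma oddThetaMul_add_left (x x' y : OddTheta X U) :
    oddThetaMul (x + x') y = oddThetaMul x y + oddThetaMul x' y :=
  Prod.ext (LinearMap.map_add₂ _ _ _ _) (by
    change y.1 • (x.2 + x'.2) - (x.1 + x'.1) • y.2 =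
      (y.1 • x.2 - x.1 • y.2) + (y.1 • x'.2 - x'.1 • y.2)
    module)

lemma oddThetaMul_self (x : OddTheta X U) : oddThetaMul x x = 0 :=
  Prod.ext (X.mul_self x.2) (sub_self (x.1 • x.2))

lemma oddThetaMul_comm (x y : OddTheta X U) : oddThetaMul x y = - oddThetaMul y x :=
  Prod.ext (Superscheme.mul_comm_neg x.2 y.2) (neg_sub (x.1 • y.2) (y.1 • x.2)).symm

lemma oddThetaMul_smul_left (p : EvenTheta X U) (x y : OddTheta X U) :
    oddThetaMul (p • x) y = p * oddThetaMul x y :=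
  Prod.ext
    (by
      change X.mul U (p.1 • x.2) y.2 = p.1 * X.mul U x.2 y.2
      rw [map_smul, LinearMap.smul_apply, smul_eq_mul])
    (by
      change y.1 • p.1 • x.2 - (p.1 * x.1 - X.mul U p.2 x.2) • y.2 =
        p.1 • (y.1 • x.2 - x.1 • y.2) + X.mul U x.2 y.2 • p.2
      rw [sub_smul, ← X.mul_assoc p.2]
      module)

lemma oddThetaMul_smul_assoc (x y z : OddTheta X U) : oddThetaMul x y • z = oddThetaMul y z • x :=
  Prod.ext
    (by
      change X.mul U x.2 y.2 * z.1 - X.mul U (y.1 • x.2 - x.1 • y.2) z.2 =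
        X.mul U y.2 z.2 * x.1 - X.mul U (z.1 • y.2 - y.1 • z.2) x.2
      rw [Superscheme.mul_comm_neg x.2 y.2]
      simp only [map_sub, map_smul, LinearMap.sub_apply, LinearMap.smul_apply, smul_eq_mul]
      rw [Superscheme.mul_comm_neg x.2 z.2]
      ring)
    (X.mul_assoc x.2 y.2 z.2)

end Superscheme

namespace AffineCocycle

variable {X : Superscheme.{u}} {B : TrivSystem X.even} (c : AffineCocycle X B)
  {U V : X.even.Opens}

open Superscheme (EvenTheta OddTheta oddThetaMul)

/-- The substitution `θ = u θ' + γ` in even elements of `𝒪[θ]`. -/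
noncomputable def substEven (b b' : B.obj U) (p : EvenTheta X U) : EvenTheta X U :=
  c.extTwist.even.g b b' p

/-- The substitution `θ = u θ' + γ` in odd elements of `𝒪[θ]`. -/
noncomputable def substOdd (b b' : B.obj U) (x : OddTheta X U) : OddTheta X U :=
  c.extTwist.odd.g b b' x

lemma substEven_mul (b b' : B.obj U) (p q : EvenTheta X U) :
    c.substEven b b' (p * q) = c.substEven b b' p * c.substEven b b' q := by
  have h₁ : X.mul U p.2 (c.γ b' b) • q.2 = - X.mul U q.2 (c.γ b' b) • p.2 := by
    rw [X.mul_assoc, Superscheme.mul_comm_neg, neg_smul]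
  have h₂ : X.mul U p.2 (c.γ b' b) * X.mul U q.2 (c.γ b' b) = 0 := by
    have h : X.mul U q.2 (c.γ b' b) • c.γ b' b = 0 := by
      rw [X.mul_assoc, X.mul_self, zero_smul]
    rw [mul_comm, ← smul_eq_mul, ← map_smul, h, map_zero]
  refine Prod.ext ?_ ?_
  · change p.1 * q.1 + X.mul U (p.1 • q.2 + q.1 • p.2) (c.γ b' b) =
      (p.1 + X.mul U p.2 (c.γ b' b)) * (q.1 + X.mul U q.2 (c.γ b' b))
    simp only [map_add, map_smul, LinearMap.add_apply, LinearMap.smul_apply, smul_eq_mul]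
    linear_combination -h₂
  · change c.u b' b • (p.1 • q.2 + q.1 • p.2) = (p.1 + X.mul U p.2 (c.γ b' b)) • c.u b' b • q.2 +
      (q.1 + X.mul U q.2 (c.γ b' b)) • c.u b' b • p.2
    rw [add_smul, smul_comm (X.mul U p.2 (c.γ b' b)), h₁]
    module

lemma substEven_one (b b' : B.obj U) : c.substEven b b' 1 = 1 :=
  Prod.ext
    (by
      change 1 + X.mul U 0 _ = 1
      rw [map_zero, LinearMap.zero_apply, add_zero])
    (smul_zero _)

lemma substOdd_smul (b b' : B.obj U) (p : EvenTheta X U) (x : OddTheta X U) :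
    c.substOdd b b' (p • x) = c.substEven b b' p • c.substOdd b b' x := by
  have h₁ : X.mul U p.2 (c.γ b' b) • x.2 = - X.mul U p.2 x.2 • c.γ b' b := by
    rw [X.mul_assoc, X.mul_assoc, Superscheme.mul_comm_neg, neg_smul]
  have h₂ : X.mul U p.2 (c.γ b' b) • c.γ b' b = 0 := by
    rw [X.mul_assoc, X.mul_self, zero_smul]
  refine Prod.ext ?_ ?_
  · change (p.1 * x.1 - X.mul U p.2 x.2) * c.u b' b = (p.1 + X.mul U p.2 (c.γ b' b)) *
      (x.1 * c.u b' b) - X.mul U (c.u b' b • p.2) (x.1 • c.γ b' b + x.2)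
    simp only [map_add, map_smul, LinearMap.smul_apply, smul_eq_mul]
    ring
  · change (p.1 * x.1 - X.mul U p.2 x.2) • c.γ b' b + p.1 • x.2 =
      (p.1 + X.mul U p.2 (c.γ b' b)) • (x.1 • c.γ b' b + x.2)
    rw [add_smul, smul_add (X.mul U p.2 (c.γ b' b)), h₁, smul_comm _ x.1, h₂]
    module

lemma substEven_oddThetaMul (b b' : B.obj U) (x y : OddTheta X U) :
    c.substEven b b' (oddThetaMul x y) = oddThetaMul (c.substOdd b b' x) (c.substOdd b b' y) := by
  refine Prod.ext ?_ ?_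
  · change X.mul U x.2 y.2 + X.mul U (y.1 • x.2 - x.1 • y.2) (c.γ b' b) =
      X.mul U (x.1 • c.γ b' b + x.2) (y.1 • c.γ b' b + y.2)
    simp only [map_add, map_sub, map_smul, LinearMap.add_apply, LinearMap.sub_apply,
      LinearMap.smul_apply, smul_eq_mul]
    rw [X.mul_self, Superscheme.mul_comm_neg (c.γ b' b) y.2]
    ring
  · change c.u b' b • (y.1 • x.2 - x.1 • y.2) = (y.1 * c.u b' b) • (x.1 • c.γ b' b + x.2) -
      (x.1 * c.u b' b) • (y.1 • c.γ b' b + y.2)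
    module

/-- Even sections of the extension, as elements of a twisted form of `𝒪[θ]`. -/
def Even (U : X.even.Opens) : Type u := Γ(c.ext.right.even, U)

/-- Odd sections of the extension, as elements of a twisted form of `𝒪[θ]`. -/
def Odd (U : X.even.Opens) : Type u := Γ(c.ext.right.odd, U)

noncomputable instance : AddCommGroup (c.Even U) :=
  inferInstanceAs (AddCommGroup Γ(c.ext.right.even, U))

noncomputable instance : AddCommGroup (c.Odd U) :=
  inferInstanceAs (AddCommGroup Γ(c.ext.right.odd, U))

/-- The coordinates of the restriction of an even section of the extension. -/
noncomputable def evenAt (h : V ≤ U) (b : B.obj V) (f : c.Even U) : EvenTheta X V :=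
  c.coordEven b (c.ext.right.even.res h f)

/-- The coordinates of the restriction of an odd section of the extension. -/
noncomputable def oddAt (h : V ≤ U) (b : B.obj V) (f : c.Odd U) : OddTheta X V :=
  c.coordOdd b (c.ext.right.odd.res h f)

/-- Restriction of even elements of `𝒪[θ]`. -/
noncomputable def resEven (h : V ≤ U) : EvenTheta X U →+* EvenTheta X V where
  toFun p := (X.even.res h p.1, X.odd.res h p.2)
  map_one' := Prod.ext (map_one (X.even.res h)) (map_zero (X.odd.res h))
  map_mul' p q := Prod.ext (map_mul (X.even.res h) p.1 q.1) (by
    change X.odd.res h (p.1 • q.2 + q.1 • p.2) = _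
    rw [map_add, Scheme.Modules.res_smul, Scheme.Modules.res_smul]
    rfl)
  map_zero' := Prod.ext (map_zero (X.even.res h)) (map_zero (X.odd.res h))
  map_add' p q := Prod.ext (map_add (X.even.res h) p.1 q.1) (map_add (X.odd.res h) p.2 q.2)

/-- Restriction of odd elements of `𝒪[θ]`. -/
noncomputable def resOdd (h : V ≤ U) (x : OddTheta X U) : OddTheta X V :=
  (X.even.res h x.1, X.odd.res h x.2)

lemma resOdd_smul (h : V ≤ U) (p : EvenTheta X U) (x : OddTheta X U) :
    resOdd h (p • x) = resEven h p • resOdd h x :=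
  Prod.ext
    (by
      change X.even.res h (p.1 * x.1 - X.mul U p.2 x.2) = _
      rw [map_sub, map_mul, Superscheme.res_mul]
      rfl)
    (X.odd.res_smul h p.1 x.2)

lemma resEven_oddThetaMul (h : V ≤ U) (x y : OddTheta X U) :
    resEven h (oddThetaMul x y) = oddThetaMul (resOdd h x) (resOdd h y) :=
  Prod.ext (Superscheme.res_mul h x.2 y.2) (by
    change X.odd.res h (y.1 • x.2 - x.1 • y.2) = _
    rw [map_sub, Scheme.Modules.res_smul, Scheme.Modules.res_smul]
    rfl)

lemma evenAt_change {W : X.even.Opens} (h : V ≤ U) (h' : W ≤ V) (b : B.obj V) (b' : B.obj W)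
    (f : c.Even U) :
    c.evenAt (h'.trans h) b' f = c.substEven (B.res h' b) b' (resEven h' (c.evenAt h b f)) := by
  have := c.extTwist.isLinear_even.coord_res_change h' b b' (c.ext.right.even.res h f)
  exact (congrArg (c.coordEven b') (c.ext.right.even.res_res h h' f).symm).trans this

lemma oddAt_change {W : X.even.Opens} (h : V ≤ U) (h' : W ≤ V) (b : B.obj V) (b' : B.obj W)
    (f : c.Odd U) :
    c.oddAt (h'.trans h) b' f = c.substOdd (B.res h' b) b' (resOdd h' (c.oddAt h b f)) := by
  have := c.extTwist.isLinear_odd.coord_res_change h' b b' (c.ext.right.odd.res h f)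
  exact (congrArg (c.coordOdd b') (c.ext.right.odd.res_res h h' f).symm).trans this

variable {c}

lemma even_ext {f g : c.Even U}
    (h : ∀ (V : X.even.Opens) (hV : V ≤ U) (b : B.obj V), c.evenAt hV b f = c.evenAt hV b g) :
    f = g :=
  c.extTwist.isLinear_even.ext_coord h

lemma odd_ext {f g : c.Odd U}
    (h : ∀ (V : X.even.Opens) (hV : V ≤ U) (b : B.obj V), c.oddAt hV b f = c.oddAt hV b g) :
    f = g :=
  c.extTwist.isLinear_odd.ext_coord h

lemma exists_even (F : ∀ (V : X.even.Opens) (_ : V ≤ U), B.obj V → EvenTheta X V)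
    (hF : ∀ (V W : X.even.Opens) (h : V ≤ U) (h' : W ≤ V) (b : B.obj V) (b' : B.obj W),
      F W (h'.trans h) b' = c.substEven (B.res h' b) b' (resEven h' (F V h b))) :
    ∃ f : c.Even U, ∀ (V : X.even.Opens) (hV : V ≤ U) (b : B.obj V),
      c.evenAt hV b f = F V hV b :=
  ⟨c.extTwist.isLinear_even.ofCoord (fun W b => F W.1 W.2 b) hF, fun V hV b =>
    c.extTwist.isLinear_even.coord_res_ofCoord (fun W b => F W.1 W.2 b) hF V hV b⟩

lemma exists_odd (F : ∀ (V : X.even.Opens) (_ : V ≤ U), B.obj V → OddTheta X V)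
    (hF : ∀ (V W : X.even.Opens) (h : V ≤ U) (h' : W ≤ V) (b : B.obj V) (b' : B.obj W),
      F W (h'.trans h) b' = c.substOdd (B.res h' b) b' (resOdd h' (F V h b))) :
    ∃ f : c.Odd U, ∀ (V : X.even.Opens) (hV : V ≤ U) (b : B.obj V),
      c.oddAt hV b f = F V hV b :=
  ⟨c.extTwist.isLinear_odd.ofCoord (fun W b => F W.1 W.2 b) hF, fun V hV b =>
    c.extTwist.isLinear_odd.coord_res_ofCoord (fun W b => F W.1 W.2 b) hF V hV b⟩

end AffineCocycle

namespace AffineCocycle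

variable {X : Superscheme.{u}} {B : TrivSystem X.even} (c : AffineCocycle X B)
  {U V : X.even.Opens}

open Superscheme (EvenTheta OddTheta oddThetaMul)

lemma evenAt_add (h : V ≤ U) (b : B.obj V) (f g : c.Even U) :
    c.evenAt h b (f + g) = c.evenAt h b f + c.evenAt h b g := rfl

lemma oddAt_add (h : V ≤ U) (b : B.obj V) (f g : c.Odd U) :
    c.oddAt h b (f + g) = c.oddAt h b f + c.oddAt h b g := rfl

lemma evenAt_zero (h : V ≤ U) (b : B.obj V) : c.evenAt h b (0 : c.Even U) = 0 := rfl

lemma evenAt_neg (h : V ≤ U) (b : B.obj V) (f : c.Even U) :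
    c.evenAt h b (-f) = -c.evenAt h b f := rfl

lemma oddAt_zero (h : V ≤ U) (b : B.obj V) : c.oddAt h b (0 : c.Odd U) = 0 := rfl

lemma exists_mul (f g : c.Even U) : ∃ p : c.Even U, ∀ (V : X.even.Opens) (hV : V ≤ U)
    (b : B.obj V), c.evenAt hV b p = c.evenAt hV b f * c.evenAt hV b g :=
  exists_even _ fun V W h h' b b' => by
    rw [c.evenAt_change h h' b, c.evenAt_change h h' b b' g, map_mul, substEven_mul]

lemma exists_one : ∃ p : c.Even U, ∀ (V : X.even.Opens) (hV : V ≤ U)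
    (b : B.obj V), c.evenAt hV b p = 1 :=
  exists_even _ fun V W h h' b b' => by rw [map_one, substEven_one]

lemma exists_smul (f : c.Even U) (x : c.Odd U) : ∃ y : c.Odd U, ∀ (V : X.even.Opens) (hV : V ≤ U)
    (b : B.obj V), c.oddAt hV b y = c.evenAt hV b f • c.oddAt hV b x :=
  exists_odd _ fun V W h h' b b' => by
    rw [c.evenAt_change h h' b, c.oddAt_change h h' b b' x, resOdd_smul, substOdd_smul]

lemma exists_oddMul (x y : c.Odd U) : ∃ p : c.Even U, ∀ (V : X.even.Opens) (hV : V ≤ U)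
    (b : B.obj V), c.evenAt hV b p = oddThetaMul (c.oddAt hV b x) (c.oddAt hV b y) :=
  exists_even _ fun V W h h' b b' => by
    rw [c.oddAt_change h h' b, c.oddAt_change h h' b b' y, resEven_oddThetaMul,
      substEven_oddThetaMul]

/-- The product of two odd sections. -/
noncomputable def oddMul (x y : c.Odd U) : c.Even U := (c.exists_oddMul x y).choose

noncomputable instance : Mul (c.Even U) := ⟨fun f g => (c.exists_mul f g).choose⟩
noncomputable instance : One (c.Even U) := ⟨c.exists_one.choose⟩
noncomputable instance : SMul (c.Even U) (c.Odd U) := ⟨fun f x => (c.exists_smul f x).choose⟩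

lemma evenAt_mul (h : V ≤ U) (b : B.obj V) (f g : c.Even U) :
    c.evenAt h b (f * g) = c.evenAt h b f * c.evenAt h b g :=
  (c.exists_mul f g).choose_spec V h b

lemma evenAt_one (h : V ≤ U) (b : B.obj V) : c.evenAt h b (1 : c.Even U) = 1 :=
  c.exists_one.choose_spec V h b

lemma oddAt_smul (h : V ≤ U) (b : B.obj V) (f : c.Even U) (x : c.Odd U) :
    c.oddAt h b (f • x) = c.evenAt h b f • c.oddAt h b x :=
  (c.exists_smul f x).choose_spec V h b

lemma evenAt_oddMul (h : V ≤ U) (b : B.obj V) (x y : c.Odd U) :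
    c.evenAt h b (c.oddMul x y) = oddThetaMul (c.oddAt h b x) (c.oddAt h b y) :=
  (c.exists_oddMul x y).choose_spec V h b

noncomputable instance : CommRing (c.Even U) where
  mul_assoc f g h := even_ext fun V hV b => by simp only [evenAt_mul, mul_assoc]
  one_mul f := even_ext fun V hV b => by rw [evenAt_mul, evenAt_one, one_mul]
  mul_one f := even_ext fun V hV b => by rw [evenAt_mul, evenAt_one, mul_one]
  mul_comm f g := even_ext fun V hV b => by rw [evenAt_mul, evenAt_mul, mul_comm]
  left_distrib f g h := even_ext fun V hV b => by simp only [evenAt_mul, evenAt_add, mul_add]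
  right_distrib f g h := even_ext fun V hV b => by simp only [evenAt_mul, evenAt_add, add_mul]
  zero_mul f := even_ext fun V hV b => by rw [evenAt_mul, evenAt_zero, zero_mul]
  mul_zero f := even_ext fun V hV b => by rw [evenAt_mul, evenAt_zero, mul_zero]
  zsmul := zsmulRec
  neg_add_cancel f := neg_add_cancel f
  sub_eq_add_neg f g := sub_eq_add_neg f g

noncomputable instance : Module (c.Even U) (c.Odd U) where
  one_smul x := odd_ext fun V hV b => by rw [oddAt_smul, evenAt_one, one_smul]
  mul_smul f g x := odd_ext fun V hV b => by simp only [oddAt_smul, evenAt_mul, mul_smul]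
  smul_zero f := odd_ext fun V hV b => by rw [oddAt_smul, oddAt_zero, smul_zero]
  smul_add f x y := odd_ext fun V hV b => by simp only [oddAt_smul, oddAt_add, smul_add]
  add_smul f g x := odd_ext fun V hV b => by
    simp only [oddAt_smul, evenAt_add, oddAt_add, add_smul]
  zero_smul x := odd_ext fun V hV b => by
    rw [oddAt_smul, evenAt_zero, oddAt_zero, zero_smul]

/-- Restriction of odd sections. -/
noncomputable def oddRes (h : V ≤ U) : c.Odd U →+ c.Odd V := c.ext.right.odd.res h

/-- Restriction of even sections, as a map of abelian groups. -/
noncomputable def evenResAdd (h : V ≤ U) : c.Even U →+ c.Even V := c.ext.right.even.res h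

lemma evenAt_evenResAdd {W : X.even.Opens} (h : V ≤ U) (h' : W ≤ V) (b : B.obj W) (f : c.Even U) :
    c.evenAt h' b (c.evenResAdd h f) = c.evenAt (h'.trans h) b f :=
  congrArg (c.coordEven b) (c.ext.right.even.res_res h h' f)

/-- Restriction of even sections. -/
noncomputable def evenRes (h : V ≤ U) : c.Even U →+* c.Even V where
  __ := c.evenResAdd h
  map_one' := even_ext fun W hW b =>
    (c.evenAt_evenResAdd h hW b 1).trans (by rw [evenAt_one, evenAt_one])
  map_mul' f g := even_ext fun W hW b =>
    (c.evenAt_evenResAdd h hW b _).trans (by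
      rw [evenAt_mul, evenAt_mul, ← evenAt_evenResAdd c h hW, ← evenAt_evenResAdd c h hW]; rfl)

lemma evenAt_evenRes {W : X.even.Opens} (h : V ≤ U) (h' : W ≤ V) (b : B.obj W) (f : c.Even U) :
    c.evenAt h' b (c.evenRes h f) = c.evenAt (h'.trans h) b f :=
  c.evenAt_evenResAdd h h' b f

lemma oddAt_oddRes {W : X.even.Opens} (h : V ≤ U) (h' : W ≤ V) (b : B.obj W) (x : c.Odd U) :
    c.oddAt h' b (c.oddRes h x) = c.oddAt (h'.trans h) b x :=
  congrArg (c.coordOdd b) (c.ext.right.odd.res_res h h' x)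

lemma oddRes_smul (h : V ≤ U) (f : c.Even U) (x : c.Odd U) :
    c.oddRes h (f • x) = c.evenRes h f • c.oddRes h x :=
  odd_ext fun W hW b => by simp only [oddAt_oddRes, oddAt_smul, evenAt_evenRes]

lemma evenRes_oddMul (h : V ≤ U) (x y : c.Odd U) :
    c.evenRes h (c.oddMul x y) = c.oddMul (c.oddRes h x) (c.oddRes h y) :=
  even_ext fun W hW b => by simp only [evenAt_evenRes, evenAt_oddMul, oddAt_oddRes]

lemma oddMul_add_left (x x' y : c.Odd U) :
    c.oddMul (x + x') y = c.oddMul x y + c.oddMul x' y :=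
  even_ext fun V hV b => by
    simp only [evenAt_oddMul, evenAt_add, oddAt_add, Superscheme.oddThetaMul_add_left]

lemma oddMul_self (x : c.Odd U) : c.oddMul x x = 0 :=
  even_ext fun V hV b => by rw [evenAt_oddMul, evenAt_zero, Superscheme.oddThetaMul_self]

lemma oddMul_comm (x y : c.Odd U) : c.oddMul x y = - c.oddMul y x :=
  even_ext fun V hV b => by
    rw [evenAt_neg, evenAt_oddMul, evenAt_oddMul, Superscheme.oddThetaMul_comm]

lemma oddMul_smul_left (f : c.Even U) (x y : c.Odd U) :
    c.oddMul (f • x) y = f * c.oddMul x y :=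
  even_ext fun V hV b => by
    simp only [evenAt_oddMul, evenAt_mul, oddAt_smul, Superscheme.oddThetaMul_smul_left]

lemma oddMul_add_right (x y y' : c.Odd U) :
    c.oddMul x (y + y') = c.oddMul x y + c.oddMul x y' := by
  rw [oddMul_comm, oddMul_comm c x y, oddMul_comm c x y', oddMul_add_left, neg_add]

lemma oddMul_smul_right (f : c.Even U) (x y : c.Odd U) :
    c.oddMul x (f • y) = f * c.oddMul x y := by
  rw [oddMul_comm, oddMul_comm c x y, oddMul_smul_left, mul_neg]

lemma oddMul_smul_assoc (x y z : c.Odd U) : c.oddMul x y • z = c.oddMul y z • x :=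
  odd_ext fun V hV b => by
    simp only [evenAt_oddMul, oddAt_smul, Superscheme.oddThetaMul_smul_assoc (c.oddAt hV b x)]

/-- Functions on `X` as even sections of the extension, as a map of abelian groups. -/
noncomputable def ofEvenAdd (U : X.even.Opens) : Γ(X.even, U) →+ c.Even U :=
  (c.ext.hom.even.app U).hom

lemma evenAt_ofEvenAdd (h : V ≤ U) (b : B.obj V) (a : Γ(X.even, U)) :
    c.evenAt h b (c.ofEvenAdd U a) = (X.even.res h a, 0) :=
  rfl

/-- Functions on `X` as even sections of the extension. -/
noncomputable def algebraEven (U : X.even.Opens) : Γ(X.even, U) →+* c.Even U where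
  __ := c.ofEvenAdd U
  map_one' := even_ext fun V hV b => by
    refine (c.evenAt_ofEvenAdd hV b 1).trans ?_
    rw [evenAt_one, map_one]
    rfl
  map_mul' a a' := even_ext fun V hV b => by
    refine (c.evenAt_ofEvenAdd hV b _).trans ?_
    rw [evenAt_mul]
    refine Eq.trans ?_ (congrArg₂ (· * ·) (c.evenAt_ofEvenAdd hV b a)
      (c.evenAt_ofEvenAdd hV b a')).symm
    refine Prod.ext (map_mul (X.even.res hV) a a') ?_
    change 0 = X.even.res hV a • (0 : Γ(X.odd, V)) + X.even.res hV a' • (0 : Γ(X.odd, V))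
    rw [smul_zero, smul_zero, add_zero]

lemma evenAt_algebraEven (h : V ≤ U) (b : B.obj V) (a : Γ(X.even, U)) :
    c.evenAt h b (c.algebraEven U a) = (X.even.res h a, 0) :=
  c.evenAt_ofEvenAdd h b a

noncomputable instance : Module Γ(X.even, U) (c.Even U) :=
  inferInstanceAs (Module Γ(X.even, U) Γ(c.ext.right.even, U))

noncomputable instance : Module Γ(X.even, U) (c.Odd U) :=
  inferInstanceAs (Module Γ(X.even, U) Γ(c.ext.right.odd, U))

lemma evenAt_smul_fst (h : V ≤ U) (b : B.obj V) (a : Γ(X.even, U)) (f : c.Even U) :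
    (c.evenAt h b (a • f)).1 = X.even.res h a * (c.evenAt h b f).1 :=
  (congrArg (fun f => (c.coordEven b f).1) (c.ext.right.even.res_smul h a f)).trans
    (congrArg Prod.fst ((c.coordEven b).map_smul (X.even.res h a) (c.ext.right.even.res h f)))

lemma evenAt_smul_snd (h : V ≤ U) (b : B.obj V) (a : Γ(X.even, U)) (f : c.Even U) :
    (c.evenAt h b (a • f)).2 = X.even.res h a • (c.evenAt h b f).2 :=
  (congrArg (fun f => (c.coordEven b f).2) (c.ext.right.even.res_smul h a f)).trans
    (congrArg Prod.snd ((c.coordEven b).map_smul (X.even.res h a) (c.ext.right.even.res h f)))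

lemma oddAt_smul_fst (h : V ≤ U) (b : B.obj V) (a : Γ(X.even, U)) (x : c.Odd U) :
    (c.oddAt h b (a • x)).1 = X.even.res h a * (c.oddAt h b x).1 :=
  (congrArg (fun f => (c.coordOdd b f).1) (c.ext.right.odd.res_smul h a x)).trans
    (congrArg Prod.fst ((c.coordOdd b).map_smul (X.even.res h a) (c.ext.right.odd.res h x)))

lemma oddAt_smul_snd (h : V ≤ U) (b : B.obj V) (a : Γ(X.even, U)) (x : c.Odd U) :
    (c.oddAt h b (a • x)).2 = X.even.res h a • (c.oddAt h b x).2 :=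
  (congrArg (fun f => (c.coordOdd b f).2) (c.ext.right.odd.res_smul h a x)).trans
    (congrArg Prod.snd ((c.coordOdd b).map_smul (X.even.res h a) (c.ext.right.odd.res h x)))

/-- Multiplication by a function on `X` agrees with the module structure of the extension. -/
lemma algebraEven_mul (a : Γ(X.even, U)) (f : c.Even U) : c.algebraEven U a * f = a • f :=
  even_ext fun V hV b => by
    rw [evenAt_mul, evenAt_algebraEven]
    refine Prod.ext (c.evenAt_smul_fst hV b a f).symm ?_
    rw [evenAt_smul_snd]
    change X.even.res hV a • _ + (c.evenAt hV b f).1 • (0 : Γ(X.odd, V)) = _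
    rw [smul_zero, add_zero]

lemma algebraEven_smul (a : Γ(X.even, U)) (x : c.Odd U) : c.algebraEven U a • x = a • x :=
  odd_ext fun V hV b => by
    rw [oddAt_smul, evenAt_algebraEven]
    refine Prod.ext ?_ (c.oddAt_smul_snd hV b a x).symm
    rw [oddAt_smul_fst]
    change X.even.res hV a * _ - X.mul V 0 (c.oddAt hV b x).2 = _
    rw [map_zero, LinearMap.zero_apply, sub_zero]

/-- Odd functions on `X` as odd sections of the extension. -/
noncomputable def algebraOdd (U : X.even.Opens) : Γ(X.odd, U) →ₗ[Γ(X.even, U)] c.Odd U where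
  toFun s := c.ofOdd U s
  map_add' := map_add (c.ext.hom.odd.app U).hom
  map_smul' a s := Scheme.Modules.Hom.app_smul c.ext.hom.odd a s

lemma oddAt_algebraOdd (h : V ≤ U) (b : B.obj V) (s : Γ(X.odd, U)) :
    c.oddAt h b (c.algebraOdd U s) = (0, X.odd.res h s) := rfl

lemma oddMul_algebraOdd (s : Γ(X.odd, U)) (x : c.Odd U) :
    c.oddMul (c.algebraOdd U s) x = c.ext.right.smulOdd U s x :=
  even_ext fun V hV b => by
    rw [evenAt_oddMul, oddAt_algebraOdd]
    refine Eq.trans ?_ ((congrArg (c.coordEven b) (c.ext.right.res_smulOdd hV s x)).trans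
      (c.coordEven_smulOdd b _ _)).symm
    refine Prod.ext rfl ?_
    change (c.oddAt hV b x).1 • X.odd.res hV s - (0 : Γ(X.even, V)) • (c.oddAt hV b x).2 = _
    rw [zero_smul, sub_zero]
    rfl

lemma smul_algebraOdd (f : c.Even U) (s : Γ(X.odd, U)) :
    f • c.algebraOdd U s = c.ext.right.smulEven U s f :=
  odd_ext fun V hV b => by
    rw [oddAt_smul, oddAt_algebraOdd]
    refine Eq.trans ?_ ((congrArg (c.coordOdd b) (c.ext.right.res_smulEven hV s f)).trans
      (c.coordOdd_smulEven b _ _)).symm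
    refine Prod.ext ?_ rfl
    change (c.evenAt hV b f).1 * 0 - X.mul V (c.evenAt hV b f).2 (X.odd.res hV s) =
      X.mul V (X.odd.res hV s) (c.evenAt hV b f).2
    rw [mul_zero, zero_sub, Superscheme.mul_comm_neg, neg_neg]

lemma algebraEven_mul_odd (s t : Γ(X.odd, U)) :
    c.algebraEven U (X.mul U s t) = c.oddMul (c.algebraOdd U s) (c.algebraOdd U t) :=
  even_ext fun V hV b => by
    rw [evenAt_algebraEven, evenAt_oddMul, oddAt_algebraOdd, oddAt_algebraOdd]
    refine Prod.ext (Superscheme.res_mul hV s t) ?_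
    change 0 = (0 : Γ(X.even, V)) • X.odd.res hV s - (0 : Γ(X.even, V)) • X.odd.res hV t
    rw [zero_smul, zero_smul, sub_zero]

lemma algebraOdd_res (h : V ≤ U) (s : Γ(X.odd, U)) :
    c.algebraOdd V (X.odd.res h s) = c.oddRes h (c.algebraOdd U s) :=
  Scheme.Modules.Hom.app_res c.ext.hom.odd h s

lemma algebraEven_res (h : V ≤ U) (a : Γ(X.even, U)) :
    c.algebraEven V (X.even.res h a) = c.evenRes h (c.algebraEven U a) :=
  Scheme.Modules.Hom.app_res c.ext.hom.even h a

/-- Even sections of the extension as a presheaf of rings. -/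
noncomputable def evenPresheaf : TopCat.Presheaf CommRingCat.{u} X.even where
  obj U := CommRingCat.of (c.Even U.unop)
  map i := CommRingCat.ofHom (c.evenRes i.unop.le)

lemma isSheaf_evenPresheaf : c.evenPresheaf.IsSheaf :=
  (TopCat.Presheaf.isSheaf_iff_isSheaf_comp (CategoryTheory.forget CommRingCat) _).2
    c.extTwist.even.isSheaf

/-- The homomorphism from functions on `X` to even sections of the extension. -/
noncomputable def evenAlgebra : X.even.presheaf ⟶ c.evenPresheaf where
  app U := CommRingCat.ofHom (c.algebraEven U.unop)
  naturality _ _ i := by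
    ext a
    exact c.algebraEven_res i.unop.le a

end AffineCocycle

/-! ### Quasi-coherence of twisted forms of `𝒪[θ]` -/

namespace AlgebraicGeometry.Scheme.Modules

variable {Z : Scheme.{u}} {M N N' : Z.Modules} {U : Z.Opens} {r : Γ(Z, U)}

lemma IsLocalizingAt.of_prod (h : N.IsLocalizingAt U r) (h' : N'.IsLocalizingAt U r)
    (e : Γ(M, U) ≃ₗ[Γ(Z, U)] Γ(N, U) × Γ(N', U))
    (e' : Γ(M, Z.basicOpen r) ≃ₗ[Γ(Z, Z.basicOpen r)]
      Γ(N, Z.basicOpen r) × Γ(N', Z.basicOpen r))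
    (he : ∀ x, e' (M.res (Z.basicOpen_le r) x) =
      (N.res (Z.basicOpen_le r) (e x).1, N'.res (Z.basicOpen_le r) (e x).2)) :
    M.IsLocalizingAt U r where
  exists_pow_smul_eq_zero s hs := by
    have h0 := he s
    rw [hs, map_zero] at h0
    obtain ⟨n, hn⟩ := h.exists_pow_smul_eq_zero _ (congrArg Prod.fst h0).symm
    obtain ⟨n', hn'⟩ := h'.exists_pow_smul_eq_zero _ (congrArg Prod.snd h0).symm
    refine ⟨n' + n, e.injective ?_⟩
    rw [e.map_smul, map_zero]
    refine Prod.ext ?_ ?_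
    · change r ^ (n' + n) • (e s).1 = 0
      rw [pow_add, mul_smul, hn, smul_zero]
    · change r ^ (n' + n) • (e s).2 = 0
      rw [add_comm, pow_add, mul_smul, hn', smul_zero]
  exists_pow_smul t := by
    obtain ⟨n, s, hs⟩ := h.exists_pow_smul (e' t).1
    obtain ⟨n', s', hs'⟩ := h'.exists_pow_smul (e' t).2
    refine ⟨n' + n, e.symm (r ^ n' • s, r ^ n • s'), e'.injective ?_⟩
    rw [he, LinearEquiv.apply_symm_apply, e'.map_smul]
    refine Prod.ext ?_ ?_
    · refine (N.res_smul _ _ _).trans ?_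
      rw [hs, map_pow, smul_smul, ← pow_add]
      rfl
    · refine (N'.res_smul _ _ _).trans ?_
      rw [hs', map_pow, smul_smul, ← pow_add, add_comm]
      rfl

lemma isLocalizingAt_unit (hU : IsAffineOpen U) (r : Γ(Z, U)) :
    IsLocalizingAt (SheafOfModules.unit Z.ringCatSheaf) U r := by
  have := hU.isLocalization_basicOpen r
  have hr : ∀ a : Γ(Z, U), algebraMap Γ(Z, U) Γ(Z, Z.basicOpen r) a = Z.res (Z.basicOpen_le r) a :=
    fun a => rfl
  constructor
  · intro (s : Γ(Z, U)) hs
    obtain ⟨n, hn⟩ := (IsLocalization.Away.exists_of_eq (x := r) (S := Γ(Z, Z.basicOpen r))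
      (a := s) (b := 0) (by rw [hr, map_zero]; exact hs))
    exact ⟨n, hn.trans (mul_zero _)⟩
  · intro (t : Γ(Z, Z.basicOpen r))
    obtain ⟨n, s, hs⟩ := IsLocalization.Away.surj r t
    rw [hr, hr] at hs
    exact ⟨n, s, hs.symm.trans (mul_comm _ _)⟩

end AlgebraicGeometry.Scheme.Modules

namespace AffineCocycle

variable {X : Superscheme.{u}} {B : TrivSystem X.even} (c : AffineCocycle X B)
  {U V : X.even.Opens}

open Superscheme (EvenTheta OddTheta oddThetaMul)

lemma isLocalizingAt_even (hU : IsAffineOpen U) (b : B.obj U) (r : Γ(X.even, U)) :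
    c.ext.right.even.IsLocalizingAt U r :=
  (Scheme.Modules.isLocalizingAt_unit hU r).of_prod
    (X.odd.isLocalizingAt_of_isQuasicoherent X.isQuasicoherent hU r)
    (c.coordEven b) (c.coordEven (B.res (X.even.basicOpen_le r) b))
    (c.extTwist.isLinear_even.coord_res _ b)

lemma isLocalizingAt_odd (hU : IsAffineOpen U) (b : B.obj U) (r : Γ(X.even, U)) :
    c.ext.right.odd.IsLocalizingAt U r :=
  (Scheme.Modules.isLocalizingAt_unit hU r).of_prod
    (X.odd.isLocalizingAt_of_isQuasicoherent X.isQuasicoherent hU r)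
    (c.coordOdd b) (c.coordOdd (B.res (X.even.basicOpen_le r) b))
    (c.extTwist.isLinear_odd.coord_res _ b)

lemma exists_affine_triv (c : AffineCocycle X B) (x : X.even) :
    ∃ U : X.even.Opens, x ∈ U ∧ IsAffineOpen U ∧ Nonempty (B.obj U) := by
  obtain ⟨U, hx, ⟨b⟩⟩ := c.exists_triv x
  obtain ⟨V, hVU, hxV, hV⟩ := Scheme.QuasicoherentAlgebra.exists_affine_le hx
  exact ⟨V, hxV, hV, ⟨B.res hVU b⟩⟩

lemma isQuasicoherent_even : c.ext.right.even.IsQuasicoherent :=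
  Scheme.Modules.isQuasicoherent_of_isLocalizingAt _ fun x => by
    obtain ⟨U, hx, hU, ⟨b⟩⟩ := c.exists_affine_triv x
    exact ⟨U, hx, hU, c.isLocalizingAt_even hU b⟩

/-- The even sections of the extension as a quasi-coherent algebra. -/
noncomputable def algebra : Scheme.QuasicoherentAlgebra X.even where
  presheaf := c.evenPresheaf
  isSheaf := c.isSheaf_evenPresheaf
  algebra := c.evenAlgebra
  coequifibered := by
    refine Scheme.AffineZariskiSite.coequifibered_iff_forall_isLocalizationAway.2 fun U r => ?_
    have h := c.ext.right.even.isLocalizingAt_of_isQuasicoherent c.isQuasicoherent_even U.2 r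
    have hle := X.even.basicOpen_le r
    let : Algebra (c.Even U.1) (c.Even (X.even.basicOpen r)) := (c.evenRes hle).toAlgebra
    have hpow : ∀ (V : X.even.Opens) (a : Γ(X.even, V)) (n : ℕ) (f : c.Even V),
        c.algebraEven V a ^ n * f = a ^ n • f := fun V a n f => by
      rw [← map_pow, algebraEven_mul]
    have hmap : ∀ f : c.Even U.1,
        algebraMap (c.Even U.1) (c.Even (X.even.basicOpen r)) f = c.evenRes hle f := fun _ => rfl
    have key : IsLocalization.Away (c.algebraEven U.1 r) (c.Even (X.even.basicOpen r)) := by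
      refine IsLocalization.Away.mk _ ?_ (fun f => ?_) (fun f g hfg => ?_)
      · rw [hmap, ← algebraEven_res]
        exact (X.even.toRingedSpace.isUnit_res_basicOpen r).map (c.algebraEven _)
      · obtain ⟨n, g, hg⟩ := h.exists_pow_smul f
        refine ⟨n, g, ?_⟩
        rw [hmap, ← algebraEven_res, mul_comm, hpow]
        exact hg.symm
      · rw [hmap, hmap, ← sub_eq_zero, ← map_sub] at hfg
        obtain ⟨n, hn⟩ := h.exists_pow_smul_eq_zero (f - g) hfg
        refine ⟨n, ?_⟩
        rw [← sub_eq_zero, ← mul_sub, hpow]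
        exact hn
    exact key

/-- A local trivialization identifies even sections with the even part of `𝒪[θ]`. -/
noncomputable def evenEquiv (b : B.obj U) : c.Even U ≃+* EvenTheta X U where
  toFun f := c.evenAt le_rfl b f
  invFun p := (c.coordEven b).symm p
  left_inv f := ((c.coordEven b).symm_apply_apply _).trans (c.ext.right.even.res_self _ f)
  right_inv p := (congrArg (c.coordEven b) (c.ext.right.even.res_self _ _)).trans
    ((c.coordEven b).apply_symm_apply p)
  map_mul' f g := c.evenAt_mul le_rfl b f g
  map_add' f g := c.evenAt_add le_rfl b f g

lemma evenEquiv_algebraEven (b : B.obj U) (a : Γ(X.even, U)) :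
    c.evenEquiv b (c.algebraEven U a) = (a, 0) :=
  (c.evenAt_algebraEven le_rfl b a).trans (Prod.ext (X.even.res_self _ a) rfl)

end AffineCocycle

namespace Superscheme.EvenTheta

variable {X : Superscheme.{u}} {U : X.even.Opens}

variable (X U) in
/-- Setting `θ = 0`. -/
noncomputable def retraction : EvenTheta X U →+* Γ(X.even, U) where
  toFun p := p.1
  map_one' := rfl
  map_mul' _ _ := rfl
  map_zero' := rfl
  map_add' _ _ := rfl

lemma pow_two_eq_zero_of_retraction {p : EvenTheta X U} (hp : retraction X U p = 0) :
    p ^ 2 = 0 := by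
  have h : p.1 = 0 := hp
  rw [pow_two]
  refine Prod.ext ?_ ?_
  · change p.1 * p.1 = 0
    rw [h, mul_zero]
  · change p.1 • p.2 + p.1 • p.2 = 0
    rw [h, zero_smul, zero_add]

end Superscheme.EvenTheta

namespace AffineCocycle

variable {X : Superscheme.{u}} {B : TrivSystem X.even} (c : AffineCocycle X B)
  {U V : X.even.Opens}

lemma isHomeomorph_restrictPreimage_proj (hU : IsAffineOpen U) (b : B.obj U) :
    IsHomeomorph ((U : Set X.even).restrictPreimage c.algebra.proj) := by
  refine c.algebra.isHomeomorph_restrictPreimage_proj hU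
    ((Superscheme.EvenTheta.retraction X U).comp (c.evenEquiv b).toRingHom)
    (fun a => congrArg Prod.fst (c.evenEquiv_algebraEven b a)) fun f hf => ⟨2, ?_⟩
  apply (c.evenEquiv b).injective
  refine (map_pow (c.evenEquiv b) (show c.Even U from f) 2).trans ?_
  exact (Superscheme.EvenTheta.pow_two_eq_zero_of_retraction hf).trans
    (map_zero (c.evenEquiv b)).symm

lemma isHomeomorph_proj : IsHomeomorph c.algebra.proj := by
  choose U hx hU b using c.exists_affine_triv
  have hcov : IsOpenCover U := IsOpenCover.mk
    (eq_top_iff.2 fun x _ => Opens.mem_iSup.2 ⟨x, hx x⟩)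
  rw [hcov.isHomeomorph_iff_restrictPreimage c.algebra.proj.continuous]
  exact fun x => c.isHomeomorph_restrictPreimage_proj (hU x) (b x).some

end AffineCocycle

/-! ### The fibration with a given sheaf of functions -/

namespace AlgebraicGeometry.Scheme.Hom

variable {Y Z : Scheme.{u}} (p : Y ⟶ Z) (hp : IsHomeomorph p)

/-- The continuous inverse of a morphism of schemes that is a homeomorphism. -/
noncomputable def invBase : Z.toTopCat ⟶ Y.toTopCat :=
  TopCat.ofHom ⟨(hp.homeomorph _).symm, (hp.homeomorph _).symm.continuous⟩

lemma apply_invBase (z : Z) : p (p.invBase hp z) = z :=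
  (hp.homeomorph _).apply_symm_apply z

lemma invBase_apply (y : Y) : p.invBase hp (p y) = y :=
  (hp.homeomorph _).symm_apply_apply y

lemma preimage_map_invBase (W : Y.Opens) : p ⁻¹ᵁ (Opens.map (p.invBase hp)).obj W = W := by
  ext y
  exact iff_of_eq (congrArg (· ∈ W) (p.invBase_apply hp y))

lemma map_invBase_preimage (U : Z.Opens) : (Opens.map (p.invBase hp)).obj (p ⁻¹ᵁ U) = U := by
  ext z
  exact iff_of_eq (congrArg (· ∈ U) (p.apply_invBase hp z))

end AlgebraicGeometry.Scheme.Hom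

namespace AffineCocycle

variable {X : Superscheme.{u}} {B : TrivSystem X.even} (c : AffineCocycle X B)

/-- The inverse of the homeomorphism from the spectrum of even sections to the base. -/
noncomputable def projInv : X.even.toTopCat ⟶ c.algebra.spec.toTopCat :=
  c.algebra.proj.invBase c.isHomeomorph_proj

/-- The open subset of the base corresponding to an open subset of the spectrum. -/
noncomputable def baseOpen (W : c.algebra.spec.Opens) : X.even.Opens :=
  (Opens.map c.projInv).obj W

variable {c}

lemma baseOpen_mono {W W' : c.algebra.spec.Opens} (h : W' ≤ W) : c.baseOpen W' ≤ c.baseOpen W :=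
  fun _ hx => h hx

variable (c)

lemma proj_preimage_baseOpen (W : c.algebra.spec.Opens) :
    c.algebra.proj ⁻¹ᵁ c.baseOpen W = W :=
  c.algebra.proj.preimage_map_invBase c.isHomeomorph_proj W

lemma baseOpen_proj_preimage (U : X.even.Opens) :
    c.baseOpen (c.algebra.proj ⁻¹ᵁ U) = U :=
  c.algebra.proj.map_invBase_preimage c.isHomeomorph_proj U

/-- Functions on the spectrum of the algebra of even sections are even sections. -/
noncomputable def specEquiv (U : X.even.Opens) :
    Γ(c.algebra.spec, c.algebra.proj ⁻¹ᵁ U) ≃+* c.Even U :=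
  c.algebra.sectionsEquiv U

variable {c} in
lemma specEquiv_res {U V : X.even.Opens} (h : V ≤ U)
    (s : Γ(c.algebra.spec, c.algebra.proj ⁻¹ᵁ U)) :
    c.specEquiv V (c.algebra.spec.res (c.algebra.proj.preimage_mono h) s) =
      c.evenRes h (c.specEquiv U s) :=
  c.algebra.sectionsEquiv_res h s

lemma specEquiv_app {U : X.even.Opens} (a : Γ(X.even, U)) :
    c.specEquiv U (c.algebra.proj.app U a) = c.algebraEven U a :=
  c.algebra.sectionsEquiv_app a

/-- Functions on an open subset of the spectrum, as even sections of the extension. -/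
noncomputable def funEquiv (W : c.algebra.spec.Opens) :
    Γ(c.algebra.spec, W) ≃+* c.Even (c.baseOpen W) where
  toFun s := c.specEquiv _ (c.algebra.spec.res (c.proj_preimage_baseOpen W).le s)
  invFun f := c.algebra.spec.res (c.proj_preimage_baseOpen W).ge ((c.specEquiv _).symm f)
  left_inv s := by
    dsimp only
    rw [RingEquiv.symm_apply_apply, Scheme.res_res, Scheme.res_self]
  right_inv f := by
    dsimp only
    rw [Scheme.res_res, Scheme.res_self, RingEquiv.apply_symm_apply]
  map_mul' s t := by rw [map_mul, map_mul]
  map_add' s t := by rw [map_add, map_add]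

variable {c} in
lemma funEquiv_res {W W' : c.algebra.spec.Opens} (h : W' ≤ W) (s : Γ(c.algebra.spec, W)) :
    c.funEquiv W' (c.algebra.spec.res h s) = c.evenRes (baseOpen_mono h) (c.funEquiv W s) := by
  change c.specEquiv _ _ = c.evenRes _ (c.specEquiv _ _)
  rw [← specEquiv_res, Scheme.res_res, Scheme.res_res]

lemma funEquiv_preimage (U : X.even.Opens) (s : Γ(c.algebra.spec, c.algebra.proj ⁻¹ᵁ U)) :
    c.funEquiv (c.algebra.proj ⁻¹ᵁ U) s =
      c.evenRes (c.baseOpen_proj_preimage U).le (c.specEquiv U s) := by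
  rw [← specEquiv_res]
  rfl

noncomputable instance (W : c.algebra.spec.Opens) :
    Module Γ(c.algebra.spec, W) (c.Odd (c.baseOpen W)) :=
  Module.compHom _ (c.funEquiv W).toRingHom

variable {c} in
lemma funEquiv_smul {W : c.algebra.spec.Opens} (s : Γ(c.algebra.spec, W))
    (x : c.Odd (c.baseOpen W)) : s • x = c.funEquiv W s • x := rfl

/-- The odd functions on the total space: over an open set they are the odd sections of the
extension over the corresponding open subset of the base. -/
noncomputable def totalOdd : c.algebra.spec.Modules :=
  letI (W : c.algebra.spec.Opens) : Module Γ(c.algebra.spec, W)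
      (((TopCat.Presheaf.pushforward Ab c.projInv).obj c.ext.right.odd.presheaf).obj (op W)) :=
    inferInstanceAs (Module Γ(c.algebra.spec, W) (c.Odd (c.baseOpen W)))
  Scheme.Modules.ofPresheaf
    ((TopCat.Presheaf.pushforward Ab c.projInv).obj c.ext.right.odd.presheaf)
    ((TopCat.Sheaf.pushforward Ab c.projInv).obj
      ⟨c.ext.right.odd.presheaf, c.ext.right.odd.isSheaf⟩).2
    (fun {W _} i s (x : c.Odd (c.baseOpen W)) =>
      (c.oddRes_smul (baseOpen_mono i.le) (c.funEquiv W s) x).trans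
        (congrArg (· • c.oddRes (baseOpen_mono i.le) x) (funEquiv_res i.le s).symm))

/-- The product of two odd functions, on the level of odd sections of the extension. -/
noncomputable def oddMulLinear (W : c.algebra.spec.Opens) :
    c.Odd (c.baseOpen W) →ₗ[Γ(c.algebra.spec, W)] c.Odd (c.baseOpen W) →ₗ[Γ(c.algebra.spec, W)]
      Γ(c.algebra.spec, W) :=
  LinearMap.mk₂ _ (fun x y => (c.funEquiv W).symm (c.oddMul x y))
    (fun x x' y => by rw [oddMul_add_left, map_add])
    (fun s x y => by
      rw [funEquiv_smul, oddMul_smul_left, map_mul, RingEquiv.symm_apply_apply, smul_eq_mul])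
    (fun x y y' => by rw [oddMul_add_right, map_add])
    (fun s x y => by
      rw [funEquiv_smul, oddMul_smul_right, map_mul, RingEquiv.symm_apply_apply, smul_eq_mul])

/-- The product of two odd functions. -/
noncomputable def totalMul (W : c.algebra.spec.Opens) :
    Γ(c.totalOdd, W) →ₗ[Γ(c.algebra.spec, W)] Γ(c.totalOdd, W) →ₗ[Γ(c.algebra.spec, W)]
      Γ(c.algebra.spec, W) :=
  c.oddMulLinear W

lemma funEquiv_totalMul {W : c.algebra.spec.Opens} (x y : c.Odd (c.baseOpen W)) :
    c.funEquiv W (c.totalMul W x y) = c.oddMul x y :=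
  (c.funEquiv W).apply_symm_apply _

/-- With `f = a + α θ`, one has `f² = a (a + 2 α θ)` and `a² = f (a - α θ)`. -/
lemma exists_sq_eq {U : X.even.Opens} (b : B.obj U) (F : c.Even U) :
    ∃ (a : Γ(X.even, U)) (G G' : c.Even U),
      F ^ 2 = c.algebraEven U a * G ∧ c.algebraEven U a ^ 2 = F * G' := by
  obtain ⟨p, rfl⟩ := (c.evenEquiv b).symm.surjective F
  let q : Superscheme.EvenTheta X U := (p.1, p.2 + p.2)
  let q' : Superscheme.EvenTheta X U := (p.1, -p.2)
  let r : Superscheme.EvenTheta X U := (p.1, 0)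
  have hr : c.evenEquiv b (c.algebraEven U p.1) = r := c.evenEquiv_algebraEven b p.1
  refine ⟨p.1, (c.evenEquiv b).symm q, (c.evenEquiv b).symm q', ?_, ?_⟩
  all_goals
    apply (c.evenEquiv b).injective
    simp only [map_mul, map_pow, RingEquiv.apply_symm_apply, hr]
    rw [pow_two]
  · refine Prod.ext rfl ?_
    change p.1 • p.2 + p.1 • p.2 = p.1 • (p.2 + p.2) + p.1 • (0 : Γ(X.odd, U))
    module
  · refine Prod.ext rfl ?_
    change p.1 • (0 : Γ(X.odd, U)) + p.1 • (0 : Γ(X.odd, U)) = p.1 • (-p.2) + p.1 • p.2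
    module

lemma isLocalizingAt_totalOdd_of {W : c.algebra.spec.Opens} {f : Γ(c.algebra.spec, W)}
    (hle : c.baseOpen (c.algebra.spec.basicOpen f) ≤ c.baseOpen W)
    (h₁ : ∀ s : c.Odd (c.baseOpen W), c.oddRes hle s = 0 → ∃ n : ℕ, c.funEquiv W f ^ n • s = 0)
    (h₂ : ∀ t : c.Odd (c.baseOpen (c.algebra.spec.basicOpen f)), ∃ (n : ℕ)
      (s : c.Odd (c.baseOpen W)), c.oddRes hle s = c.evenRes hle (c.funEquiv W f ^ n) • t) :
    c.totalOdd.IsLocalizingAt W f where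
  exists_pow_smul_eq_zero s hs := by
    obtain ⟨n, hn⟩ := h₁ s hs
    exact ⟨n, (congrArg (· • (show c.Odd (c.baseOpen W) from s)) (map_pow _ f n)).trans hn⟩
  exists_pow_smul t := by
    obtain ⟨n, s, hs⟩ := h₂ t
    refine ⟨n, s, hs.trans (congrArg (· • (show c.Odd (c.baseOpen _) from t)) ?_)⟩
    rw [← map_pow, ← map_pow]
    exact (funEquiv_res _ _).symm

/-- A function `f` on the spectrum has the same non-vanishing locus as its even part `a`, and `f²`
is a multiple of `a`, so odd functions localize as on the base. -/
lemma isLocalizingAt_totalOdd {U : X.even.Opens} (hU : IsAffineOpen U) (b : B.obj U)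
    (f : Γ(c.algebra.spec, c.algebra.proj ⁻¹ᵁ U)) :
    c.totalOdd.IsLocalizingAt (c.algebra.proj ⁻¹ᵁ U) f := by
  obtain ⟨a, G, G', hG, hG'⟩ := c.exists_sq_eq b (c.specEquiv U f)
  have hW : c.baseOpen (c.algebra.proj ⁻¹ᵁ U) = U := c.baseOpen_proj_preimage U
  -- Each of `f` and `a` divides the square of the other.
  have hD : c.algebra.spec.basicOpen f = c.algebra.proj ⁻¹ᵁ X.even.basicOpen a := by
    have h₁ : f ^ 2 = c.algebra.proj.app U a * (c.specEquiv U).symm G := by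
      apply (c.specEquiv U).injective
      rw [map_pow, map_mul, specEquiv_app, RingEquiv.apply_symm_apply, hG]
    have h₂ : c.algebra.proj.app U a ^ 2 = f * (c.specEquiv U).symm G' := by
      apply (c.specEquiv U).injective
      rw [map_pow, map_mul, specEquiv_app, RingEquiv.apply_symm_apply, hG']
    rw [Scheme.preimage_basicOpen]
    apply le_antisymm
    · rw [← Scheme.basicOpen_pow _ f (n := 2) two_pos, h₁, Scheme.basicOpen_mul]
      exact inf_le_left
    · rw [← Scheme.basicOpen_pow _ _ (n := 2) two_pos, h₂, Scheme.basicOpen_mul]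
      exact inf_le_left
  have hDV : c.baseOpen (c.algebra.spec.basicOpen f) = X.even.basicOpen a := by
    rw [hD, baseOpen_proj_preimage]
  have hle := baseOpen_mono (c.algebra.spec.basicOpen_le f)
  obtain ⟨h₁, h₂⟩ := (Scheme.Modules.isLocalizingAt_iff _ hW hDV hle).1
    (c.isLocalizingAt_odd hU b a)
  have hF (n : ℕ) : c.funEquiv _ f ^ (2 * n) =
      c.evenRes hW.le G ^ n * c.algebraEven _ (X.even.res hW.le a ^ n) := by
    rw [c.funEquiv_preimage U f, pow_mul, ← map_pow _ _ 2, hG, map_mul, mul_pow, mul_comm,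
      map_pow (c.algebraEven _), algebraEven_res]
  refine c.isLocalizingAt_totalOdd_of hle (fun s hs => ?_) (fun t => ?_)
  · obtain ⟨n, hn⟩ := h₁ s hs
    refine ⟨2 * n, ?_⟩
    rw [hF, mul_smul, algebraEven_smul]
    exact (congrArg _ hn).trans (smul_zero (A := c.Odd _) _)
  · obtain ⟨n, s, hs⟩ : ∃ (n : ℕ) (s : c.Odd (c.baseOpen (c.algebra.proj ⁻¹ᵁ U))),
        c.oddRes hle s = X.even.res hle (X.even.res hW.le a ^ n) • t := by
      obtain ⟨n, s, hs⟩ := h₂ t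
      exact ⟨n, s, hs.trans (congrArg (· • t) (by rw [map_pow, Scheme.res_res]))⟩
    refine ⟨2 * n, c.evenRes hW.le G ^ n • s, ?_⟩
    rw [hF, map_mul, oddRes_smul, mul_smul, ← algebraEven_res, algebraEven_smul, hs]

lemma isQuasicoherent_totalOdd : c.totalOdd.IsQuasicoherent := by
  refine Scheme.Modules.isQuasicoherent_of_isLocalizingAt _ fun y => ?_
  obtain ⟨U, hxU, hU, ⟨b⟩⟩ := c.exists_affine_triv (c.algebra.proj y)
  refine ⟨c.algebra.proj ⁻¹ᵁ U, hxU, ?_, c.isLocalizingAt_totalOdd hU b⟩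
  rw [c.algebra.proj_preimage hU]
  exact isAffineOpen_opensRange _

/-- The total space of the fibration defined by an affine cocycle: the relative spectrum of the even
sections of the extension, with the odd sections as odd functions. -/
noncomputable def totalSpace : Superscheme.{u} where
  even := c.algebra.spec
  odd := c.totalOdd
  isQuasicoherent := c.isQuasicoherent_totalOdd
  mul := c.totalMul
  mul_self {W} (s : c.Odd (c.baseOpen W)) :=
    (congrArg (c.funEquiv W).symm (c.oddMul_self s)).trans (map_zero _)
  mul_assoc {W} (s t r : c.Odd (c.baseOpen W)) := by
    refine (congrArg (· • r) (c.funEquiv_totalMul s t)).trans ?_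
    refine Eq.trans ?_ (congrArg (· • s) (c.funEquiv_totalMul t r)).symm
    exact c.oddMul_smul_assoc s t r
  map_mul {W W'} i (s t : c.Odd (c.baseOpen W)) := by
    apply (c.funEquiv W').injective
    refine (funEquiv_res i.le _).trans ?_
    refine (congrArg (c.evenRes _) (c.funEquiv_totalMul s t)).trans ?_
    refine (c.evenRes_oddMul _ s t).trans ?_
    exact (c.funEquiv_totalMul (c.oddRes (baseOpen_mono i.le) s)
      (c.oddRes (baseOpen_mono i.le) t)).symm

/-- The odd functions on the base, as odd functions on the fibration. -/
noncomputable def projOdd (U : X.even.Opens) (s : Γ(X.odd, U)) :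
    c.Odd (c.baseOpen (c.algebra.proj ⁻¹ᵁ U)) :=
  c.oddRes (c.baseOpen_proj_preimage U).le (c.algebraOdd U s)

lemma funEquiv_app {U : X.even.Opens} (a : Γ(X.even, U)) :
    c.funEquiv _ (c.algebra.proj.app U a) =
      c.evenRes (c.baseOpen_proj_preimage U).le (c.algebraEven U a) := by
  rw [funEquiv_preimage, specEquiv_app]

lemma projOdd_smul {U : X.even.Opens} (a : Γ(X.even, U)) (s : Γ(X.odd, U)) :
    c.projOdd U (a • s) = c.algebra.proj.app U a • c.projOdd U s := by
  rw [funEquiv_smul, funEquiv_app, projOdd, map_smul, ← algebraEven_smul, oddRes_smul]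
  rfl

lemma oddRes_oddRes {U V W : X.even.Opens} (h : V ≤ U) (h' : W ≤ V) (x : c.Odd U) :
    c.oddRes h' (c.oddRes h x) = c.oddRes (h'.trans h) x :=
  c.ext.right.odd.res_res h h' x

lemma projOdd_res {U V : X.even.Opens} (h : V ≤ U) (s : Γ(X.odd, U)) :
    c.projOdd V (X.odd.res h s) =
      c.oddRes (baseOpen_mono (c.algebra.proj.preimage_mono h)) (c.projOdd U s) := by
  rw [projOdd, algebraOdd_res, projOdd, oddRes_oddRes, oddRes_oddRes]

lemma projOdd_add {U : X.even.Opens} (s t : Γ(X.odd, U)) :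
    c.projOdd U (s + t) = c.projOdd U s + c.projOdd U t := by
  rw [projOdd, map_add, map_add]
  rfl

/-- The homomorphism from odd functions on the base to odd functions on the fibration. -/
noncomputable def projOddHom :
    X.odd ⟶ (Scheme.Modules.pushforward c.algebra.proj).obj c.totalOdd :=
  Scheme.Modules.homMk
    (fun U => LinearMap.mk
      (M₂ := Γ((Scheme.Modules.pushforward c.algebra.proj).obj c.totalOdd, U))
      ⟨c.projOdd U, c.projOdd_add⟩ c.projOdd_smul)
    c.projOdd_res

/-- The projection of the fibration. -/
noncomputable def totalProj : c.totalSpace ⟶ X :=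
  Superscheme.Hom.mk (X := c.totalSpace) (Y := X) c.algebra.proj c.projOddHom
    (fun {U} s t => by
      apply (c.funEquiv _).injective
      refine (c.funEquiv_app _).trans ?_
      refine Eq.trans ?_ (c.funEquiv_totalMul (c.projOdd U s) (c.projOdd U t)).symm
      rw [algebraEven_mul_odd, evenRes_oddMul]
      rfl)

end AffineCocycle

namespace SuperModule

variable {X : Superscheme.{u}} {M N : SuperModule X}

/-- A homomorphism that is bijective on sections is an isomorphism. -/
lemma isIso_of_bijective (φ : M ⟶ N) (h : ∀ U, Function.Bijective (φ.even.app U))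
    (h' : ∀ U, Function.Bijective (φ.odd.app U)) : IsIso φ := by
  let e (U : X.even.Opens) : Γ(M.even, U) ≃ₗ[Γ(X.even, U)] Γ(N.even, U) :=
    LinearEquiv.ofBijective
      { toFun := φ.even.app U
        map_add' := map_add _
        map_smul' := φ.even.app_smul } (h U)
  let e' (U : X.even.Opens) : Γ(M.odd, U) ≃ₗ[Γ(X.even, U)] Γ(N.odd, U) :=
    LinearEquiv.ofBijective
      { toFun := φ.odd.app U
        map_add' := map_add _
        map_smul' := φ.odd.app_smul } (h' U)
  let ψ : N ⟶ M :=
    { even := Scheme.Modules.homMk (fun U => (e U).symm) fun {U V} i x => by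
        apply (e V).injective
        refine ((e V).apply_symm_apply _).trans ?_
        refine Eq.trans ?_ (φ.even.app_res i ((e U).symm x)).symm
        exact congrArg (N.even.res i) ((e U).apply_symm_apply x).symm
      odd := Scheme.Modules.homMk (fun U => (e' U).symm) fun {U V} i x => by
        apply (e' V).injective
        refine ((e' V).apply_symm_apply _).trans ?_
        refine Eq.trans ?_ (φ.odd.app_res i ((e' U).symm x)).symm
        exact congrArg (N.odd.res i) ((e' U).apply_symm_apply x).symm
      app_smulEven := fun {U} s x => by
        apply (e' U).injective
        refine ((e' U).apply_symm_apply _).trans ?_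
        refine Eq.trans ?_ (φ.app_smulEven s ((e U).symm x)).symm
        exact congrArg (N.smulEven U s) ((e U).apply_symm_apply x).symm
      app_smulOdd := fun {U} s x => by
        apply (e U).injective
        refine ((e U).apply_symm_apply _).trans ?_
        refine Eq.trans ?_ (φ.app_smulOdd s ((e' U).symm x)).symm
        exact congrArg (N.smulOdd U s) ((e' U).apply_symm_apply x).symm }
  exact ⟨ψ, hom_ext (fun U x => (e U).symm_apply_apply x) fun U x => (e' U).symm_apply_apply x,
    hom_ext (fun U x => (e U).apply_symm_apply x) fun U x => (e' U).apply_symm_apply x⟩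

end SuperModule

namespace SuperExtension

variable {X Y : Superscheme.{u}}

lemma isFrame_toPushforward_iff (f : Y ⟶ X) {U : X.even.Opens} (θ : Γ(Y.odd, f.even ⁻¹ᵁ U)) :
    IsFrame (Under.mk (toPushforward f)) U θ ↔
      (pushforward f (structureSheaf Y)).IsBasis U
        (fun _ : Fin 1 => (1 : Γ(Y.even, f.even ⁻¹ᵁ U))) (fun _ : Fin 1 => θ) := by
  have h : one (Under.mk (toPushforward f)) U = (1 : Γ(Y.even, f.even ⁻¹ᵁ U)) :=
    map_one (f.even.app U).hom
  exact iff_of_eq (congrArg (fun a => (pushforward f (structureSheaf Y)).IsBasis U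
    (fun _ : Fin 1 => a) (fun _ : Fin 1 => θ)) h)

end SuperExtension

namespace AffineCocycle

variable {X : Superscheme.{u}} {B : TrivSystem X.even} (c : AffineCocycle X B)

/-- Odd sections of the extension, as odd functions on the fibration. -/
noncomputable def totalOddRes (U : X.even.Opens) (x : c.Odd U) :
    c.Odd (c.baseOpen (c.algebra.proj ⁻¹ᵁ U)) :=
  c.oddRes (c.baseOpen_proj_preimage U).le x

lemma bijective_totalOddRes (U : X.even.Opens) : Function.Bijective (c.totalOddRes U) := by
  refine Function.bijective_iff_has_inverse.2 ⟨c.oddRes (c.baseOpen_proj_preimage U).ge,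
    fun x => ?_, fun x => ?_⟩
  · exact (c.oddRes_oddRes _ _ x).trans (c.ext.right.odd.res_self _ x)
  · exact (c.oddRes_oddRes _ _ x).trans (c.ext.right.odd.res_self _ x)

lemma totalOddRes_smul {U : X.even.Opens} (f : c.Even U) (x : c.Odd U) :
    c.totalOddRes U (f • x) = (c.specEquiv U).symm f • c.totalOddRes U x := by
  rw [funEquiv_smul, funEquiv_preimage, RingEquiv.apply_symm_apply, totalOddRes, oddRes_smul]
  rfl

lemma specEquiv_symm_oddMul {U : X.even.Opens} (x y : c.Odd U) :
    (c.specEquiv U).symm (c.oddMul x y) =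
      c.totalMul _ (c.totalOddRes U x) (c.totalOddRes U y) := by
  apply (c.funEquiv _).injective
  refine Eq.trans ?_ (c.funEquiv_totalMul _ _).symm
  rw [funEquiv_preimage, RingEquiv.apply_symm_apply, evenRes_oddMul]
  rfl

lemma totalOddRes_res {U V : X.even.Opens} (h : V ≤ U) (x : c.Odd U) :
    c.totalOddRes V (c.oddRes h x) =
      c.oddRes (baseOpen_mono (c.algebra.proj.preimage_mono h)) (c.totalOddRes U x) := by
  rw [totalOddRes, totalOddRes, oddRes_oddRes, oddRes_oddRes]

lemma specEquiv_symm_res {U V : X.even.Opens} (h : V ≤ U) (f : c.Even U) :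
    (c.specEquiv V).symm (c.evenRes h f) =
      c.algebra.spec.res (c.algebra.proj.preimage_mono h) ((c.specEquiv U).symm f) := by
  apply (c.specEquiv V).injective
  rw [specEquiv_res, RingEquiv.apply_symm_apply, RingEquiv.apply_symm_apply]

lemma specEquiv_symm_smul {U : X.even.Opens} (a : Γ(X.even, U)) (f : c.Even U) :
    (c.specEquiv U).symm (a • f) = c.algebra.proj.app U a * (c.specEquiv U).symm f := by
  rw [← algebraEven_mul, map_mul, ← specEquiv_app, RingEquiv.symm_apply_apply]

lemma totalOddRes_smul_base {U : X.even.Opens} (a : Γ(X.even, U)) (x : c.Odd U) :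
    c.totalOddRes U (a • x) = c.algebra.proj.app U a • c.totalOddRes U x := by
  rw [← algebraEven_smul, totalOddRes_smul, ← specEquiv_app, RingEquiv.symm_apply_apply]

/-- The homomorphism from sections of the extension to functions on the total space. -/
noncomputable def toDirectImage :
    c.ext.right ⟶ pushforward c.totalProj (structureSheaf c.totalSpace) where
  even := Scheme.Modules.homMk
    (fun U => LinearMap.mk
      (M₂ := Γ((pushforward c.totalProj (structureSheaf c.totalSpace)).even, U))
      ⟨(c.specEquiv U).symm, map_add (c.specEquiv U).symm⟩ c.specEquiv_symm_smul)
    c.specEquiv_symm_res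
  odd := Scheme.Modules.homMk
    (fun U => LinearMap.mk
      (M₂ := Γ((pushforward c.totalProj (structureSheaf c.totalSpace)).odd, U))
      ⟨c.totalOddRes U, map_add (c.oddRes _)⟩ c.totalOddRes_smul_base)
    c.totalOddRes_res
  app_smulEven {U} s f :=
    (congrArg (c.totalOddRes U) (c.smul_algebraOdd f s).symm).trans
      (c.totalOddRes_smul f (c.algebraOdd U s))
  app_smulOdd {U} s x :=
    (congrArg (c.specEquiv U).symm (c.oddMul_algebraOdd s x).symm).trans
      (c.specEquiv_symm_oddMul (c.algebraOdd U s) x)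

instance : IsIso c.toDirectImage :=
  isIso_of_bijective _ (fun U => (c.specEquiv U).symm.bijective) c.bijective_totalOddRes

/-- The extension is the direct image of the functions on the fibration. -/
noncomputable def extIsoDirectImage : c.ext ≅ Under.mk (toPushforward c.totalProj) :=
  Under.isoMk (asIso c.toDirectImage) (hom_ext
    (fun U a => ((c.specEquiv U).symm_apply_eq).2 (c.specEquiv_app a).symm)
    (fun _ _ => rfl))

lemma isA01Fibration_totalProj : IsA01Fibration c.totalProj := fun x => by
  obtain ⟨U, hx, hU, ⟨b⟩⟩ := c.exists_affine_triv x
  exact ⟨U, hx, c.isHomeomorph_restrictPreimage_proj hU b, _,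
    (SuperExtension.isFrame_toPushforward_iff _ _).1
      ((c.isFrame_frame b).app c.extIsoDirectImage)⟩

end AffineCocycle

/-! ### Homomorphisms of direct images -/

namespace Superscheme

variable {X Y : Superscheme.{u}} (f : Y ⟶ X) {U V : X.even.Opens}

/-- Pull-back of odd functions. -/
noncomputable def pullOdd (U : X.even.Opens) : Γ(X.odd, U) →+ Γ(Y.odd, f.even ⁻¹ᵁ U) :=
  (f.odd.app U).hom

/-- The even function `a + α θ` on `Y`, for an odd function `θ`. -/
noncomputable def evalEven (θ : Γ(Y.odd, f.even ⁻¹ᵁ U)) (p : EvenTheta X U) :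
    Γ(Y.even, f.even ⁻¹ᵁ U) :=
  f.even.app U p.1 + Y.mul _ (pullOdd f U p.2) θ

/-- The odd function `b θ + β` on `Y`, for an odd function `θ`. -/
noncomputable def evalOdd (θ : Γ(Y.odd, f.even ⁻¹ᵁ U)) (x : OddTheta X U) :
    Γ(Y.odd, f.even ⁻¹ᵁ U) :=
  f.even.app U x.1 • θ + pullOdd f U x.2

variable {f}

lemma pullOdd_smul (a : Γ(X.even, U)) (s : Γ(X.odd, U)) :
    pullOdd f U (a • s) = f.even.app U a • pullOdd f U s :=
  f.odd.app_smul a s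

lemma app_mul_eq (s t : Γ(X.odd, U)) :
    f.even.app U (X.mul U s t) = Y.mul _ (pullOdd f U s) (pullOdd f U t) :=
  f.app_mul s t

/-- `α θ ⋅ β θ = 0`. -/
lemma mul_mul_mul_self (s t θ : Γ(X.odd, U)) : X.mul U s θ * X.mul U t θ = 0 := by
  rw [_root_.mul_comm, ← smul_eq_mul, ← _root_.map_smul, X.mul_assoc, X.mul_self, zero_smul,
    map_zero]

lemma evalEven_mul (θ : Γ(Y.odd, f.even ⁻¹ᵁ U)) (p q : EvenTheta X U) :
    evalEven f θ (p * q) = evalEven f θ p * evalEven f θ q := by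
  change f.even.app U (p.1 * q.1) + Y.mul _ (pullOdd f U (p.1 • q.2 + q.1 • p.2)) θ =
    (f.even.app U p.1 + Y.mul _ (pullOdd f U p.2) θ) *
      (f.even.app U q.1 + Y.mul _ (pullOdd f U q.2) θ)
  have h := mul_mul_mul_self (pullOdd f U p.2) (pullOdd f U q.2) θ
  rw [_root_.map_mul, map_add, pullOdd_smul, pullOdd_smul]
  simp only [map_add, _root_.map_smul, LinearMap.add_apply, LinearMap.smul_apply, smul_eq_mul]
  linear_combination -h

lemma evalOdd_smul (θ : Γ(Y.odd, f.even ⁻¹ᵁ U)) (p : EvenTheta X U) (x : OddTheta X U) :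
    evalOdd f θ (p • x) = evalEven f θ p • evalOdd f θ x := by
  change f.even.app U (p.1 * x.1 - X.mul U p.2 x.2) • θ + pullOdd f U (p.1 • x.2) =
    (f.even.app U p.1 + Y.mul _ (pullOdd f U p.2) θ) •
      (f.even.app U x.1 • θ + pullOdd f U x.2)
  have h₁ : Y.mul _ (pullOdd f U p.2) θ • θ = 0 := by
    rw [Y.mul_assoc, Y.mul_self, zero_smul]
  have h₂ : Y.mul _ (pullOdd f U p.2) θ • pullOdd f U x.2 =
      - Y.mul _ (pullOdd f U p.2) (pullOdd f U x.2) • θ := by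
    rw [neg_smul, Y.mul_assoc _ θ, Y.mul_assoc _ _ θ, mul_comm_neg θ, neg_smul]
  rw [map_sub, _root_.map_mul, app_mul_eq, pullOdd_smul, add_smul, smul_add (Y.mul _ _ _), h₂,
    smul_comm (Y.mul _ _ _), h₁]
  module

lemma evalEven_oddThetaMul (θ : Γ(Y.odd, f.even ⁻¹ᵁ U)) (x y : OddTheta X U) :
    evalEven f θ (oddThetaMul x y) = Y.mul _ (evalOdd f θ x) (evalOdd f θ y) := by
  change f.even.app U (X.mul U x.2 y.2) + Y.mul _ (pullOdd f U (y.1 • x.2 - x.1 • y.2)) θ =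
    Y.mul _ (f.even.app U x.1 • θ + pullOdd f U x.2) (f.even.app U y.1 • θ + pullOdd f U y.2)
  rw [app_mul_eq, map_sub, pullOdd_smul, pullOdd_smul]
  simp only [map_add, map_sub, _root_.map_smul, LinearMap.add_apply, LinearMap.sub_apply,
    LinearMap.smul_apply, smul_eq_mul, Y.mul_self]
  rw [mul_comm_neg θ]
  ring

end Superscheme

namespace SuperExtension

variable {X Y Z : Superscheme.{u}} {f : Y ⟶ X} {f' : Z ⟶ X} {U V : X.even.Opens}

open Superscheme (EvenTheta OddTheta evalEven evalOdd pullOdd evalEven_mul evalOdd_smul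
  evalEven_oddThetaMul)

lemma evenComb_toPushforward (θ : Γ(Y.odd, f.even ⁻¹ᵁ U)) (p : EvenTheta X U) :
    evenComb (Under.mk (toPushforward f)) θ p.1 p.2 = evalEven f θ p := by
  refine congrArg (· + Y.mul _ (pullOdd f U p.2) θ) ?_
  exact (congrArg (f.even.app U p.1 * ·) (map_one (f.even.app U).hom)).trans (mul_one _)

lemma oddComb_toPushforward (θ : Γ(Y.odd, f.even ⁻¹ᵁ U)) (x : OddTheta X U) :
    oddComb (Under.mk (toPushforward f)) θ x.1 x.2 = evalOdd f θ x := by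
  refine congrArg (f.even.app U x.1 • θ + ·) ?_
  exact (congrArg (· • pullOdd f U x.2) (map_one (f.even.app U).hom)).trans (one_smul _ _)

variable (φ : Under.mk (toPushforward f) ⟶ Under.mk (toPushforward f'))

variable (U) in
/-- The map on even functions. -/
noncomputable def evenMap : Γ(Y.even, f.even ⁻¹ᵁ U) →+ Γ(Z.even, f'.even ⁻¹ᵁ U) :=
  (φ.right.even.app U).hom

variable (U) in
/-- The map on odd functions. -/
noncomputable def oddMap : Γ(Y.odd, f.even ⁻¹ᵁ U) →+ Γ(Z.odd, f'.even ⁻¹ᵁ U) :=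
  (φ.right.odd.app U).hom

lemma evenMap_res (h : V ≤ U) (a : Γ(Y.even, f.even ⁻¹ᵁ U)) :
    evenMap V φ (Y.even.res (f.even.preimage_mono h) a) =
      Z.even.res (f'.even.preimage_mono h) (evenMap U φ a) :=
  φ.right.even.app_res h a

lemma oddMap_res (h : V ≤ U) (a : Γ(Y.odd, f.even ⁻¹ᵁ U)) :
    oddMap V φ (Y.odd.res (f.even.preimage_mono h) a) =
      Z.odd.res (f'.even.preimage_mono h) (oddMap U φ a) :=
  φ.right.odd.app_res h a

lemma evenMap_app (a : Γ(X.even, U)) : evenMap U φ (f.even.app U a) = f'.even.app U a :=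
  congrArg (fun g => g.even.app U a) (Under.w φ)

lemma oddMap_app (s : Γ(X.odd, U)) : oddMap U φ (pullOdd f U s) = pullOdd f' U s :=
  congrArg (fun g => g.odd.app U s) (Under.w φ)

lemma evenMap_evalEven (θ : Γ(Y.odd, f.even ⁻¹ᵁ U)) (p : EvenTheta X U) :
    evenMap U φ (evalEven f θ p) = evalEven f' (oddMap U φ θ) p := by
  rw [← evenComb_toPushforward, ← evenComb_toPushforward]
  exact app_evenComb φ θ p.1 p.2

lemma oddMap_evalOdd (θ : Γ(Y.odd, f.even ⁻¹ᵁ U)) (x : OddTheta X U) :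
    oddMap U φ (evalOdd f θ x) = evalOdd f' (oddMap U φ θ) x := by
  rw [← oddComb_toPushforward, ← oddComb_toPushforward]
  exact app_oddComb φ θ x.1 x.2

/-- Locally, all functions are of the form `a + α θ` and `b θ + β`. -/
lemma exists_eval (hf : HasLocalFrames (Under.mk (toPushforward f))) {x : X.even} (hx : x ∈ U) :
    ∃ (V : X.even.Opens) (_ : V ≤ U), x ∈ V ∧ ∃ θ : Γ(Y.odd, f.even ⁻¹ᵁ V),
      Function.Surjective (evalEven f θ) ∧ Function.Surjective (evalOdd f θ) := by
  obtain ⟨V, hVU, hxV, θ, hθ⟩ := hf.exists_le hx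
  refine ⟨V, hVU, hxV, θ, fun a => ?_, fun a => ?_⟩
  · obtain ⟨b, β, h⟩ := hθ.exists_even a
    exact ⟨(b, β), (evenComb_toPushforward θ (b, β)).symm.trans h.symm⟩
  · obtain ⟨b, β, h⟩ := hθ.exists_odd a
    exact ⟨(b, β), (oddComb_toPushforward θ (b, β)).symm.trans h.symm⟩

/-- A homomorphism of direct images is multiplicative, since it is so on `𝒪[θ]`. -/
lemma evenMap_mul (hf : HasLocalFrames (Under.mk (toPushforward f)))
    (a b : Γ(Y.even, f.even ⁻¹ᵁ U)) :
    evenMap U φ (a * b) = evenMap U φ a * evenMap U φ b := by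
  refine Z.even.eq_of_locally fun z hz => ?_
  obtain ⟨V, hVU, hxV, θ, hθ, hθ'⟩ := exists_eval hf (show f'.even z ∈ U from hz)
  refine ⟨f'.even ⁻¹ᵁ V, f'.even.preimage_mono hVU, hxV, ?_⟩
  obtain ⟨p, hp⟩ := hθ (Y.even.res (f.even.preimage_mono hVU) a)
  obtain ⟨q, hq⟩ := hθ (Y.even.res (f.even.preimage_mono hVU) b)
  rw [map_mul (Z.even.res _), ← evenMap_res φ hVU, ← evenMap_res φ hVU, ← evenMap_res φ hVU,
    map_mul (Y.even.res _), ← hp, ← hq, ← evalEven_mul,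
    evenMap_evalEven, evenMap_evalEven, evenMap_evalEven, evalEven_mul]

lemma oddMap_smul (hf : HasLocalFrames (Under.mk (toPushforward f)))
    (a : Γ(Y.even, f.even ⁻¹ᵁ U)) (x : Γ(Y.odd, f.even ⁻¹ᵁ U)) :
    oddMap U φ (a • x) = evenMap U φ a • oddMap U φ x := by
  refine Z.odd.eq_of_locally fun z hz => ?_
  obtain ⟨V, hVU, hxV, θ, hθ, hθ'⟩ := exists_eval hf (show f'.even z ∈ U from hz)
  refine ⟨f'.even ⁻¹ᵁ V, f'.even.preimage_mono hVU, hxV, ?_⟩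
  obtain ⟨p, hp⟩ := hθ (Y.even.res (f.even.preimage_mono hVU) a)
  obtain ⟨q, hq⟩ := hθ' (Y.odd.res (f.even.preimage_mono hVU) x)
  rw [Scheme.Modules.res_smul, ← evenMap_res φ hVU, ← oddMap_res φ hVU, ← oddMap_res φ hVU,
    Scheme.Modules.res_smul, ← hp, ← hq, ← evalOdd_smul,
    evenMap_evalEven, oddMap_evalOdd, oddMap_evalOdd, evalOdd_smul]

lemma evenMap_odd_mul (hf : HasLocalFrames (Under.mk (toPushforward f)))
    (x y : Γ(Y.odd, f.even ⁻¹ᵁ U)) :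
    evenMap U φ (Y.mul _ x y) = Z.mul _ (oddMap U φ x) (oddMap U φ y) := by
  refine Z.even.eq_of_locally fun z hz => ?_
  obtain ⟨V, hVU, hxV, θ, hθ, hθ'⟩ := exists_eval hf (show f'.even z ∈ U from hz)
  refine ⟨f'.even ⁻¹ᵁ V, f'.even.preimage_mono hVU, hxV, ?_⟩
  obtain ⟨p, hp⟩ := hθ' (Y.odd.res (f.even.preimage_mono hVU) x)
  obtain ⟨q, hq⟩ := hθ' (Y.odd.res (f.even.preimage_mono hVU) y)
  rw [Superscheme.res_mul, ← evenMap_res φ hVU, ← oddMap_res φ hVU, ← oddMap_res φ hVU,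
    Superscheme.res_mul, ← hp, ← hq, ← evalEven_oddThetaMul,
    evenMap_evalEven, oddMap_evalOdd, oddMap_evalOdd, evalEven_oddThetaMul]

lemma evenMap_one : evenMap U φ 1 = 1 :=
  (congrArg (evenMap U φ) (map_one (f.even.app U).hom).symm).trans
    ((evenMap_app φ 1).trans (map_one (f'.even.app U).hom))

variable (U) in
/-- A homomorphism of direct images, on even functions. -/
noncomputable def evenRingMap (hf : HasLocalFrames (Under.mk (toPushforward f))) :
    Γ(Y.even, f.even ⁻¹ᵁ U) →+* Γ(Z.even, f'.even ⁻¹ᵁ U) where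
  __ := evenMap U φ
  map_one' := evenMap_one φ
  map_mul' := evenMap_mul φ hf

/-- Locally, even functions are pulled back from the base up to nilpotents. -/
lemma exists_isNilpotent_sub (hf : HasLocalFrames (Under.mk (toPushforward f))) {x : X.even}
    (hx : x ∈ U) (a : Γ(Y.even, f.even ⁻¹ᵁ U)) :
    ∃ (V : X.even.Opens) (h : V ≤ U), x ∈ V ∧ ∃ b : Γ(X.even, V),
      IsNilpotent (Y.even.res (f.even.preimage_mono h) a - f.even.app V b) := by
  obtain ⟨V, hVU, hxV, θ, hθ, -⟩ := exists_eval hf hx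
  obtain ⟨p, hp⟩ := hθ (Y.even.res (f.even.preimage_mono hVU) a)
  refine ⟨V, hVU, hxV, p.1, 2, ?_⟩
  rw [← hp, evalEven, add_sub_cancel_left, pow_two]
  exact Superscheme.mul_mul_mul_self _ _ _

end SuperExtension

/-! ### Morphisms of fibrations and homomorphisms of direct images -/

namespace SuperExtension

variable {X Y Z : Superscheme.{u}} {f : Y ⟶ X} {f' : Z ⟶ X}
  (φ : Under.mk (toPushforward f) ⟶ Under.mk (toPushforward f'))
  (hf : HasLocalFrames (Under.mk (toPushforward f))) (hp : IsHomeomorph f.even)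

/-- The open subset of the base corresponding to an open subset of the fibration. -/
noncomputable abbrev homBaseOpen (hp : IsHomeomorph f.even) (W : Y.even.Opens) : X.even.Opens :=
  (Opens.map (f.even.invBase hp)).obj W

/-- The morphism of spaces underlying the morphism of fibrations with a given pull-back. -/
noncomputable def homBase (f' : Z ⟶ X) (hp : IsHomeomorph f.even) :
    Z.even.toTopCat ⟶ Y.even.toTopCat :=
  f'.even.base ≫ f.even.invBase hp

lemma homBaseOpen_mono {W W' : Y.even.Opens} (h : W' ≤ W) :
    homBaseOpen hp W' ≤ homBaseOpen hp W :=
  fun _ hx => h hx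

lemma preimage_homBaseOpen (W : Y.even.Opens) : f.even ⁻¹ᵁ homBaseOpen hp W = W :=
  f.even.preimage_map_invBase hp W

/-- Pull-back of even functions along the morphism of fibrations. -/
noncomputable def homEven (W : Y.even.Opens) :
    Γ(Y.even, W) →+* Γ(Z.even, f'.even ⁻¹ᵁ homBaseOpen hp W) :=
  (evenRingMap (homBaseOpen hp W) φ hf).comp (Y.even.res (preimage_homBaseOpen hp W).le)

/-- Pull-back of odd functions along the morphism of fibrations. -/
noncomputable def homOdd (W : Y.even.Opens) :
    Γ(Y.odd, W) →+ Γ(Z.odd, f'.even ⁻¹ᵁ homBaseOpen hp W) :=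
  (oddMap (homBaseOpen hp W) φ).comp (Y.odd.res (preimage_homBaseOpen hp W).le)

lemma homEven_res {W W' : Y.even.Opens} (h : W' ≤ W) (a : Γ(Y.even, W)) :
    homEven φ hf hp W' (Y.even.res h a) =
      Z.even.res (f'.even.preimage_mono (homBaseOpen_mono hp h)) (homEven φ hf hp W a) := by
  change evenMap _ φ (Y.even.res _ _) = Z.even.res _ (evenMap _ φ _)
  rw [← evenMap_res φ (homBaseOpen_mono hp h), Scheme.res_res, Scheme.res_res]

lemma homOdd_res {W W' : Y.even.Opens} (h : W' ≤ W) (a : Γ(Y.odd, W)) :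
    homOdd φ hp W' (Y.odd.res h a) =
      Z.odd.res (f'.even.preimage_mono (homBaseOpen_mono hp h)) (homOdd φ hp W a) := by
  change oddMap _ φ (Y.odd.res _ _) = Z.odd.res _ (oddMap _ φ _)
  rw [← oddMap_res φ (homBaseOpen_mono hp h), Scheme.Modules.res_res, Scheme.Modules.res_res]

lemma homOdd_smul {W : Y.even.Opens} (a : Γ(Y.even, W)) (x : Γ(Y.odd, W)) :
    homOdd φ hp W (a • x) = homEven φ hf hp W a • homOdd φ hp W x := by
  change oddMap _ φ (Y.odd.res _ (a • x)) = _
  rw [Scheme.Modules.res_smul, oddMap_smul φ hf]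
  rfl

lemma homEven_mul {W : Y.even.Opens} (x y : Γ(Y.odd, W)) :
    homEven φ hf hp W (Y.mul W x y) = Z.mul _ (homOdd φ hp W x) (homOdd φ hp W y) := by
  change evenMap _ φ (Y.even.res _ _) = _
  rw [Superscheme.res_mul, evenMap_odd_mul φ hf]
  rfl

/-- The morphism of ringed spaces underlying the morphism of fibrations. -/
noncomputable def homPresheafed : Z.even.toPresheafedSpace ⟶ Y.even.toPresheafedSpace where
  base := homBase f' hp
  c :=
    { app := fun W => CommRingCat.ofHom (homEven φ hf hp W.unop)
      naturality := fun W W' i => by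
        ext a
        exact homEven_res φ hf hp i.unop.le a }

lemma _root_.AlgebraicGeometry.Scheme.mem_basicOpen_iff_of_isNilpotent_sub {S : Scheme.{u}}
    {U V : S.Opens} (h : V ≤ U) {x : S} (hx : x ∈ V) {a : Γ(S, U)} {b : Γ(S, V)}
    (hn : IsNilpotent (S.res h a - b)) : x ∈ S.basicOpen a ↔ x ∈ S.basicOpen b := by
  let g := (S.presheaf.germ V x hx).hom
  have hg : S.presheaf.germ U x (h hx) a = g (S.res h a) :=
    (S.presheaf.germ_res_apply (homOfLE h) x hx a).symm
  rw [S.mem_basicOpen _ x (h hx), S.mem_basicOpen _ x hx, hg]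
  change IsUnit (g _) ↔ IsUnit (g b)
  have h₂ := hn.map g
  rw [map_sub] at h₂
  constructor
  · intro h₃
    have := h₂.neg.isUnit_add_left_of_commute h₃ (Commute.all _ _)
    rwa [neg_sub, add_sub_cancel] at this
  · intro h₃
    have := h₂.isUnit_add_left_of_commute h₃ (Commute.all _ _)
    rwa [add_sub_cancel] at this

/-- Modulo nilpotents, functions on the fibration are functions on the base, so the morphism is
local because the projections are. -/
lemma isLocalHom_stalkMap (z : Z.even) :
    IsLocalHom ((homPresheafed φ hf hp).stalkMap z).hom := by
  constructor
  intro s hs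
  obtain ⟨W, hW, a, rfl⟩ := Y.even.presheaf.exists_germ_eq s
  have hxW : f'.even z ∈ homBaseOpen hp W := hW
  have hs' : z ∈ Z.even.basicOpen (homEven φ hf hp W a) := by
    refine (Z.even.mem_basicOpen _ z hxW).2 ?_
    have h := PresheafedSpace.stalkMap_germ_apply (homPresheafed φ hf hp) W z hW a
    exact h ▸ hs
  -- Near the given point `a` is, up to a nilpotent, the pull-back of a function `b` on the base,
  -- and so is its image under `φ`. Both are thus invertible over the points where `b` is.
  obtain ⟨V, hV, hxV, b, hb⟩ := exists_isNilpotent_sub hf hxW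
    (Y.even.res (preimage_homBaseOpen hp W).le a)
  have hb' : IsNilpotent (Z.even.res (f'.even.preimage_mono hV) (homEven φ hf hp W a) -
      f'.even.app V b) := by
    have h := hb.map (evenRingMap V φ hf)
    rw [map_sub] at h
    have h₁ := evenMap_res φ hV (Y.even.res (preimage_homBaseOpen hp W).le a)
    have h₂ := evenMap_app φ b
    exact h₁ ▸ h₂ ▸ h
  rw [Scheme.mem_basicOpen_iff_of_isNilpotent_sub (f'.even.preimage_mono hV) (x := z) hxV hb',
    ← Scheme.preimage_basicOpen] at hs'
  have hy : f.even (f.even.invBase hp (f'.even z)) = f'.even z := f.even.apply_invBase hp _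
  rw [Scheme.res_res] at hb
  have hyV : f.even.invBase hp (f'.even z) ∈ f.even ⁻¹ᵁ V := by
    change f.even _ ∈ V
    rwa [hy]
  refine (Y.even.mem_basicOpen _ _ hW).1
    ((Scheme.mem_basicOpen_iff_of_isNilpotent_sub (preimage_homBaseOpen hp W ▸
      f.even.preimage_mono hV) hyV hb).2 ?_)
  rw [← Scheme.preimage_basicOpen]
  change f.even _ ∈ X.even.basicOpen b
  rw [hy]
  exact hs'

/-- The morphism of schemes underlying the morphism of fibrations. -/
noncomputable def homScheme : Z.even ⟶ Y.even :=
  ⟨homPresheafed φ hf hp, isLocalHom_stalkMap φ hf hp⟩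

/-- The morphism of fibrations with a given pull-back of functions. -/
noncomputable def homOfDirectImage : Z ⟶ Y :=
  Superscheme.Hom.mk (X := Z) (Y := Y) (homScheme φ hf hp)
    (Scheme.Modules.homMk
      (fun W => LinearMap.mk
        (M₂ := Γ((Scheme.Modules.pushforward (homScheme φ hf hp)).obj Z.odd, W))
        ⟨homOdd φ hp W, map_add (homOdd φ hp W)⟩ (homOdd_smul φ hf hp))
      (homOdd_res φ hp))
    (homEven_mul φ hf hp)

end SuperExtension

namespace Superscheme

variable {Y Z : Superscheme.{u}}

/-- Morphisms of superschemes are determined by the map of spaces and the pull-back of functions. -/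
lemma hom_ext_of_base {g g' : Z ⟶ Y} (hb : g.even.base = g'.even.base)
    (he : ∀ (W : Y.even.Opens) (a : Γ(Y.even, W)) (h : g'.even ⁻¹ᵁ W ≤ g.even ⁻¹ᵁ W),
      Z.even.res h (g.even.app W a) = g'.even.app W a)
    (ho : ∀ (W : Y.even.Opens) (a : Γ(Y.odd, W)) (h : g'.even ⁻¹ᵁ W ≤ g.even ⁻¹ᵁ W),
      Z.odd.res h (pullOdd g W a) = pullOdd g' W a) : g = g' := by
  obtain ⟨e, o, _⟩ := g
  obtain ⟨e', o', _⟩ := g'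
  obtain rfl : e = e' := Scheme.Hom.ext hb fun W => by
    ext a
    exact he W a (by
      change e' ⁻¹ᵁ W ≤ e ⁻¹ᵁ W
      rw [show e' ⁻¹ᵁ W = (Opens.map e'.base).obj W from rfl, ← hb])
  obtain rfl : o = o' := Scheme.Modules.hom_ext _ _ fun W => by
    ext a
    exact (Z.odd.res_self le_rfl _).symm.trans (ho W a le_rfl)
  rfl

end Superscheme

namespace SuperExtension

variable {X Y Z : Superscheme.{u}} {f : Y ⟶ X} {f' : Z ⟶ X}
  (φ : Under.mk (toPushforward f) ⟶ Under.mk (toPushforward f'))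
  (hf : HasLocalFrames (Under.mk (toPushforward f))) (hp : IsHomeomorph f.even)

lemma map_homBaseOpen (U : X.even.Opens) : homBaseOpen hp (f.even ⁻¹ᵁ U) = U :=
  f.even.map_invBase_preimage hp U

/-- Pull-back of even functions over an open subset of the base. -/
lemma res_homEven_preimage (U : X.even.Opens) (a : Γ(Y.even, f.even ⁻¹ᵁ U))
    (h : f'.even ⁻¹ᵁ U ≤ f'.even ⁻¹ᵁ homBaseOpen hp (f.even ⁻¹ᵁ U)) :
    Z.even.res h (homEven φ hf hp (f.even ⁻¹ᵁ U) a) = evenMap U φ a := by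
  have h₁ := evenMap_res φ (map_homBaseOpen hp U).ge
    (Y.even.res (preimage_homBaseOpen hp (f.even ⁻¹ᵁ U)).le a)
  rw [Scheme.res_res, Scheme.res_self] at h₁
  exact h₁.symm

lemma res_homOdd_preimage (U : X.even.Opens) (a : Γ(Y.odd, f.even ⁻¹ᵁ U))
    (h : f'.even ⁻¹ᵁ U ≤ f'.even ⁻¹ᵁ homBaseOpen hp (f.even ⁻¹ᵁ U)) :
    Z.odd.res h (homOdd φ hp (f.even ⁻¹ᵁ U) a) = oddMap U φ a := by
  have h₁ := oddMap_res φ (map_homBaseOpen hp U).ge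
    (Y.odd.res (preimage_homBaseOpen hp (f.even ⁻¹ᵁ U)).le a)
  rw [Scheme.Modules.res_res, Scheme.Modules.res_self] at h₁
  exact h₁.symm

lemma homOfDirectImage_comp : homOfDirectImage φ hf hp ≫ f = f' := by
  refine Superscheme.hom_ext_of_base ?_ (fun U a h => ?_) (fun U a h => ?_)
  · ext z
    exact f.even.apply_invBase hp (f'.even z)
  · exact (res_homEven_preimage φ hf hp U (f.even.app U a) h).trans (evenMap_app φ a)
  · exact (res_homOdd_preimage φ hp U (Superscheme.pullOdd f U a) h).trans (oddMap_app φ a)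

lemma pushforwardUnitMap_homOfDirectImage :
    pushforwardUnitMap f' f (homOfDirectImage φ hf hp) (homOfDirectImage_comp φ hf hp) =
      φ.right :=
  SuperModule.hom_ext (fun U a => res_homEven_preimage φ hf hp U a _)
    (fun U a => res_homOdd_preimage φ hp U a _)

/-- A morphism into a fibration is determined by the pull-back of functions on direct images. -/
lemma hom_eq_of_pushforwardUnitMap_eq (hp : IsHomeomorph f.even) {k k' : Z ⟶ Y} (hk : k ≫ f = f')
    (hk' : k' ≫ f = f')
    (h : pushforwardUnitMap f' f k hk = pushforwardUnitMap f' f k' hk') : k = k' := by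
  have hb : k.even.base = k'.even.base := by
    ext z
    apply hp.injective
    exact (congrArg (fun g : Z ⟶ X => g.even z) hk).trans
      (congrArg (fun g : Z ⟶ X => g.even z) hk').symm
  have hW (W : Y.even.Opens) : ∃ U, f.even ⁻¹ᵁ U = W := ⟨_, preimage_homBaseOpen hp W⟩
  refine Superscheme.hom_ext_of_base hb (fun W a hle => ?_) (fun W a hle => ?_)
  · obtain ⟨U, rfl⟩ := hW W
    have h₁ := congrArg (fun g => g.even.app U a) h
    have h₂ := congrArg (Z.even.res (even_preimage hk' U).ge) h₁
    refine Eq.trans ?_ (h₂.trans ?_)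
    · exact (Z.even.res_res _ _ _).symm
    · exact (Z.even.res_res _ _ _).trans (Z.even.res_self _ _)
  · obtain ⟨U, rfl⟩ := hW W
    have h₁ := congrArg (fun g => g.odd.app U a) h
    have h₂ := congrArg (Z.odd.res (even_preimage hk' U).ge) h₁
    refine Eq.trans ?_ (h₂.trans ?_)
    · exact (Z.odd.res_res _ _ _).symm
    · exact (Z.odd.res_res _ _ _).trans (Z.odd.res_self _ _)

end SuperExtension

namespace IsA01Fibration

variable {X Y : Superscheme.{u}} {f : Y ⟶ X}

lemma isHomeomorph (hf : IsA01Fibration f) : IsHomeomorph f.even := by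
  choose U hx hU using hf
  have hcov : IsOpenCover U := IsOpenCover.mk
    (eq_top_iff.2 fun x _ => Opens.mem_iSup.2 ⟨x, hx x⟩)
  rw [hcov.isHomeomorph_iff_restrictPreimage f.even.continuous]
  exact fun x => (hU x).1

lemma hasLocalFrames (hf : IsA01Fibration f) :
    SuperExtension.HasLocalFrames (Under.mk (toPushforward f)) := fun x => by
  obtain ⟨U, hx, _, θ, hθ⟩ := hf x
  exact ⟨U, hx, θ, (SuperExtension.isFrame_toPushforward_iff f θ).2 hθ⟩

lemma isBundleExtension (hf : IsA01Fibration f) : IsBundleExtension (Under.mk (toPushforward f)) :=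
  SuperExtension.isBundleExtension_iff.2 hf.hasLocalFrames

end IsA01Fibration

/-! ### Fibrations and bundle extensions -/

namespace SuperExtension

variable {X Y Z : Superscheme.{u}} {f : Y ⟶ X} {f' : Z ⟶ X}

/-- The composite of the morphisms with given pull-backs is the identity when the pull-backs
are inverse to each other. -/
lemma homOfDirectImage_comp_homOfDirectImage (hf : IsA01Fibration f) (hf' : IsA01Fibration f')
    (φ : Under.mk (toPushforward f) ≅ Under.mk (toPushforward f')) :
    homOfDirectImage φ.hom hf.hasLocalFrames hf.isHomeomorph ≫
      homOfDirectImage φ.inv hf'.hasLocalFrames hf'.isHomeomorph = 𝟙 Z := by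
  have h := homOfDirectImage_comp φ.hom hf.hasLocalFrames hf.isHomeomorph
  have h' := homOfDirectImage_comp φ.inv hf'.hasLocalFrames hf'.isHomeomorph
  refine hom_eq_of_pushforwardUnitMap_eq hf'.isHomeomorph
    ((Category.assoc _ _ _).trans ((congrArg _ h').trans h)) (Category.id_comp f') ?_
  refine (pushforwardUnitMap_comp f' f f' _ _ h h' _).trans ?_
  rw [pushforwardUnitMap_homOfDirectImage, pushforwardUnitMap_homOfDirectImage,
    pushforwardUnitMap_id]
  exact congrArg (fun k => k.right) φ.inv_hom_id

/-- An isomorphism of the extensions defined by two fibrations comes from an isomorphism of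
the fibrations. -/
noncomputable def fibrationIso (hf : IsA01Fibration f) (hf' : IsA01Fibration f')
    (φ : Under.mk (toPushforward f) ≅ Under.mk (toPushforward f')) : Over.mk f' ≅ Over.mk f :=
  Over.isoMk
    ⟨homOfDirectImage φ.hom hf.hasLocalFrames hf.isHomeomorph,
      homOfDirectImage φ.inv hf'.hasLocalFrames hf'.isHomeomorph,
      homOfDirectImage_comp_homOfDirectImage hf hf' φ,
      homOfDirectImage_comp_homOfDirectImage hf' hf φ.symm⟩
    (homOfDirectImage_comp φ.hom hf.hasLocalFrames hf.isHomeomorph)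

end SuperExtension

namespace A01Fibration

variable (X : Superscheme.{u})

/-- The functor sending a fibration `π : Y ⟶ X` to the bundle extension `𝒪_X → π_* 𝒪_Y`. -/
noncomputable def functor : A01Fibration X ⥤ BundleExtension X :=
  Core.functorToCore (ObjectProperty.lift _ (directImage X) fun Y =>
    Y.of.property.isBundleExtension)

variable {X}

instance : (functor X).Faithful where
  map_injective {Y Z g g'} h := by
    have h₁ : pushforwardUnitMap Z.of.obj.hom Y.of.obj.hom g.iso.inv.hom.left
        (Over.w g.iso.inv.hom) =
        pushforwardUnitMap Z.of.obj.hom Y.of.obj.hom g'.iso.inv.hom.left (Over.w g'.iso.inv.hom) :=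
      congrArg (fun k => ((BundleExtension.forget X).map k).right) h
    have h₂ := SuperExtension.hom_eq_of_pushforwardUnitMap_eq Y.of.property.isHomeomorph _ _ h₁
    have h₃ : g.iso.inv = g'.iso.inv :=
      ObjectProperty.hom_ext _ (Over.OverMorphism.ext h₂)
    exact Core.hom_ext (by rw [← cancel_mono g'.iso.inv, Iso.hom_inv_id, ← h₃, Iso.hom_inv_id])

instance : (functor X).Full where
  map_surjective {Y Z} φ := by
    let φ' : Under.mk (toPushforward Y.of.obj.hom) ≅ Under.mk (toPushforward Z.of.obj.hom) :=
      (ObjectProperty.ι _).mapIso φ.iso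
    let k := SuperExtension.fibrationIso Y.of.property Z.of.property φ'
    -- An isomorphism acts by pull-back along its inverse.
    refine ⟨⟨ObjectProperty.isoMk _ (k.symm : Y.of.obj ≅ Z.of.obj)⟩,
      Core.hom_ext (ObjectProperty.hom_ext _ (Under.UnderMorphism.ext ?_))⟩
    exact SuperExtension.pushforwardUnitMap_homOfDirectImage φ'.hom
      Y.of.property.hasLocalFrames Y.of.property.isHomeomorph

instance : (functor X).EssSurj where
  mem_essImage E := by
    obtain ⟨P, ⟨i⟩⟩ := (inferInstance : (LineTorsorPair.extensionFunctor X).EssSurj).mem_essImage E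
    let c := P.of.cocycle
    let j : c.ext ≅ E.of.obj := (ObjectProperty.ι _).mapIso ((Core.inclusion _).mapIso i)
    exact ⟨⟨⟨Over.mk c.totalProj, c.isA01Fibration_totalProj⟩⟩, ⟨(Groupoid.isoEquivHom _ _).symm
      ⟨ObjectProperty.isoMk _ (c.extIsoDirectImage.symm ≪≫ j :
        Under.mk (toPushforward c.totalProj) ≅ E.of.obj)⟩⟩⟩

instance : (functor X).IsEquivalence where

end A01Fibration

theorem mainTheorem12 (X : Superscheme.{u}) :
    ∃ (F : A01Fibration X ≌ LineTorsor X) (G : LineTorsor X ≌ BundleExtension X),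
      Nonempty (F.functor ⋙ G.functor ⋙ BundleExtension.forget X ≅ A01Fibration.directImage X) ∧
      ∃ A : ∀ P : LineTorsor X,
          AssociatedExtension P.of ((BundleExtension.forget X).obj (G.functor.obj P)),
        ∀ (P Q : LineTorsor X) (f : P ⟶ Q) (U : X.even.Opens) (t : P.of.sec U)
          (e : Γ(P.of.line.even, U)) (he : P.of.line.IsGenerator U e)
          (he' : Q.of.line.IsGenerator U (f.iso.hom.line.even.app U e)),
          ((BundleExtension.forget X).map (G.functor.map f)).right.odd.app U
              ((A P).coord t e he) =
            (A Q).coord (f.iso.hom.torsor.app (op U) t) (f.iso.hom.line.even.app U e) he' := by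
  let G := (LineTorsorPair.extensionFunctor X).asEquivalence
  -- The composite of both equivalences is the direct image functor by the counit of `G`.
  refine ⟨(A01Fibration.functor X).asEquivalence.trans G.symm, G,
    ⟨Functor.isoWhiskerLeft (A01Fibration.functor X)
      (Functor.isoWhiskerRight G.counitIso (BundleExtension.forget X))⟩,
    fun P => P.of.associatedExtension, fun P Q f U t e he he' => ?_⟩
  exact LineTorsorPair.extensionMap_coord f.iso U t e he he'
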